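/- Let $l\in[-\tfrac12,\infty)$ and let $q:(0,1)\to\mathbb R$ be measurable. Set $\tilde q(x)=|q(x)|$ if $l>-\tfrac12$ and $\tilde q(x)=(1-\log x)|q(x)|$ if $l=-\tfrac12$, and suppose that $x\tilde q(x)\in L^1(0,1)$. Let $H=-\frac{d^2}{dx^2}+\frac{l(l+1)}{x^2}+q(x)$. For $z\in\mathbb C$ and $x>0$ let $$\phi_l(z,x)=z^{-\frac{2l+1}{4}}\sqrt{\tfrac{\pi x}{2}}\,J_{l+\frac12}(\sqrt z\,x),$$ $$\theta_l(z,x)=-z^{\frac{2l+1}{4}}\sqrt{\tfrac{\pi x}{2}}\begin{cases}\frac{-1}{\sin((l+\frac12)\pi)}J_{-l-\frac12}(\sqrt z\,x),& l+\tfrac12\notin\mathbb N_0,\\ Y_{l+\frac12}(\sqrt z\,x)-\frac1\pi\log(z)\,J_{l+\frac12}(\sqrt z\,x),& l+\tfrac12\in\mathbb N_0,\end{cases}$$ where $J$, $Y$ are the Bessel and Neumann functions, all branches are principal, and the values at the removable singularity $z=0$ are the limits; and let $$G_l(z,x,y)=\phi_l(z,x)\theta_l(z,y)-\phi_l(z,y)\theta_l(z,x).$$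 Primes denote derivatives with respect to $x$ (the left derivative at $x=1$). Then there is a function $\phi:\mathbb C\times(0,1]\to\mathbb C$ with the following properties. 1. For each $z\in\mathbb C$, $\phi(z,\cdot)$ is a solution of $Hf=zf$: it is differentiable on $(0,1]$, its derivative is absolutely continuous on $[a,1]$ for every $a\in(0,1)$, and the equation holds almost everywhere in $(0,1)$. 2. For each $x\in(0,1]$, $z\mapsto\phi(z,x)$ is entire. 3. For all $z\in\mathbb C$ and $x\in(0,1]$, $$\phi(z,x)=\phi_l(z,x)+\int_0^x G_l(z,x,y)q(y)\phi(z,y)\,dy,$$ $$\phi'(z,x)=\phi_l'(z,x)+\int_0^x \frac{\partial G_l}{\partial x}(z,x,y)q(y)\phi(z,y)\,dy,$$ where both integrands are Lebesgue integrable on $(0,x)$. 4. There is a constant $C$, independent of $z$ and $x$, such that for all $z\in\mathbb C$ and $x\in(0,1]$ $$|\phi(z,x)-\phi_l(z,x)|\le C\Big(\frac{x}{1+|z|^{1/2}x}\Big)^{l+1}e^{|\mathrm{Im}(z^{1/2})|x}\int_0^x\frac{y\tilde q(y)}{1+|z|^{1/2}y}\,dy,$$ $$|\phi'(z,x)-\phi_l'(z,x)|\le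 C\Big(\frac{x}{1+|z|^{1/2}x}\Big)^{l}e^{|\mathrm{Im}(z^{1/2})|x}\int_0^x\frac{y\tilde q(y)}{1+|z|^{1/2}y}\,dy.$$ -/

import Mathlib

noncomputable section

namespace SphericalSchrodinger

/-- The Bessel function `J_ν(w)` of real order `ν`, principal branch of `(w / 2) ^ ν`.  At the
poles of `Γ` Mathlib's `Γ` is `0`, so that `1 / Γ` is the (entire) reciprocal Gamma function. -/
def besselJ (ν : ℝ) (w : ℂ) : ℂ :=
  (w / 2) ^ (ν : ℂ) *
    ∑' k : ℕ, (-1) ^ k / ((k.factorial : ℂ) * (Real.Gamma (ν + k + 1) : ℂ)) * (w / 2) ^ (2 * k)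

/-- `ψ(m + 1) = H_m - γ`, the digamma function at the positive integer `m + 1`. -/
def digammaSucc (m : ℕ) : ℝ := (harmonic m : ℝ) - Real.eulerMascheroniConstant

/-- The Neumann function `Y_n(w)` of integer order `n ≥ 0`, principal branch of `log (w / 2)`. -/
def neumannY (n : ℕ) (w : ℂ) : ℂ :=
  2 / (Real.pi : ℂ) * Complex.log (w / 2) * besselJ n w
    - 1 / (Real.pi : ℂ) * ∑ k ∈ Finset.range n,
        ((n - k - 1).factorial : ℂ) / (k.factorial : ℂ) * ((w / 2) ^ (2 * k) / (w / 2) ^ n)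
    - 1 / (Real.pi : ℂ) * ∑' k : ℕ,
        ((digammaSucc k + digammaSucc (n + k) : ℝ) : ℂ) * (-1) ^ k
          / ((k.factorial : ℂ) * ((n + k).factorial : ℂ)) * (w / 2) ^ (2 * k + n)

/-- The principal branch of `√z`. -/
def csqrt (z : ℂ) : ℂ := z ^ (1 / 2 : ℂ)

/-- `φ_l(z, x) = z^{-(2l+1)/4} √(πx/2) J_{l+1/2}(√z x)`; at the removable singularity `z = 0` the
value is the limit `√π x^{l+1} / (Γ(l+3/2) 2^{l+1})`. -/
def phiFree (l : ℝ) (z : ℂ) (x : ℝ) : ℂ :=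
  if z = 0 then
    ((Real.sqrt Real.pi / (Real.Gamma (l + 3 / 2) * 2 ^ (l + 1)) * x ^ (l + 1) : ℝ) : ℂ)
  else
    z ^ (-((2 * l + 1) / 4 : ℝ) : ℂ) * (Real.sqrt (Real.pi * x / 2) : ℂ)
      * besselJ (l + 1 / 2) (csqrt z * x)

open Classical in
/-- The second solution `θ_l(z, x)`, that is, `-z^{(2l+1)/4} √(πx/2)` times
`-J_{-l-1/2}(√z x) / sin((l+1/2)π)` if `l + 1/2` is not an integer, and times
`Y_{l+1/2}(√z x) - (1/π) log(z) J_{l+1/2}(√z x)` if `l + 1/2` is an integer `≥ 0`;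
at the removable singularity `z = 0` the value is the limit. -/
def thetaFree (l : ℝ) (z : ℂ) (x : ℝ) : ℂ :=
  if z = 0 then
    if l = -1 / 2 then
      ((Real.sqrt (2 * x / Real.pi)
        * (Real.log 2 - Real.eulerMascheroniConstant - Real.log x) : ℝ) : ℂ)
    else
      ((Real.Gamma (l + 3 / 2) * 2 ^ (l + 1) / (Real.sqrt Real.pi * (2 * l + 1))
        * x ^ (-l) : ℝ) : ℂ)
  else
    -(z ^ (((2 * l + 1) / 4 : ℝ) : ℂ)) * (Real.sqrt (Real.pi * x / 2) : ℂ) *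
      if ∃ n : ℕ, l + 1 / 2 = n then
        neumannY ⌊l + 1 / 2⌋₊ (csqrt z * x)
          - 1 / (Real.pi : ℂ) * Complex.log z * besselJ (l + 1 / 2) (csqrt z * x)
      else
        -1 / (Real.sin ((l + 1 / 2) * Real.pi) : ℂ) * besselJ (-l - 1 / 2) (csqrt z * x)

/-- `G_l(z, x, y) = φ_l(z, x) θ_l(z, y) - φ_l(z, y) θ_l(z, x)`. -/
def green (l : ℝ) (z : ℂ) (x y : ℝ) : ℂ :=
  phiFree l z x * thetaFree l z y - phiFree l z y * thetaFree l z x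

/-- The derivative of a function on `(0, 1]`; at `x = 1` it is the left derivative. -/
def ddx (f : ℝ → ℂ) (x : ℝ) : ℂ := derivWithin f (Set.Ioc 0 1) x

/-- `q̃`. -/
def qTilde (l : ℝ) (q : ℝ → ℝ) (x : ℝ) : ℝ :=
  if l = -1 / 2 then (1 - Real.log x) * |q x| else |q x|

/-- `f` solves `-f'' + (l(l+1)/x² + q) f = z f`: `f` is differentiable on `(0, 1]`, `f'` is
absolutely continuous on each `[a, 1]` with `0 < a < 1`, and the equation holds almost
everywhere in `(0, 1)`. -/
structure IsSolution (l : ℝ) (q : ℝ → ℝ) (z : ℂ) (f : ℝ → ℂ) : Prop where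
  differentiable : DifferentiableOn ℝ f (Set.Ioc 0 1)
  absolutelyContinuous : ∀ a : ℝ, 0 < a → a < 1 → AbsolutelyContinuousOnInterval (ddx f) a 1
  equation : ∀ᵐ x ∂(MeasureTheory.volume.restrict (Set.Ioo (0 : ℝ) 1)),
    -ddx (ddx f) x + ((l * (l + 1) / x ^ 2 + q x : ℝ) : ℂ) * f x = z * f x

/-- `∫₀ˣ y q̃(y) / (1 + |z|^{1/2} y) dy`. -/
def errorIntegral (l : ℝ) (q : ℝ → ℝ) (z : ℂ) (x : ℝ) : ℝ :=
  ∫ y in (0 : ℝ)..x, y * qTilde l q y / (1 + Real.sqrt ‖z‖ * y)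

end SphericalSchrodinger

end

noncomputable section

namespace SphericalSchrodinger

open MeasureTheory Set Filter Topology

/-! The solution is the Neumann series `∑ Tⁿ φ_l` of the Volterra operator `(T f)(x) = ∫₀ˣ G_l(z, x,
y) q(y) f(y) dy`. All depends on free bounds with constants independent of `z`. Put `w(x) = x / (1 +
|z|^{1/2} x)`. Then `φ_l` is bounded by `w(x)^{l+1} e^{|Im √z| x}`, and `G_l`, `∂ₓ G_l` by `w(x)^s
w(y)^{-l} e^{|Im √z| (x-y)}` with `s = l + 1`, `l`, times a logarithm of `y` if `l = -1/2`. In `T f`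
the weights at `y` multiply to `w(y) ≤ y`, so the `n`-th iterate is at most the weight of `φ_l`
times `C₀ (C I(x))ⁿ / n!`, where `I(x) = ∫₀ˣ y q̃(y) dy` (`Frobenius.admissible_volterra`). The
series converges locally uniformly in `z` and inherits analyticity; putting its bound back into the
integral equation gives both error estimates (`norm_integral_kernel_le`).

The free bounds use no Bessel asymptotics. The free solutions are `φ_l = x^{l+1} S(z x²)` and `θ_l =
x^{-l} A(z x²) + c zⁿ log(x/2) φ_l` with `S`, `A` entire (`nonempty_frobenius`), and their Wronskian
is `1` (`frobenius_wronskian`). Hence `G_l(z, ·, y)` is the free solution with Cauchy data `(0, 1)`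
at `y`. Up to the turning point `|z|^{-1/2}` it is controlled by a rescaled first order system
(`exists_bound_small`), beyond it by the energy `|u'|² + |z| |u|²` (`FreeSol.energy`);
`Frobenius.exists_green_bound` combines the two.

For the differential equation, splitting `G_l` writes the solution as `φ_l (1 + A) - θ_l B` with
absolutely continuous `A`, `B`, as in variation of constants (`Frobenius.isSolution`). -/

/-! ### Entire power series and the Euler operator `ζ d/dζ` -/

/-- The coefficients of an everywhere convergent power series. -/
def EntireCoeff (c : ℕ → ℂ) : Prop := ∀ r : ℝ, 0 ≤ r → Summable fun k => ‖c k‖ * r ^ k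

/-- The sum of a power series. -/
def powerSum (c : ℕ → ℂ) (ζ : ℂ) : ℂ := ∑' k, c k * ζ ^ k

/-- `F` is entire and `ζ F'(ζ) = F₁(ζ)`. -/
structure EulerPair (F F₁ : ℂ → ℂ) : Prop where
  differentiable : Differentiable ℂ F
  euler : ∀ ζ, ζ * deriv F ζ = F₁ ζ

lemma EntireCoeff.hasSum {c : ℕ → ℂ} (hc : EntireCoeff c) (ζ : ℂ) :
    HasSum (fun k => c k * ζ ^ k) (powerSum c ζ) := by
  refine Summable.hasSum (Summable.of_norm ?_)
  simpa using hc ‖ζ‖ (norm_nonneg _)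

lemma EntireCoeff.mul_index {c : ℕ → ℂ} (hc : EntireCoeff c) :
    EntireCoeff fun k => (k : ℂ) * c k := by
  intro r hr
  refine Summable.of_nonneg_of_le (fun k => by positivity) (fun k => ?_) (hc (2 * r) (by positivity))
  have h : (k : ℝ) ≤ 2 ^ k := by exact_mod_cast k.lt_two_pow_self.le
  rw [norm_mul, Complex.norm_natCast, mul_pow]
  calc (k : ℝ) * ‖c k‖ * r ^ k ≤ 2 ^ k * ‖c k‖ * r ^ k := by gcongr
    _ = _ := by ring

/-- Termwise differentiation, justified by uniform convergence of the differentiated series on a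
ball of radius `|ζ| + 1`. -/
lemma EntireCoeff.eulerPair {c : ℕ → ℂ} (hc : EntireCoeff c) :
    EulerPair (powerSum c) (powerSum fun k => (k : ℂ) * c k) := by
  have key : ∀ ζ : ℂ, HasDerivAt (powerSum c) (∑' k : ℕ, c k * (k * ζ ^ (k - 1))) ζ := by
    intro ζ
    set R : ℝ := ‖ζ‖ + 1 with hR
    -- `R ≥ 1` makes `R ^ (k - 1) ≤ R ^ k` valid also at `k = 0`, where `k - 1` is `0`.
    have hR1 : 1 ≤ R := by have := norm_nonneg ζ; linarith
    have hmem : ζ ∈ Metric.ball (0 : ℂ) R := by simp [hR]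
    refine hasDerivAt_tsum_of_isPreconnected (hc.mul_index R (by linarith)) Metric.isOpen_ball
      (convex_ball _ _).isPreconnected (fun k y _ => (hasDerivAt_pow k y).const_mul (c k))
      (fun k y hy => ?_) hmem (hc.hasSum ζ).summable hmem
    have hy' : ‖y‖ ≤ R := by simpa using (Metric.mem_ball.1 hy).le
    rw [norm_mul, norm_mul, norm_pow, norm_mul, Complex.norm_natCast]
    calc ‖c k‖ * (k * ‖y‖ ^ (k - 1)) ≤ ‖c k‖ * (k * R ^ (k - 1)) := by gcongr
      _ ≤ ‖c k‖ * (k * R ^ k) := by gcongr; omega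
      _ = _ := by ring
  refine ⟨fun ζ => (key ζ).differentiableAt, fun ζ => ?_⟩
  rw [(key ζ).deriv, ← tsum_mul_left]
  refine tsum_congr fun k => ?_
  rcases k with _ | k
  · simp
  · push_cast
    rw [pow_succ]
    ring

/-- A recurrence `aₖ = bₖ aₖ₊₁` with `|bₖ| → ∞` forces an entire series. -/
lemma entireCoeff_of_recurrence {a b : ℕ → ℂ} (hb : Tendsto (fun k => ‖b k‖) atTop atTop)
    (h : ∀ k, b k * a (k + 1) = -a k) : EntireCoeff a := by
  intro r hr
  refine summable_of_ratio_norm_eventually_le (r := 1 / 2) (by norm_num) ?_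
  filter_upwards [hb.eventually_ge_atTop (2 * r + 1)] with k hk
  have h1 : ‖a k‖ = ‖b k‖ * ‖a (k + 1)‖ := by rw [← norm_mul, h, norm_neg]
  rw [norm_mul, norm_mul, norm_norm, norm_norm, norm_pow, norm_pow, Real.norm_of_nonneg hr, h1,
    pow_succ]
  have : r ≤ 1 / 2 * ‖b k‖ := by linarith
  calc ‖a (k + 1)‖ * (r ^ k * r) ≤ ‖a (k + 1)‖ * (r ^ k * (1 / 2 * ‖b k‖)) := by gcongr
    _ = _ := by ring

/-- The coefficients of `ζ ^ n` times a power series. -/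
def shiftCoeff (n : ℕ) (c : ℕ → ℂ) (k : ℕ) : ℂ := if k < n then 0 else c (k - n)

lemma hasSum_shiftCoeff (n : ℕ) {c : ℕ → ℂ} {ζ s : ℂ} (h : HasSum (fun k => c k * ζ ^ k) s) :
    HasSum (fun k => shiftCoeff n c k * ζ ^ k) (ζ ^ n * s) := by
  rw [← hasSum_nat_add_iff' n, Finset.sum_eq_zero, sub_zero]
  · have e : (fun k => shiftCoeff n c (k + n) * ζ ^ (k + n)) = fun k => ζ ^ n * (c k * ζ ^ k) := by
      funext k
      simp only [shiftCoeff, pow_add, Nat.add_sub_cancel]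
      rw [if_neg (by omega)]
      ring
    rw [e]
    exact h.mul_left _
  · intro k hk
    simp [shiftCoeff, Finset.mem_range.1 hk]

lemma EulerPair.continuous {F F₁ : ℂ → ℂ} (h : EulerPair F F₁) : Continuous F :=
  h.differentiable.continuous

lemma EulerPair.div_const {F F₁ : ℂ → ℂ} (h : EulerPair F F₁) (a : ℂ) :
    EulerPair (fun ζ => F ζ / a) fun ζ => F₁ ζ / a :=
  ⟨h.differentiable.div_const a, fun ζ => by rw [deriv_div_const, ← h.euler]; ring⟩

/-- The generalized Wronskian identity for two Frobenius series. -/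
lemma frobenius_wronskian {l : ℝ} {S S₁ S₂ A A₁ A₂ : ℂ → ℂ} {c : ℂ} {n : ℕ}
    (hS : EulerPair S S₁) (hS₁ : EulerPair S₁ S₂) (hA : EulerPair A A₁) (hA₁ : EulerPair A₁ A₂)
    (hcn : c = 0 ∨ l + 1 / 2 = n)
    (eqS : ∀ ζ, 4 * S₂ ζ + (4 * l + 2) * S₁ ζ + ζ * S ζ = 0)
    (eqA : ∀ ζ, 4 * A₂ ζ - (4 * l + 2) * A₁ ζ + ζ * A ζ
      + c * ζ ^ n * ((2 * l + 1) * S ζ + 4 * S₁ ζ) = 0)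
    (h0 : (2 * l + 1) * S 0 * A 0 - c * 0 ^ n * S 0 ^ 2 = 1) (ζ : ℂ) :
    (2 * l + 1) * S ζ * A ζ + 2 * (S₁ ζ * A ζ - S ζ * A₁ ζ) - c * ζ ^ n * S ζ ^ 2 = 1 := by
  -- For `φ = x^{l+1} S(z x²)` and `θ = x^{-l} A(z x²) + c zⁿ log(x/2) φ`, this is `φ' θ - φ θ'` in
  -- the variable `ζ = z x²`.
  set W : ℂ → ℂ := fun ζ => (2 * l + 1) * S ζ * A ζ + 2 * (S₁ ζ * A ζ - S ζ * A₁ ζ)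
    - c * ζ ^ n * S ζ ^ 2 with hW
  have d1 := hS.differentiable
  have d2 := hA.differentiable
  have d3 := hS₁.differentiable
  have d4 := hA₁.differentiable
  have hWd : Differentiable ℂ W := by fun_prop
  have hEuler : ∀ ζ, ζ * deriv W ζ = 0 := by
    intro ζ
    have hd : HasDerivAt W ((2 * l + 1) * deriv S ζ * A ζ + (2 * l + 1) * S ζ * deriv A ζ
        + 2 * (deriv S₁ ζ * A ζ + S₁ ζ * deriv A ζ - (deriv S ζ * A₁ ζ + S ζ * deriv A₁ ζ))
        - (c * (n * ζ ^ (n - 1)) * S ζ ^ 2 + c * ζ ^ n * (2 * S ζ * deriv S ζ))) ζ := by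
      have e1 := (d1 ζ).hasDerivAt
      have e2 := (d2 ζ).hasDerivAt
      have e3 := (d3 ζ).hasDerivAt
      have e4 := (d4 ζ).hasDerivAt
      have := (((e1.const_mul (2 * (l : ℂ) + 1)).mul e2).add
        (((e3.mul e2).sub (e1.mul e4)).const_mul 2)).sub
        (((hasDerivAt_pow n ζ).const_mul c).mul (e1.pow 2))
      exact this.congr_deriv (by simp)
    -- The logarithmic term is present only if `n = l + 1/2`, so `c n` may always be replaced by `c
    -- (l + 1/2)`.
    have hn : ζ * (c * (n * ζ ^ (n - 1))) = c * (l + 1 / 2) * ζ ^ n := by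
      rcases hcn with h | h
      · simp [h]
      · have : (n : ℂ) = l + 1 / 2 := by rw [← Complex.ofReal_natCast, ← h]; push_cast; ring
        rcases n with _ | n
        · rw [← this]; simp
        · rw [← this, Nat.add_sub_cancel, pow_succ]; ring
    rw [hd.deriv]
    have f1 := hS.euler ζ
    have f2 := hA.euler ζ
    have f3 := hS₁.euler ζ
    have f4 := hA₁.euler ζ
    have g1 := eqS ζ
    have g2 := eqA ζ
    linear_combination ((2 * l + 1) * A ζ - 2 * A₁ ζ - 2 * c * ζ ^ n * S ζ) * f1
      + ((2 * l + 1) * S ζ + 2 * S₁ ζ) * f2 + 2 * A ζ * f3 - 2 * S ζ * f4 - S ζ ^ 2 * hn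
      + (1 / 2) * A ζ * g1 - (1 / 2) * S ζ * g2
  -- The Euler operator gives `W' = 0` only off the origin; continuity of `W'` covers `ζ = 0`.
  have hderiv : ∀ ζ, deriv W ζ = 0 := by
    have hc : Continuous (deriv W) := hWd.contDiff.continuous_deriv (n := 1) le_rfl
    have : deriv W = fun _ => 0 := by
      refine Continuous.ext_on (dense_compl_singleton (0 : ℂ)) hc continuous_const fun ζ hζ => ?_
      exact (mul_eq_zero.1 (hEuler ζ)).resolve_left hζ
    exact fun ζ => congrFun this ζ
  have hconst : W ζ = W 0 := is_const_of_deriv_eq_zero hWd hderiv ζ 0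
  have e1 : S₁ 0 = 0 := by rw [← hS.euler 0, zero_mul]
  have e2 : A₁ 0 = 0 := by rw [← hA.euler 0, zero_mul]
  change W ζ = 1
  rw [hconst, ← h0]
  simp only [hW, e1, e2]
  ring

/-! ### Frobenius representation of the free solutions -/

/-- The free solutions are given by Frobenius series. -/
structure Frobenius (l : ℝ) where
  S : ℂ → ℂ
  S₁ : ℂ → ℂ
  S₂ : ℂ → ℂ
  A : ℂ → ℂ
  A₁ : ℂ → ℂ
  A₂ : ℂ → ℂ
  c : ℂ
  n : ℕ
  hS : EulerPair S S₁
  hS₁ : EulerPair S₁ S₂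
  hA : EulerPair A A₁
  hA₁ : EulerPair A₁ A₂
  c_eq_zero_or : c = 0 ∨ l + 1 / 2 = n
  eqS : ∀ ζ, 4 * S₂ ζ + (4 * l + 2) * S₁ ζ + ζ * S ζ = 0
  eqA : ∀ ζ, 4 * A₂ ζ - (4 * l + 2) * A₁ ζ + ζ * A ζ
    + c * ζ ^ n * ((2 * l + 1) * S ζ + 4 * S₁ ζ) = 0
  wronskian_zero : (2 * l + 1) * S 0 * A 0 - c * 0 ^ n * S 0 ^ 2 = 1
  phi_eq : ∀ (z : ℂ) (x : ℝ), 0 < x → phiFree l z x = (x ^ (l + 1) : ℝ) * S (z * x ^ 2)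
  theta_eq : ∀ (z : ℂ) (x : ℝ), 0 < x → thetaFree l z x = (x ^ (-l) : ℝ) * A (z * x ^ 2)
    + c * z ^ n * Real.log (x / 2) * phiFree l z x

/-! ### Principal branches of the square root, logarithm and powers. -/

lemma csqrt_sq (z : ℂ) : csqrt z ^ 2 = z := by
  rw [csqrt, one_div]
  exact_mod_cast Complex.cpow_nat_inv_pow z two_ne_zero

lemma csqrt_ne_zero {z : ℂ} (hz : z ≠ 0) : csqrt z ≠ 0 := by
  intro h
  apply hz
  rw [← csqrt_sq z, h]
  simp

lemma log_csqrt {z : ℂ} (hz : z ≠ 0) : Complex.log (csqrt z) = Complex.log z / 2 := by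
  have h1 := Complex.neg_pi_lt_log_im z
  have h2 := Complex.log_im_le_pi z
  have hpi := Real.pi_pos
  have him : (Complex.log z * (1 / 2)).im = (Complex.log z).im / 2 := by
    rw [show Complex.log z * (1 / 2) = Complex.log z / (2 : ℝ) by push_cast; ring,
      Complex.div_ofReal_im]
  rw [csqrt, Complex.cpow_def_of_ne_zero hz, Complex.log_exp]
  · ring
  · rw [him]; linarith
  · rw [him]; linarith

lemma log_csqrt_mul {z : ℂ} (hz : z ≠ 0) {x : ℝ} (hx : 0 < x) :
    Complex.log (csqrt z * x / 2) = Complex.log z / 2 + Real.log (x / 2) := by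
  rw [show csqrt z * x / 2 = ((x / 2 : ℝ) : ℂ) * csqrt z by push_cast; ring,
    Complex.log_ofReal_mul (by positivity) (csqrt_ne_zero hz), log_csqrt hz]
  ring

/-- No branch correction appears: halving an argument in `(-π, π]` keeps it there, and the factor `x
/ 2` is positive. -/
lemma csqrt_mul_cpow {z : ℂ} (hz : z ≠ 0) {x : ℝ} (hx : 0 < x) (ν : ℝ) :
    (csqrt z * x / 2) ^ (ν : ℂ) = z ^ ((ν / 2 : ℝ) : ℂ) * ((x / 2) ^ ν : ℝ) := by
  have hne : csqrt z * x / 2 ≠ 0 :=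
    div_ne_zero (mul_ne_zero (csqrt_ne_zero hz) (by exact_mod_cast hx.ne')) two_ne_zero
  rw [Complex.cpow_def_of_ne_zero hne, log_csqrt_mul hz hx, Complex.cpow_def_of_ne_zero hz,
    Real.rpow_def_of_pos (by positivity), Complex.ofReal_exp, ← Complex.exp_add]
  congr 1
  push_cast
  ring

/-! ### Bessel series as entire functions of `z x²`. -/

/-- The coefficients of the Bessel series in powers of `z x²`. -/
def jCoeff (ν : ℝ) (k : ℕ) : ℂ :=
  ((Real.sqrt (Real.pi / 2) * 2 ^ (-ν) : ℝ) : ℂ) *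
    ((-1) ^ k / ((k.factorial : ℂ) * (Real.Gamma (ν + k + 1) : ℂ)) / 4 ^ k)

lemma jCoeff_succ (ν : ℝ) (k : ℕ) :
    4 * ((k + 1 : ℕ) : ℂ) * (((k + 1 : ℕ) : ℂ) + ν) * jCoeff ν (k + 1) = -jCoeff ν k := by
  have hk : ((k : ℂ) + 1) ≠ 0 := by exact_mod_cast k.succ_ne_zero
  have hf : (k.factorial : ℂ) ≠ 0 := by exact_mod_cast k.factorial_ne_zero
  -- At `ν + k + 1 = 0` the value `Γ(0) = 0` makes `jCoeff ν k` vanish, and the left side vanishes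
  -- through its own factor `k + 1 + ν`; so the recurrence passes the pole.
  rcases eq_or_ne (ν + k + 1) 0 with h | h
  · have h' : (k : ℂ) + 1 + ν = 0 := by
      have : ((ν + k + 1 : ℝ) : ℂ) = 0 := by rw [h]; simp
      push_cast at this
      linear_combination this
    simp only [jCoeff, h, Real.Gamma_zero]
    push_cast
    rw [h']
    simp
  · have hG : Real.Gamma (ν + (k + 1 : ℕ) + 1) = (ν + k + 1) * Real.Gamma (ν + k + 1) := by
      rw [← Real.Gamma_add_one h]
      push_cast
      ring_nf
    have h' : (ν : ℂ) + k + 1 ≠ 0 := by exact_mod_cast h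
    simp only [jCoeff, hG, Nat.factorial_succ, pow_succ]
    push_cast
    rcases eq_or_ne (Real.Gamma (ν + k + 1)) 0 with h0 | h0
    · simp [h0]
    · have h0' : (Real.Gamma (ν + k + 1) : ℂ) ≠ 0 := by exact_mod_cast h0
      field_simp
      ring

lemma entireCoeff_jCoeff (ν : ℝ) : EntireCoeff (jCoeff ν) := by
  refine entireCoeff_of_recurrence ?_ (jCoeff_succ ν)
  have h : Tendsto (fun k : ℕ => (k : ℝ) + (1 - |ν|)) atTop atTop :=
    tendsto_atTop_add_const_right _ _ tendsto_natCast_atTop_atTop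
  refine tendsto_atTop_mono (fun k => ?_) h
  rw [norm_mul, norm_mul, Complex.norm_natCast]
  have h1 : (k : ℝ) + 1 - |ν| ≤ ‖(((k + 1 : ℕ) : ℂ) + ν)‖ := by
    have := norm_sub_le_norm_add ((k + 1 : ℕ) : ℂ) (ν : ℂ)
    rw [Complex.norm_natCast, Complex.norm_real, Real.norm_eq_abs] at this
    push_cast at this ⊢
    linarith
  have h2 : (1 : ℝ) ≤ ‖(4 : ℂ)‖ * ((k + 1 : ℕ) : ℝ) := by
    norm_num
    have : (0 : ℝ) ≤ k := k.cast_nonneg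
    linarith
  nlinarith [norm_nonneg (((k + 1 : ℕ) : ℂ) + ν)]

/-- The Bessel differential equation for the series with coefficients `jCoeff ν`. -/
lemma powerSum_jCoeff_eq (ν : ℝ) (ζ : ℂ) :
    4 * powerSum (fun k => (k : ℂ) * ((k : ℂ) * jCoeff ν k)) ζ
      + 4 * ν * powerSum (fun k => (k : ℂ) * jCoeff ν k) ζ + ζ * powerSum (jCoeff ν) ζ = 0 := by
  have h0 := entireCoeff_jCoeff ν
  have e := ((h0.mul_index.mul_index.hasSum ζ).mul_left 4).add
    (((h0.mul_index.hasSum ζ).mul_left (4 * (ν : ℂ))))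
  have e' := e.add (hasSum_shiftCoeff 1 (h0.hasSum ζ))
  rw [pow_one] at e'
  refine e'.unique ?_
  convert hasSum_zero using 2 with k
  rcases k with _ | k
  · simp [shiftCoeff]
  · have := jCoeff_succ ν k
    simp only [shiftCoeff, Nat.add_sub_cancel, if_neg (Nat.not_lt.2 (Nat.le_add_left 1 k))]
    linear_combination ζ ^ (k + 1) * this

lemma rpow_half_factor {x : ℝ} (hx : 0 < x) (ν : ℝ) :
    Real.sqrt (Real.pi * x / 2) * (x / 2) ^ ν
      = Real.sqrt (Real.pi / 2) * 2 ^ (-ν) * x ^ (ν + 1 / 2) := by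
  rw [show Real.pi * x / 2 = Real.pi / 2 * x by ring, Real.sqrt_mul (by positivity),
    Real.div_rpow hx.le (by norm_num), Real.rpow_neg (by norm_num), Real.rpow_add hx,
    ← Real.sqrt_eq_rpow]
  ring

lemma csqrt_mul_pow (z : ℂ) (x : ℝ) (k : ℕ) :
    (csqrt z * x / 2) ^ (2 * k) = (z * x ^ 2) ^ k / 4 ^ k := by
  rw [pow_mul, div_pow, mul_pow, csqrt_sq, div_pow]
  norm_num

/-- All branch dependence sits in the single factor `z^{ν/2}`, which the prefactors in `phiFree` and
`thetaFree` cancel. -/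
lemma sqrt_mul_besselJ {z : ℂ} (hz : z ≠ 0) {x : ℝ} (hx : 0 < x) (ν : ℝ) :
    (Real.sqrt (Real.pi * x / 2) : ℂ) * besselJ ν (csqrt z * x)
      = z ^ ((ν / 2 : ℝ) : ℂ) * (x ^ (ν + 1 / 2) : ℝ) * powerSum (jCoeff ν) (z * x ^ 2) := by
  have h1 : powerSum (jCoeff ν) (z * x ^ 2) = ((Real.sqrt (Real.pi / 2) * 2 ^ (-ν) : ℝ) : ℂ) *
      ∑' k : ℕ, (-1) ^ k / ((k.factorial : ℂ) * (Real.Gamma (ν + k + 1) : ℂ))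
        * (csqrt z * x / 2) ^ (2 * k) := by
    rw [powerSum, ← tsum_mul_left]
    refine tsum_congr fun k => ?_
    rw [csqrt_mul_pow, jCoeff]
    ring
  have h2 : ((Real.sqrt (Real.pi * x / 2) * (x / 2) ^ ν : ℝ) : ℂ)
      = ((Real.sqrt (Real.pi / 2) * 2 ^ (-ν) * x ^ (ν + 1 / 2) : ℝ) : ℂ) := by
    rw [rpow_half_factor hx]
  rw [h1, besselJ, csqrt_mul_cpow hz hx]
  push_cast at h2 ⊢
  linear_combination (z ^ ((ν : ℂ) / 2) * ∑' k : ℕ, (-1) ^ k /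
    ((k.factorial : ℂ) * (Real.Gamma (ν + k + 1) : ℂ)) * (csqrt z * x / 2) ^ (2 * k)) * h2

lemma powerSum_zero (c : ℕ → ℂ) : powerSum c 0 = c 0 := by
  rw [powerSum, tsum_eq_single 0]
  · simp
  · intro k hk
    simp [hk]

lemma phiFree_eq {l : ℝ} (z : ℂ) {x : ℝ} (hx : 0 < x) :
    phiFree l z x = (x ^ (l + 1) : ℝ) * powerSum (jCoeff (l + 1 / 2)) (z * x ^ 2) := by
  rw [phiFree]
  split_ifs with hz
  · have h2 : (2 : ℝ) ^ (l + 1) = 2 ^ (l + 1 / 2) * Real.sqrt 2 := by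
      rw [Real.sqrt_eq_rpow, ← Real.rpow_add (by norm_num)]
      congr 1
      ring
    have h3 : Real.sqrt (Real.pi / 2) = Real.sqrt Real.pi / Real.sqrt 2 :=
      Real.sqrt_div Real.pi_pos.le _
    subst hz
    rw [zero_mul, powerSum_zero, jCoeff, h2, h3, Real.rpow_neg (by norm_num)]
    norm_num
    rw [show l + 1 / 2 + 1 = l + 3 / 2 by ring]
    ring
  · rw [mul_assoc, sqrt_mul_besselJ hz hx, show l + 1 / 2 + 1 / 2 = l + 1 by ring, ← mul_assoc,
      ← mul_assoc, ← Complex.cpow_add _ _ hz,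
      show (-((2 * l + 1) / 4 : ℝ) : ℂ) + (((l + 1 / 2) / 2 : ℝ) : ℂ) = 0 by push_cast; ring]
    simp

lemma sqrt_pi_div_two_mul_self :
    Real.sqrt (Real.pi / 2) * Real.sqrt (Real.pi / 2) = Real.pi / 2 :=
  Real.mul_self_sqrt (by positivity)

lemma sin_ne_zero_of_not_nat {l : ℝ} (hl : -1 / 2 ≤ l) (h : ¬∃ n : ℕ, l + 1 / 2 = n) :
    Real.sin ((l + 1 / 2) * Real.pi) ≠ 0 := by
  rw [Ne, Real.sin_eq_zero_iff]
  rintro ⟨m, hm⟩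
  have hm' : (m : ℝ) = l + 1 / 2 := mul_right_cancel₀ Real.pi_ne_zero hm
  have h0 : 0 ≤ m := by
    have : (0 : ℝ) ≤ m := by linarith
    exact_mod_cast this
  refine h ⟨m.toNat, ?_⟩
  rw [← hm']
  exact_mod_cast (Int.toNat_of_nonneg h0).symm

lemma powerSum_jCoeff_wronskian_zero {l : ℝ} (hl : -1 / 2 < l) {a : ℂ}
    (ha : a = ((Real.Gamma (l + 3 / 2) * 2 ^ (l + 1) / (Real.sqrt Real.pi * (2 * l + 1)) : ℝ) : ℂ)) :
    (2 * l + 1) * powerSum (jCoeff (l + 1 / 2)) 0 * a = 1 := by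
  have h := phiFree_eq (l := l) 0 one_pos
  have hG : Real.Gamma (l + 3 / 2) ≠ 0 := (Real.Gamma_pos_of_pos (by linarith)).ne'
  have h1 : 2 * l + 1 ≠ 0 := by linarith
  have h2 : (2 : ℝ) ^ (l + 1) ≠ 0 := by positivity
  have h3 : Real.sqrt Real.pi ≠ 0 := by positivity
  rw [phiFree, if_pos rfl, Real.one_rpow, Complex.ofReal_one, zero_mul, one_mul, mul_one] at h
  rw [← h, ha]
  have : (2 * l + 1) * (Real.sqrt Real.pi / (Real.Gamma (l + 3 / 2) * 2 ^ (l + 1))) *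
      (Real.Gamma (l + 3 / 2) * 2 ^ (l + 1) / (Real.sqrt Real.pi * (2 * l + 1))) = 1 := by
    generalize Real.Gamma (l + 3 / 2) = g at *
    field_simp
  exact_mod_cast this

/-- Euler's reflection formula at `s = l + 1/2` turns `1 / (Γ(1 - s) sin πs)` into `Γ(s) / π`. This
matches the leading coefficient of the second Frobenius series with the prescribed value of
`thetaFree` at `z = 0`. -/
lemma jCoeff_neg_zero_div_sin {l : ℝ} (hl : -1 / 2 ≤ l) (h : ¬∃ n : ℕ, l + 1 / 2 = n) :
    jCoeff (-l - 1 / 2) 0 / Real.sin ((l + 1 / 2) * Real.pi)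
      = ((Real.Gamma (l + 3 / 2) * 2 ^ (l + 1) / (Real.sqrt Real.pi * (2 * l + 1)) : ℝ) : ℂ) := by
  have hs := sin_ne_zero_of_not_nat hl h
  have hl0 : l + 1 / 2 ≠ 0 := fun h0 => h ⟨0, by simpa using h0⟩
  have hl' : 0 < l + 1 / 2 := lt_of_le_of_ne (by linarith) hl0.symm
  have hG : Real.Gamma (l + 3 / 2) = (l + 1 / 2) * Real.Gamma (l + 1 / 2) := by
    rw [← Real.Gamma_add_one hl0]
    ring_nf
  have href := Real.Gamma_mul_Gamma_one_sub (l + 1 / 2)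
  have h2 : (2 : ℝ) ^ (l + 1) = 2 ^ (l + 1 / 2) * Real.sqrt 2 := by
    rw [Real.sqrt_eq_rpow, ← Real.rpow_add (by norm_num)]
    congr 1
    ring
  have h3 : Real.sqrt (Real.pi / 2) = Real.sqrt Real.pi / Real.sqrt 2 :=
    Real.sqrt_div Real.pi_pos.le _
  have h4 : Real.sqrt 2 * Real.sqrt 2 = 2 := Real.mul_self_sqrt (by norm_num)
  have h5 : Real.sqrt Real.pi * Real.sqrt Real.pi = Real.pi := Real.mul_self_sqrt Real.pi_pos.le
  rw [mul_comm Real.pi] at href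
  have hne : Real.Gamma (1 - (l + 1 / 2)) ≠ 0 := by
    intro h0
    rw [h0, mul_zero] at href
    exact (div_ne_zero Real.pi_ne_zero hs) href.symm
  have hsp : Real.sqrt Real.pi ≠ 0 := by positivity
  have hs2 : Real.sqrt 2 ≠ 0 := by positivity
  have h21 : 2 * l + 1 ≠ 0 := by intro h0; apply hl0; linarith
  have key : Real.sqrt (Real.pi / 2) * 2 ^ (l + 1 / 2) * (1 / Real.Gamma (1 - (l + 1 / 2)))
      / Real.sin ((l + 1 / 2) * Real.pi)
      = Real.Gamma (l + 3 / 2) * 2 ^ (l + 1) / (Real.sqrt Real.pi * (2 * l + 1)) := by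
    rw [h2, h3, hG]
    have hrec : 1 / Real.Gamma (1 - (l + 1 / 2)) / Real.sin ((l + 1 / 2) * Real.pi)
        = Real.Gamma (l + 1 / 2) / Real.pi := by
      rw [eq_div_iff hs] at href
      rw [div_div, div_eq_div_iff (mul_ne_zero hne hs) Real.pi_ne_zero]
      linear_combination -href
    rw [mul_div_assoc, hrec, show 2 * l + 1 = 2 * (l + 1 / 2) by ring]
    generalize Real.Gamma (l + 1 / 2) = g
    generalize Real.sqrt Real.pi = p at *
    generalize Real.sqrt 2 = s at *
    generalize l + 1 / 2 = v at *
    rw [← h5]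
    field_simp
    linear_combination -g * h4
  rw [← key, jCoeff]
  norm_num
  rw [show -l - 1 / 2 + 1 = 1 - (l + 1 / 2) by ring, show 1 / 2 + l = l + 1 / 2 by ring]

/-- The Frobenius representation if `l + 1 / 2` is not an integer. -/
def frobeniusNonInteger {l : ℝ} (hl : -1 / 2 ≤ l) (h : ¬∃ n : ℕ, l + 1 / 2 = n) :
    Frobenius l where
  S := powerSum (jCoeff (l + 1 / 2))
  S₁ := powerSum fun k => (k : ℂ) * jCoeff (l + 1 / 2) k
  S₂ := powerSum fun k => (k : ℂ) * ((k : ℂ) * jCoeff (l + 1 / 2) k)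
  A ζ := powerSum (jCoeff (-l - 1 / 2)) ζ / Real.sin ((l + 1 / 2) * Real.pi)
  A₁ ζ := powerSum (fun k => (k : ℂ) * jCoeff (-l - 1 / 2) k) ζ / Real.sin ((l + 1 / 2) * Real.pi)
  A₂ ζ := powerSum (fun k => (k : ℂ) * ((k : ℂ) * jCoeff (-l - 1 / 2) k)) ζ
    / Real.sin ((l + 1 / 2) * Real.pi)
  c := 0
  n := 0
  hS := (entireCoeff_jCoeff _).eulerPair
  hS₁ := (entireCoeff_jCoeff _).mul_index.eulerPair
  hA := (entireCoeff_jCoeff _).eulerPair.div_const _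
  hA₁ := (entireCoeff_jCoeff _).mul_index.eulerPair.div_const _
  c_eq_zero_or := Or.inl rfl
  eqS ζ := by
    rw [← powerSum_jCoeff_eq (l + 1 / 2) ζ]
    push_cast
    ring
  eqA ζ := by
    have := powerSum_jCoeff_eq (-l - 1 / 2) ζ
    push_cast at this
    linear_combination this / Real.sin ((l + 1 / 2) * Real.pi)
  wronskian_zero := by
    have hl' : -1 / 2 < l :=
      lt_of_le_of_ne hl fun h0 => h ⟨0, by rw [← h0]; norm_num⟩
    rw [zero_mul, zero_mul, sub_zero]
    exact powerSum_jCoeff_wronskian_zero hl'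
      (by rw [powerSum_zero]; exact jCoeff_neg_zero_div_sin hl h)
  phi_eq z x hx := phiFree_eq z hx
  theta_eq z x hx := by
    have hl0 : l ≠ -1 / 2 := fun h0 => h ⟨0, by rw [h0]; norm_num⟩
    rw [thetaFree]
    split_ifs with hz
    · subst hz
      rw [zero_mul, powerSum_zero, jCoeff_neg_zero_div_sin hl h]
      push_cast
      ring
    · have e := sqrt_mul_besselJ hz hx (-l - 1 / 2)
      have e2 : z ^ (((2 * l + 1) / 4 : ℝ) : ℂ) * z ^ (((-l - 1 / 2) / 2 : ℝ) : ℂ) = 1 := by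
        rw [← Complex.cpow_add _ _ hz]
        have : (((2 * l + 1) / 4 : ℝ) : ℂ) + (((-l - 1 / 2) / 2 : ℝ) : ℂ) = 0 := by
          push_cast
          ring
        rw [this, Complex.cpow_zero]
      rw [show -l - 1 / 2 + 1 / 2 = -l by ring] at e
      linear_combination (z ^ (((2 * l + 1) / 4 : ℝ) : ℂ) / Real.sin ((l + 1 / 2) * Real.pi)) * e
        + ((x ^ (-l) : ℝ) * powerSum (jCoeff (-l - 1 / 2)) (z * x ^ 2)
          / Real.sin ((l + 1 / 2) * Real.pi)) * e2

/-! ### Integer `l + 1/2`: the logarithmic second solution. -/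

/-- The coefficients of the analytic part of `θ_l` if `l + 1 / 2 = n`. -/
def logCoeff (n k : ℕ) : ℂ :=
  ((Real.sqrt (Real.pi / 2) * 2 ^ n / Real.pi : ℝ) : ℂ) *
    (if k < n then ((n - k - 1).factorial : ℂ) / (k.factorial : ℂ) / 4 ^ k
    else ((digammaSucc (k - n) + digammaSucc k : ℝ) : ℂ) * (-1) ^ (k - n)
      / (((k - n).factorial : ℂ) * (k.factorial : ℂ)) / 4 ^ k)

lemma digammaSucc_succ (m : ℕ) : digammaSucc (m + 1) = digammaSucc m + 1 / (m + 1) := by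
  rw [digammaSucc, digammaSucc, harmonic_succ]
  push_cast
  ring

lemma abs_digammaSucc_le (m : ℕ) : |digammaSucc m| ≤ m + 1 := by
  induction m with
  | zero =>
    have h1 := Real.one_half_lt_eulerMascheroniConstant
    have h2 := Real.eulerMascheroniConstant_lt_two_thirds
    rw [digammaSucc, abs_le]
    constructor <;> norm_num <;> linarith
  | succ m ih =>
    rw [digammaSucc_succ]
    have h : (1 : ℝ) / (m + 1) ≤ 1 := by
      rw [div_le_one (by positivity)]
      have : (0 : ℝ) ≤ m := m.cast_nonneg
      linarith
    have h' : (0 : ℝ) ≤ 1 / (m + 1) := by positivity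
    rw [abs_le] at ih ⊢
    push_cast
    constructor <;> linarith [ih.1, ih.2]

lemma logCoeff_add (n m : ℕ) : logCoeff n (n + m) =
    ((Real.sqrt (Real.pi / 2) * 2 ^ n / Real.pi : ℝ) : ℂ) *
      (((digammaSucc m + digammaSucc (n + m) : ℝ) : ℂ) * (-1) ^ m
        / ((m.factorial : ℂ) * ((n + m).factorial : ℂ)) / 4 ^ (n + m)) := by
  rw [logCoeff, if_neg (by omega), Nat.add_sub_cancel_left]

lemma entireCoeff_logCoeff (n : ℕ) : EntireCoeff (logCoeff n) := by
  intro r hr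
  rw [← summable_nat_add_iff n]
  set K : ℝ := Real.sqrt (Real.pi / 2) * 2 ^ n / Real.pi with hK
  have hK0 : 0 ≤ K := by positivity
  -- Past the first `n` terms the digamma factor is at most `(n + 2) 2^m`, so the exponential series
  -- at `2 r` is a majorant.
  refine Summable.of_nonneg_of_le (fun m => by positivity) (fun m => ?_)
    ((Real.summable_pow_div_factorial (2 * r)).mul_left (K * (n + 2) * r ^ n))
  have h1 : ‖((digammaSucc m + digammaSucc (n + m) : ℝ) : ℂ)‖ ≤ (n + 2) * 2 ^ m := by
    rw [Complex.norm_real, Real.norm_eq_abs]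
    have h2 : ((m + 1 : ℕ) : ℝ) ≤ 2 ^ m := by exact_mod_cast m.lt_two_pow_self
    have h3 := abs_digammaSucc_le m
    have h4 := abs_digammaSucc_le (n + m)
    have h5 := abs_add_le (digammaSucc m) (digammaSucc (n + m))
    push_cast at h2 h4
    have h6 : (0 : ℝ) ≤ n := n.cast_nonneg
    have h7 : (0 : ℝ) ≤ m := m.cast_nonneg
    nlinarith [mul_nonneg h6 h7]
  have h2 : (1 : ℝ) ≤ ((n + m).factorial : ℝ) := by exact_mod_cast (n + m).factorial_pos
  have h3 : (1 : ℝ) ≤ 4 ^ (n + m) := one_le_pow₀ (by norm_num)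
  have h4 : (0 : ℝ) < (m.factorial : ℝ) := by exact_mod_cast m.factorial_pos
  have h5 : ‖logCoeff n (m + n)‖ ≤ K * ((n + 2) * 2 ^ m / m.factorial) := by
    rw [add_comm m n, logCoeff_add, norm_mul, Complex.norm_real, Real.norm_of_nonneg hK0]
    gcongr
    rw [norm_div, norm_div, norm_mul, norm_mul, norm_pow, norm_pow, norm_neg, norm_one, one_pow,
      mul_one, Complex.norm_natCast, Complex.norm_natCast, Complex.norm_ofNat, div_div]
    refine div_le_div₀ (by positivity) h1 h4 ?_
    calc (m.factorial : ℝ) = m.factorial * 1 * 1 := by ring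
      _ ≤ m.factorial * (n + m).factorial * 4 ^ (n + m) := by gcongr
  calc ‖logCoeff n (m + n)‖ * r ^ (m + n)
      ≤ K * ((n + 2) * 2 ^ m / m.factorial) * r ^ (m + n) := by gcongr
    _ = _ := by rw [pow_add, mul_pow]; ring

lemma jCoeff_nat (n k : ℕ) : jCoeff n k = ((Real.sqrt (Real.pi / 2) / 2 ^ n : ℝ) : ℂ) *
    ((-1) ^ k / ((k.factorial : ℂ) * ((n + k).factorial : ℂ)) / 4 ^ k) := by
  have h : Real.Gamma ((n : ℝ) + k + 1) = ((n + k).factorial : ℝ) := by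
    rw [← Real.Gamma_nat_eq_factorial]
    push_cast
    rfl
  rw [jCoeff, h, Real.rpow_neg (by norm_num), Real.rpow_natCast]
  push_cast
  ring

/-- Below `k = n` this is a factorial recurrence without source. At `k = n` the factor `4 k (k - n)`
vanishes, and for `n ≥ 1` the coefficient with index `n - 1` is balanced by the first source term of
the logarithm. Beyond `n` the source is matched by the increments `1/(m+1)` and `1/(n+m+1)` of the
two digamma values. -/
lemma logCoeff_recurrence (n k : ℕ) :
    4 * ((k : ℂ) * ((k : ℂ) * logCoeff n k)) - 4 * n * ((k : ℂ) * logCoeff n k)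
      + shiftCoeff 1 (logCoeff n) k
      + (-2 / (Real.pi : ℂ)) * (2 * n * shiftCoeff n (jCoeff n) k
        + 4 * shiftCoeff n (fun k => (k : ℂ) * jCoeff n k) k) = 0 := by
  have hpi : (Real.pi : ℂ) ≠ 0 := by exact_mod_cast Real.pi_ne_zero
  rcases lt_or_ge k n with hk | hk
  · simp only [shiftCoeff, if_pos hk]
    rcases k with _ | k
    · simp
    · obtain ⟨i, rfl⟩ := Nat.exists_eq_add_of_lt hk
      have e1 : k + 1 + i + 1 - (k + 1) - 1 = i := by omega
      have e2 : k + 1 + i + 1 - k - 1 = i + 1 := by omega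
      rw [if_neg (by omega), Nat.add_sub_cancel, logCoeff, logCoeff, if_pos (by omega),
        if_pos (by omega), e1, e2, Nat.factorial_succ, Nat.factorial_succ]
      have hf : (k.factorial : ℂ) ≠ 0 := by exact_mod_cast k.factorial_ne_zero
      have hk1 : (k : ℂ) + 1 ≠ 0 := by exact_mod_cast k.succ_ne_zero
      push_cast
      field_simp
      ring
  · obtain ⟨m, rfl⟩ := Nat.exists_eq_add_of_le hk
    simp only [shiftCoeff, if_neg (Nat.not_lt.2 hk), Nat.add_sub_cancel_left]
    rcases m with _ | m
    · rcases n with _ | n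
      · simp
      · rw [if_neg (by omega), Nat.add_zero, Nat.add_sub_cancel, jCoeff_nat, logCoeff,
          logCoeff, if_neg (lt_irrefl _), if_pos (by omega), Nat.sub_self,
          show n + 1 - n - 1 = 0 by omega, Nat.add_zero, Nat.factorial_succ]
        have hf : (n.factorial : ℂ) ≠ 0 := by exact_mod_cast n.factorial_ne_zero
        have hk1 : (n : ℂ) + 1 ≠ 0 := by exact_mod_cast n.succ_ne_zero
        have h4 : (4 : ℂ) ^ n = 2 ^ n * 2 ^ n := by rw [← mul_pow]; norm_num
        push_cast
        rw [h4]
        field_simp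
        ring
    · rw [if_neg (by omega), show n + (m + 1) - 1 = n + m by omega, jCoeff_nat, logCoeff_add,
        logCoeff_add, ← add_assoc n m 1, Nat.factorial_succ, Nat.factorial_succ,
        digammaSucc_succ, digammaSucc_succ]
      have hf : ((n + m).factorial : ℂ) ≠ 0 := by exact_mod_cast (n + m).factorial_ne_zero
      have hf' : (m.factorial : ℂ) ≠ 0 := by exact_mod_cast m.factorial_ne_zero
      have hk1 : (n : ℂ) + m + 1 ≠ 0 := by exact_mod_cast (n + m).succ_ne_zero
      have hk2 : (m : ℂ) + 1 ≠ 0 := by exact_mod_cast m.succ_ne_zero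
      have h4 : (4 : ℂ) ^ n = 2 ^ n * 2 ^ n := by rw [← mul_pow]; norm_num
      push_cast
      rw [pow_succ 4 (n + m), pow_add 4 n m, pow_succ 4 m, h4]
      field_simp
      ring

lemma csqrt_pow {l : ℝ} {n : ℕ} (hln : l + 1 / 2 = n) (z : ℂ) :
    z ^ (((2 * l + 1) / 4 : ℝ) : ℂ) = csqrt z ^ n := by
  rw [csqrt, ← Complex.cpow_mul_nat]
  congr 1
  have : (2 * l + 1) / 4 = 1 / 2 * (n : ℝ) := by rw [← hln]; ring
  rw [this]
  push_cast
  ring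

lemma sqrt_eq_rpow_mul {l : ℝ} {n : ℕ} (hln : l + 1 / 2 = n) {x : ℝ} (hx : 0 < x) :
    Real.sqrt (Real.pi * x / 2) = Real.sqrt (Real.pi / 2) * 2 ^ n * x ^ (-l) * (x / 2) ^ n := by
  have h := rpow_half_factor hx (-(n : ℝ))
  rw [neg_neg, Real.rpow_natCast, show -(n : ℝ) + 1 / 2 = -l by rw [← hln]; ring,
    Real.rpow_neg (by positivity), Real.rpow_natCast] at h
  rw [← h]
  field_simp

/-- The logarithm in `Y_n` splits into `log z / 2 + log (x/2)`. The first part is what the term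
`(1/π) log(z) J` in `θ_l` removes, leaving an expression entire in `z`; the finite and infinite sums
merge into one power series in `z x²`. -/
lemma csqrt_pow_mul_neumannY {l : ℝ} {n : ℕ} (hln : l + 1 / 2 = n) {z : ℂ} (hz : z ≠ 0) {x : ℝ}
    (hx : 0 < x) :
    csqrt z ^ n * Real.sqrt (Real.pi * x / 2) * neumannY n (csqrt z * x)
      = 2 / Real.pi * (Complex.log z / 2 + Real.log (x / 2))
          * (csqrt z ^ n * Real.sqrt (Real.pi * x / 2) * besselJ n (csqrt z * x))
        - (x ^ (-l) : ℝ) * powerSum (logCoeff n) (z * x ^ 2) := by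
  have hs := csqrt_ne_zero hz
  have hxc : (x : ℂ) ≠ 0 := by exact_mod_cast hx.ne'
  have hpi : (Real.pi : ℂ) ≠ 0 := by exact_mod_cast Real.pi_ne_zero
  have hr : (Real.sqrt (Real.pi * x / 2) : ℂ)
      = Real.sqrt (Real.pi / 2) * 2 ^ n * (x ^ (-l) : ℝ) * (x / 2) ^ n := by
    rw [sqrt_eq_rpow_mul hln hx]
    push_cast
    rfl
  have h1 := ((entireCoeff_logCoeff n).hasSum (z * x ^ 2)).summable.sum_add_tsum_nat_add n
  have hfin : ((x ^ (-l) : ℝ) : ℂ) * ∑ k ∈ Finset.range n, logCoeff n k * (z * x ^ 2) ^ k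
      = csqrt z ^ n * Real.sqrt (Real.pi * x / 2) * (1 / (Real.pi : ℂ) * ∑ k ∈ Finset.range n,
        ((n - k - 1).factorial : ℂ) / (k.factorial : ℂ)
          * ((csqrt z * x / 2) ^ (2 * k) / (csqrt z * x / 2) ^ n)) := by
    rw [Finset.mul_sum, Finset.mul_sum, Finset.mul_sum]
    refine Finset.sum_congr rfl fun k hk => ?_
    rw [csqrt_mul_pow, logCoeff, if_pos (Finset.mem_range.1 hk), hr,
      show (csqrt z * x / 2) ^ n = csqrt z ^ n * (x / 2) ^ n by rw [← mul_pow]; ring]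
    have hx2 : (x / 2 : ℂ) ^ n ≠ 0 := pow_ne_zero _ (div_ne_zero hxc two_ne_zero)
    generalize (x / 2 : ℂ) ^ n = u at *
    push_cast
    field_simp
  have hinf : ((x ^ (-l) : ℝ) : ℂ) * ∑' k, logCoeff n (k + n) * (z * x ^ 2) ^ (k + n)
      = csqrt z ^ n * Real.sqrt (Real.pi * x / 2) * (1 / (Real.pi : ℂ) * ∑' k : ℕ,
        ((digammaSucc k + digammaSucc (n + k) : ℝ) : ℂ) * (-1) ^ k
          / ((k.factorial : ℂ) * ((n + k).factorial : ℂ)) * (csqrt z * x / 2) ^ (2 * k + n)) := by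
    rw [← tsum_mul_left, ← tsum_mul_left, ← tsum_mul_left]
    refine tsum_congr fun k => ?_
    have e : csqrt z ^ n * (x / 2 : ℂ) ^ n * (csqrt z * x / 2) ^ (2 * k + n)
        = (z * x ^ 2) ^ (k + n) / 4 ^ (k + n) := by
      rw [← csqrt_mul_pow, mul_add, pow_add _ (2 * k) n, pow_add _ (2 * k) (2 * n), two_mul n,
        pow_add _ n n, mul_div_assoc, mul_pow]
      ring
    rw [add_comm k n, logCoeff_add, hr, add_comm n k]
    push_cast
    linear_combination (-((digammaSucc k : ℂ) + digammaSucc (k + n)) * (-1) ^ k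
      / ((k.factorial : ℂ) * ((k + n).factorial : ℂ)) * (1 / (Real.pi : ℂ)) *
        (Real.sqrt (Real.pi / 2) * 2 ^ n * (x ^ (-l) : ℝ))) * e
  rw [powerSum, ← h1, neumannY, log_csqrt_mul hz hx]
  linear_combination hfin + hinf

/-- The Frobenius representation if `l + 1 / 2 = n` is an integer. -/
def frobeniusInteger {l : ℝ} {n : ℕ} (hln : l + 1 / 2 = n) : Frobenius l where
  S := powerSum (jCoeff n)
  S₁ := powerSum fun k => (k : ℂ) * jCoeff n k
  S₂ := powerSum fun k => (k : ℂ) * ((k : ℂ) * jCoeff n k)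
  A := powerSum (logCoeff n)
  A₁ := powerSum fun k => (k : ℂ) * logCoeff n k
  A₂ := powerSum fun k => (k : ℂ) * ((k : ℂ) * logCoeff n k)
  c := -2 / (Real.pi : ℂ)
  n := n
  hS := (entireCoeff_jCoeff _).eulerPair
  hS₁ := (entireCoeff_jCoeff _).mul_index.eulerPair
  hA := (entireCoeff_logCoeff _).eulerPair
  hA₁ := (entireCoeff_logCoeff _).mul_index.eulerPair
  c_eq_zero_or := Or.inr hln
  eqS ζ := by
    have hl : (l : ℂ) = n - 1 / 2 := by rw [← Complex.ofReal_natCast, ← hln]; push_cast; ring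
    rw [← powerSum_jCoeff_eq n ζ, hl]
    push_cast
    ring
  eqA ζ := by
    have hl : (l : ℂ) = n - 1 / 2 := by rw [← Complex.ofReal_natCast, ← hln]; push_cast; ring
    have h0 := entireCoeff_logCoeff n
    have hj := entireCoeff_jCoeff n
    have e := (((h0.mul_index.mul_index.hasSum ζ).mul_left 4).sub
      ((h0.mul_index.hasSum ζ).mul_left (4 * (n : ℂ)))).add (hasSum_shiftCoeff 1 (h0.hasSum ζ))
    have e' := e.add ((((hasSum_shiftCoeff n (hj.hasSum ζ)).mul_left (2 * (n : ℂ))).add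
      ((hasSum_shiftCoeff n (hj.mul_index.hasSum ζ)).mul_left 4)).mul_left (-2 / (Real.pi : ℂ)))
    have e'' := e'.unique (a₂ := 0) (by
      convert hasSum_zero using 2 with k
      linear_combination ζ ^ k * logCoeff_recurrence n k)
    rw [hl]
    linear_combination e''
  wronskian_zero := by
    have hl : (l : ℂ) = n - 1 / 2 := by rw [← Complex.ofReal_natCast, ← hln]; push_cast; ring
    have hpi : (Real.pi : ℂ) ≠ 0 := by exact_mod_cast Real.pi_ne_zero
    have hs : (Real.sqrt (Real.pi / 2) : ℂ) * Real.sqrt (Real.pi / 2) = Real.pi / 2 := by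
      exact_mod_cast sqrt_pi_div_two_mul_self
    rw [powerSum_zero, powerSum_zero, jCoeff_nat, logCoeff, hl]
    rcases n with _ | n
    · generalize Real.sqrt (Real.pi / 2) = r at *
      simp
      field_simp
      linear_combination 2 * hs
    · rw [if_pos (by omega), zero_pow (by omega), show n + 1 - 0 - 1 = n by omega,
        Nat.add_zero, Nat.factorial_succ]
      have hf : (n.factorial : ℂ) ≠ 0 := by exact_mod_cast n.factorial_ne_zero
      have hk1 : (n : ℂ) + 1 ≠ 0 := by exact_mod_cast n.succ_ne_zero
      simp only [Nat.factorial_zero, pow_zero, mul_zero, zero_mul, sub_zero]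
      push_cast
      field_simp
      linear_combination (2 : ℂ) * ((n : ℂ) + 1) * hs
  phi_eq z x hx := by rw [phiFree_eq z hx, hln]
  theta_eq z x hx := by
    have hpi : (Real.pi : ℂ) ≠ 0 := by exact_mod_cast Real.pi_ne_zero
    have hphi := phiFree_eq (l := l) z hx
    rw [thetaFree]
    split_ifs with hz hl h
    · subst hz
      -- For `n = 0` the factor `zⁿ` equals `1` even at `z = 0`, so the logarithm survives there;
      -- for `n ≥ 1` it disappears.
      obtain rfl : n = 0 := by
        have : (n : ℝ) = 0 := by rw [← hln, hl]; norm_num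
        exact_mod_cast this
      have h1 : x ^ (-l) = Real.sqrt x := by rw [hl, Real.sqrt_eq_rpow]; norm_num
      have h2 : x ^ (l + 1) = Real.sqrt x := by rw [hl, Real.sqrt_eq_rpow]; norm_num
      have h3 : Real.sqrt (2 * x / Real.pi)
          = Real.sqrt (Real.pi / 2) * (2 / Real.pi) * Real.sqrt x := by
        rw [Real.sqrt_eq_iff_mul_self_eq (by positivity) (by positivity)]
        have h4 := sqrt_pi_div_two_mul_self
        have h5 := Real.mul_self_sqrt hx.le
        have := Real.pi_ne_zero
        symm
        calc Real.sqrt (Real.pi / 2) * (2 / Real.pi) * Real.sqrt x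
              * (Real.sqrt (Real.pi / 2) * (2 / Real.pi) * Real.sqrt x)
            = (Real.sqrt (Real.pi / 2) * Real.sqrt (Real.pi / 2)) * (2 / Real.pi) ^ 2
              * (Real.sqrt x * Real.sqrt x) := by ring
          _ = 2 * x / Real.pi := by rw [h4, h5]; field_simp
      rw [hphi, zero_mul, powerSum_zero, powerSum_zero, hln, jCoeff_nat, logCoeff, h1, h2, h3,
        Real.log_div hx.ne' two_ne_zero]
      simp only [lt_irrefl, if_false]
      simp [digammaSucc]
      field_simp
      ring
    · subst hz
      rcases n with _ | n
      · refine absurd ?_ hl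
        push_cast at hln
        linarith
      · have h1 : (2 : ℝ) ^ (l + 1) = 2 ^ (n + 1) * Real.sqrt 2 := by
          rw [Real.sqrt_eq_rpow, ← Real.rpow_natCast, ← Real.rpow_add (by norm_num), ← hln]
          congr 1
          ring
        have h2 : Real.Gamma (l + 3 / 2) = (n + 1) * n.factorial := by
          rw [show l + 3 / 2 = ((n + 1 : ℕ) : ℝ) + 1 by rw [← hln]; ring,
            Real.Gamma_nat_eq_factorial, Nat.factorial_succ]
          push_cast
          rfl
        have h3 : Real.sqrt (Real.pi / 2) = Real.sqrt Real.pi / Real.sqrt 2 :=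
          Real.sqrt_div Real.pi_pos.le _
        have h4 : Real.sqrt 2 * Real.sqrt 2 = 2 := Real.mul_self_sqrt (by norm_num)
        have h5 : Real.sqrt Real.pi * Real.sqrt Real.pi = Real.pi :=
          Real.mul_self_sqrt Real.pi_pos.le
        have key : Real.Gamma (l + 3 / 2) * 2 ^ (l + 1) / (Real.sqrt Real.pi * (2 * l + 1))
            = Real.sqrt (Real.pi / 2) * 2 ^ (n + 1) / Real.pi * n.factorial := by
          have h6 : (n : ℝ) + 1 ≠ 0 := by positivity
          have h7 : Real.sqrt Real.pi ≠ 0 := by positivity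
          have h8 : Real.sqrt 2 ≠ 0 := by positivity
          rw [h1, h2, h3, show 2 * l + 1 = 2 * (n + 1) by push_cast at hln; linarith]
          generalize Real.sqrt Real.pi = p at *
          generalize Real.sqrt 2 = s at *
          rw [← h5]
          field_simp
          linear_combination h4
        rw [key, zero_mul, powerSum_zero, logCoeff, if_pos (by omega), zero_pow (by omega),
          show n + 1 - 0 - 1 = n by omega]
        push_cast
        simp
        ring
    · have e := csqrt_pow_mul_neumannY hln hz hx
      have e2 := sqrt_mul_besselJ hz hx n
      have e3 : z ^ (((n : ℝ) / 2 : ℝ) : ℂ) = csqrt z ^ n := by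
        rw [← csqrt_pow hln, ← hln]
        congr 2
        ring
      have e4 : csqrt z ^ n * csqrt z ^ n = z ^ n := by
        rw [← mul_pow, ← pow_two, csqrt_sq]
      rw [e3, show (n : ℝ) + 1 / 2 = l + 1 by rw [← hln]; ring] at e2
      rw [hphi, csqrt_pow hln, hln, Nat.floor_natCast, ← e4]
      linear_combination -e + (-2 / (Real.pi : ℂ)) * Real.log (x / 2) * csqrt z ^ n * e2
    · exact absurd ⟨n, hln⟩ h

theorem nonempty_frobenius {l : ℝ} (hl : -1 / 2 ≤ l) : Nonempty (Frobenius l) := by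
  by_cases h : ∃ n : ℕ, l + 1 / 2 = n
  · obtain ⟨n, hn⟩ := h
    exact ⟨frobeniusInteger hn⟩
  · exact ⟨frobeniusNonInteger hl h⟩

/-! ### Derivatives, Wronskian and elementary bounds of the free solutions. -/

section

/-- Differentiating `x^s F(z x²)` gives `x^{s-1}` times such a combination at `z x²`. Having its
Euler pair allows `EulerPair.hasDerivAt_rpow_mul` to be applied a second time. -/
lemma EulerPair.lin {F F₁ F₂ : ℂ → ℂ} (h : EulerPair F F₁) (h₁ : EulerPair F₁ F₂) (s : ℂ) :
    EulerPair (fun ζ => s * F ζ + 2 * F₁ ζ) fun ζ => s * F₁ ζ + 2 * F₂ ζ := by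
  have d := h.differentiable
  have d₁ := h₁.differentiable
  refine ⟨by fun_prop, fun ζ => ?_⟩
  have hd : HasDerivAt (fun ζ => s * F ζ + 2 * F₁ ζ) (s * deriv F ζ + 2 * deriv F₁ ζ) ζ :=
    ((d ζ).hasDerivAt.const_mul s).add ((d₁ ζ).hasDerivAt.const_mul 2)
  rw [hd.deriv, ← h.euler, ← h₁.euler]
  ring

/-- The derivative of `x ^ s F(z x²)`. -/
lemma EulerPair.hasDerivAt_rpow_mul {F F₁ : ℂ → ℂ} (h : EulerPair F F₁) (s : ℝ) (z : ℂ) {x : ℝ}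
    (hx : 0 < x) :
    HasDerivAt (fun x : ℝ => ((x ^ s : ℝ) : ℂ) * F (z * x ^ 2))
      (((x ^ (s - 1) : ℝ) : ℂ) * (s * F (z * x ^ 2) + 2 * F₁ (z * x ^ 2))) x := by
  have h1 : HasDerivAt (fun x : ℝ => ((x ^ s : ℝ) : ℂ)) ((s * x ^ (s - 1) : ℝ) : ℂ) x :=
    (Real.hasDerivAt_rpow_const (Or.inl hx.ne')).ofReal_comp
  have h2 : HasDerivAt (fun x : ℝ => z * (x : ℂ) ^ 2) (z * (2 * x)) x := by
    have := ((Complex.ofRealCLM.hasDerivAt (x := x)).pow 2).const_mul z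
    simpa using this
  have h3 : HasDerivAt (fun x : ℝ => F (z * (x : ℂ) ^ 2)) (deriv F (z * x ^ 2) * (z * (2 * x))) x :=
    HasDerivAt.comp x (h.differentiable _).hasDerivAt h2
  refine (h1.mul h3).congr_deriv ?_
  have hs : x ^ s = x ^ (s - 1) * x := by
    rw [← Real.rpow_add_one hx.ne']
    ring_nf
  rw [← h.euler, hs]
  push_cast
  ring

lemma hasDerivAt_log_div_two {x : ℝ} (hx : 0 < x) :
    HasDerivAt (fun x : ℝ => (Real.log (x / 2) : ℂ)) ((x⁻¹ : ℝ) : ℂ) x := by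
  refine HasDerivAt.ofReal_comp ?_
  have h : HasDerivAt (fun x : ℝ => x / 2) (1 / 2) x := (hasDerivAt_id x).div_const 2
  refine (h.log (by positivity)).congr_deriv ?_
  field_simp

/-- `φ_l'`. -/
def dphi (l : ℝ) (z : ℂ) (x : ℝ) : ℂ := deriv (phiFree l z) x

/-- `θ_l'`. -/
def dtheta (l : ℝ) (z : ℂ) (x : ℝ) : ℂ := deriv (thetaFree l z) x

/-- The logarithmic factor in the definition of `q̃`. -/
def logFactor (l x : ℝ) : ℝ := if l = -1 / 2 then 1 - Real.log x else 1

variable {l : ℝ}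

namespace Frobenius

lemma hasDerivAt_phi_aux (F : Frobenius l) (z : ℂ) {x : ℝ} (hx : 0 < x) :
    HasDerivAt (phiFree l z)
      (((x ^ l : ℝ) : ℂ) * ((l + 1 : ℝ) * F.S (z * x ^ 2) + 2 * F.S₁ (z * x ^ 2))) x := by
  have := F.hS.hasDerivAt_rpow_mul (l + 1) z hx
  rw [add_sub_cancel_right] at this
  refine this.congr_of_eventuallyEq ?_
  filter_upwards [lt_mem_nhds hx] with y hy using F.phi_eq z y hy

lemma dphi_eq (F : Frobenius l) (z : ℂ) {x : ℝ} (hx : 0 < x) :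
    dphi l z x = ((x ^ l : ℝ) : ℂ) * ((l + 1 : ℝ) * F.S (z * x ^ 2) + 2 * F.S₁ (z * x ^ 2)) :=
  (F.hasDerivAt_phi_aux z hx).deriv

lemma hasDerivAt_phi (F : Frobenius l) (z : ℂ) {x : ℝ} (hx : 0 < x) :
    HasDerivAt (phiFree l z) (dphi l z x) x :=
  (F.hasDerivAt_phi_aux z hx).differentiableAt.hasDerivAt

lemma hasDerivAt_dphi (F : Frobenius l) (z : ℂ) {x : ℝ} (hx : 0 < x) :
    HasDerivAt (dphi l z) (((l * (l + 1) / x ^ 2 : ℝ) - z) * phiFree l z x) x := by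
  have h := (F.hS.lin F.hS₁ ((l + 1 : ℝ) : ℂ)).hasDerivAt_rpow_mul l z hx
  have h' := h.congr_of_eventuallyEq (f₁ := dphi l z) (by
    filter_upwards [lt_mem_nhds hx] with y hy using F.dphi_eq z hy)
  refine h'.congr_deriv ?_
  have e := F.eqS (z * x ^ 2)
  have hxc : (x : ℂ) ≠ 0 := by exact_mod_cast hx.ne'
  have e1 : x ^ (l + 1) = x ^ (l - 1) * x ^ 2 := by
    rw [← Real.rpow_natCast x 2, ← Real.rpow_add hx]
    norm_num
    ring_nf
  rw [F.phi_eq z x hx, e1]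
  push_cast
  field_simp
  linear_combination ((x ^ (l - 1) : ℝ) : ℂ) * e

lemma hasDerivAt_theta_aux (F : Frobenius l) (z : ℂ) {x : ℝ} (hx : 0 < x) :
    HasDerivAt (thetaFree l z)
      (((x ^ (-l - 1) : ℝ) : ℂ) * ((-l : ℝ) * F.A (z * x ^ 2) + 2 * F.A₁ (z * x ^ 2))
        + F.c * z ^ F.n * (((x⁻¹ : ℝ) : ℂ) * phiFree l z x + Real.log (x / 2) * dphi l z x)) x := by
  have h1 := F.hA.hasDerivAt_rpow_mul (-l) z hx
  have h2 := hasDerivAt_log_div_two hx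
  have h3 := h1.add ((h2.const_mul (F.c * z ^ F.n)).mul (F.hasDerivAt_phi z hx))
  refine (h3.congr_of_eventuallyEq ?_).congr_deriv ?_
  · filter_upwards [lt_mem_nhds hx] with y hy using F.theta_eq z y hy
  · ring

lemma dtheta_eq (F : Frobenius l) (z : ℂ) {x : ℝ} (hx : 0 < x) :
    dtheta l z x =
      ((x ^ (-l - 1) : ℝ) : ℂ) * ((-l : ℝ) * F.A (z * x ^ 2) + 2 * F.A₁ (z * x ^ 2))
        + F.c * z ^ F.n * (((x⁻¹ : ℝ) : ℂ) * phiFree l z x + Real.log (x / 2) * dphi l z x) :=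
  (F.hasDerivAt_theta_aux z hx).deriv

lemma hasDerivAt_theta (F : Frobenius l) (z : ℂ) {x : ℝ} (hx : 0 < x) :
    HasDerivAt (thetaFree l z) (dtheta l z x) x :=
  (F.hasDerivAt_theta_aux z hx).differentiableAt.hasDerivAt

lemma rpow_of_eq {n : ℕ} (hn : l + 1 / 2 = n) {x : ℝ} (hx : 0 < x) :
    x ^ (l + 1) = x ^ (-l) * (x ^ 2) ^ n := by
  rw [← pow_mul, ← Real.rpow_natCast, ← Real.rpow_add hx]
  congr 1
  push_cast
  linarith

lemma hasDerivAt_dtheta (F : Frobenius l) (z : ℂ) {x : ℝ} (hx : 0 < x) :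
    HasDerivAt (dtheta l z) (((l * (l + 1) / x ^ 2 : ℝ) - z) * thetaFree l z x) x := by
  have h1 := (F.hA.lin F.hA₁ ((-l : ℝ) : ℂ)).hasDerivAt_rpow_mul (-l - 1) z hx
  have h2 := hasDerivAt_log_div_two hx
  have h3 : HasDerivAt (fun x : ℝ => ((x⁻¹ : ℝ) : ℂ)) ((-(x ^ 2)⁻¹ : ℝ) : ℂ) x :=
    (hasDerivAt_inv hx.ne').ofReal_comp
  have h4 := h1.add (((h3.mul (F.hasDerivAt_phi z hx)).add
    (h2.mul (F.hasDerivAt_dphi z hx))).const_mul (F.c * z ^ F.n))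
  have h5 := h4.congr_of_eventuallyEq (f₁ := dtheta l z) (by
    filter_upwards [lt_mem_nhds hx] with y hy using F.dtheta_eq z hy)
  refine h5.congr_deriv ?_
  have e := F.eqA (z * x ^ 2)
  have hxc : (x : ℂ) ≠ 0 := by exact_mod_cast hx.ne'
  have e1 : x ^ (-l - 1 - 1) = x ^ (-l) / x ^ 2 := by
    rw [Real.rpow_sub_one hx.ne', Real.rpow_sub_one hx.ne']
    field_simp
  have e2 : x ^ l = x ^ (l + 1) / x := by rw [Real.rpow_add_one hx.ne']; field_simp
  -- This brings the terms created by differentiating the logarithm to the scale `x^{-l}` of the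
  -- series `A`. The terms still carrying a logarithm cancel because `φ_l` solves the equation.
  have e3 : F.c * z ^ F.n * ((x ^ (l + 1) : ℝ) : ℂ)
      = F.c * (z * x ^ 2) ^ F.n * ((x ^ (-l) : ℝ) : ℂ) := by
    rcases F.c_eq_zero_or with h | h
    · simp [h]
    · rw [rpow_of_eq h hx, mul_pow]
      push_cast
      ring
  rw [F.theta_eq z x hx, F.dphi_eq z hx, F.phi_eq z x hx, e1, e2]
  generalize F.S (z * x ^ 2) = s at *
  generalize F.S₁ (z * x ^ 2) = s₁ at *
  generalize F.A (z * x ^ 2) = a at *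
  generalize F.A₁ (z * x ^ 2) = a₁ at *
  generalize F.A₂ (z * x ^ 2) = a₂ at *
  push_cast
  field_simp
  linear_combination ((x ^ (-l) : ℝ) : ℂ) * e + ((2 * l + 1) * s + 4 * s₁) * e3

/-- The Wronskian of the free solutions. -/
lemma wronskian (F : Frobenius l) (z : ℂ) {x : ℝ} (hx : 0 < x) :
    dphi l z x * thetaFree l z x - phiFree l z x * dtheta l z x = 1 := by
  have w := frobenius_wronskian F.hS F.hS₁ F.hA F.hA₁ F.c_eq_zero_or F.eqS F.eqA F.wronskian_zero
    (z * x ^ 2)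
  have hxc : (x : ℂ) ≠ 0 := by exact_mod_cast hx.ne'
  have e1 : x ^ (-l - 1) = (x ^ l)⁻¹ / x := by
    rw [Real.rpow_sub_one hx.ne', Real.rpow_neg hx.le]
  have e2 : x ^ (l + 1) = x ^ l * x := Real.rpow_add_one hx.ne' l
  have e4 : x ^ (-l) = (x ^ l)⁻¹ := Real.rpow_neg hx.le l
  have hl : ((x ^ l : ℝ) : ℂ) ≠ 0 := by exact_mod_cast (Real.rpow_pos_of_pos hx l).ne'
  have e3 : F.c * z ^ F.n * (((x ^ l : ℝ) : ℂ) * ((x ^ l : ℝ) : ℂ) * x)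
      = F.c * (z * x ^ 2) ^ F.n := by
    rcases F.c_eq_zero_or with h | h
    · simp [h]
    · have := rpow_of_eq h hx
      rw [e2, e4, eq_comm, inv_mul_eq_iff_eq_mul₀ (Real.rpow_pos_of_pos hx l).ne'] at this
      have h5 : (((x ^ 2) ^ F.n : ℝ) : ℂ) = ((x ^ l * (x ^ l * x) : ℝ) : ℂ) := by rw [this]
      push_cast at h5
      rw [mul_pow, h5]
      ring
  rw [F.dtheta_eq z hx, F.theta_eq z x hx, F.dphi_eq z hx, F.phi_eq z x hx, e1, e2, e4]
  generalize F.S (z * x ^ 2) = s at *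
  generalize F.S₁ (z * x ^ 2) = s₁ at *
  generalize F.A (z * x ^ 2) = a at *
  generalize F.A₁ (z * x ^ 2) = a₁ at *
  push_cast
  field_simp
  linear_combination w - s ^ 2 * e3

lemma differentiable_phi (F : Frobenius l) {x : ℝ} (hx : 0 < x) : Differentiable ℂ fun z => phiFree l z x := by
  have h : (fun z => phiFree l z x) = fun z => ((x ^ (l + 1) : ℝ) : ℂ) * F.S (z * x ^ 2) :=
    funext fun z => F.phi_eq z x hx
  have := F.hS.differentiable
  rw [h]
  fun_prop

lemma differentiable_theta (F : Frobenius l) {x : ℝ} (hx : 0 < x) : Differentiable ℂ fun z => thetaFree l z x := by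
  have h := funext fun z => F.theta_eq z x hx
  have h1 := F.hA.differentiable
  have h2 := F.differentiable_phi hx
  rw [h]
  fun_prop

/-- Under `|z| x² ≤ 1` the argument of `S` and `S₁` stays in the unit disc, so compactness gives a
constant independent of `z`. -/
lemma exists_phi_bound (F : Frobenius l) :
    ∃ C, 0 ≤ C ∧ ∀ (z : ℂ) (x : ℝ), 0 < x → ‖z‖ * x ^ 2 ≤ 1 →
      ‖phiFree l z x‖ ≤ C * x ^ (l + 1) ∧ ‖dphi l z x‖ ≤ C * x ^ l := by
  obtain ⟨C₁, hC₁⟩ := (isCompact_closedBall (0 : ℂ) 1).exists_bound_of_continuousOn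
    F.hS.continuous.continuousOn
  obtain ⟨C₂, hC₂⟩ := (isCompact_closedBall (0 : ℂ) 1).exists_bound_of_continuousOn
    F.hS₁.continuous.continuousOn
  have h1 : 0 ≤ C₁ := (norm_nonneg _).trans (hC₁ 0 (by simp))
  have h2 : 0 ≤ C₂ := (norm_nonneg _).trans (hC₂ 0 (by simp))
  refine ⟨C₁ + |l + 1| * C₁ + 2 * C₂, by positivity, fun z x hx hzx => ?_⟩
  have hmem : z * (x : ℂ) ^ 2 ∈ Metric.closedBall (0 : ℂ) 1 := by
    rw [mem_closedBall_zero_iff, norm_mul, norm_pow, Complex.norm_real, Real.norm_of_nonneg hx.le]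
    exact hzx
  have b1 := hC₁ _ hmem
  have b2 := hC₂ _ hmem
  constructor
  · rw [F.phi_eq z x hx, norm_mul, Complex.norm_real,
      Real.norm_of_nonneg (Real.rpow_nonneg hx.le _), mul_comm]
    gcongr
    nlinarith [mul_nonneg (abs_nonneg (l + 1)) h1]
  · rw [F.dphi_eq z hx, norm_mul, Complex.norm_real,
      Real.norm_of_nonneg (Real.rpow_nonneg hx.le _), mul_comm]
    gcongr
    refine (norm_add_le _ _).trans ?_
    rw [norm_mul, norm_mul, Complex.norm_real, Real.norm_eq_abs, Complex.norm_ofNat]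
    nlinarith [mul_le_mul_of_nonneg_left b1 (abs_nonneg (l + 1))]

/-- Here the constant depends on `z`: the bound only serves integrability when the Green function is
split. For `l > -1/2` the power `x^{2l+1}` absorbs the logarithm; for `l = -1/2` it does not, whence
`logFactor`. -/
lemma exists_theta_bound (F : Frobenius l) (hl : -1 / 2 ≤ l) (z : ℂ) :
    ∃ K, 0 ≤ K ∧ ∀ x ∈ Ioc (0 : ℝ) 1,
      ‖thetaFree l z x‖ ≤ K * x ^ (-l) * logFactor l x ∧ ‖phiFree l z x‖ ≤ K * x ^ (l + 1) := by
  obtain ⟨C₁, hC₁⟩ := (isCompact_closedBall (0 : ℂ) ‖z‖).exists_bound_of_continuousOn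
    F.hS.continuous.continuousOn
  obtain ⟨C₂, hC₂⟩ := (isCompact_closedBall (0 : ℂ) ‖z‖).exists_bound_of_continuousOn
    F.hA.continuous.continuousOn
  have h1 : 0 ≤ C₁ := (norm_nonneg _).trans (hC₁ 0 (by simp))
  have h2 : 0 ≤ C₂ := (norm_nonneg _).trans (hC₂ 0 (by simp))
  -- a bound for `|log (x / 2)| x ^ (2 l + 1)`
  obtain ⟨M, hM0, hM⟩ : ∃ M, 0 ≤ M ∧ ∀ x ∈ Ioc (0 : ℝ) 1,
      |Real.log (x / 2)| * x ^ (2 * l + 1) ≤ M * logFactor l x := by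
    have hlog : ∀ x ∈ Ioc (0 : ℝ) 1, |Real.log (x / 2)| ≤ 1 - Real.log x := by
      intro x hx
      have h3 := Real.log_nonpos hx.1.le hx.2
      have h4 := Real.log_two_lt_d9
      have h5 := Real.log_two_gt_d9
      rw [Real.log_div hx.1.ne' two_ne_zero, abs_of_nonpos (by linarith)]
      linarith
    rcases eq_or_lt_of_le hl with h | h
    · refine ⟨1, zero_le_one, fun x hx => ?_⟩
      rw [logFactor, if_pos h.symm, ← h]
      norm_num
      exact hlog x hx
    · refine ⟨1 + 1 / (2 * l + 1), by have : 0 < 2 * l + 1 := by linarith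
                                      positivity, fun x hx => ?_⟩
      have hd : 0 < 2 * l + 1 := by linarith
      rw [logFactor, if_neg h.ne', mul_one]
      have h3 := Real.abs_log_mul_self_rpow_lt x (2 * l + 1) hx.1 hx.2 hd
      have h4 : x ^ (2 * l + 1) ≤ 1 := Real.rpow_le_one hx.1.le hx.2 hd.le
      have h5 : 0 ≤ x ^ (2 * l + 1) := Real.rpow_nonneg hx.1.le _
      rw [abs_mul, abs_of_nonneg h5, abs_of_nonpos (Real.log_nonpos hx.1.le hx.2)] at h3
      have h6 := mul_le_mul_of_nonneg_right (hlog x hx) h5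
      nlinarith
  have hL : ∀ x ∈ Ioc (0 : ℝ) 1, 1 ≤ logFactor l x := by
    intro x hx
    rw [logFactor]
    split_ifs
    · have := Real.log_nonpos hx.1.le hx.2
      linarith
    · exact le_rfl
  set N := ‖F.c * z ^ F.n‖ with hN
  refine ⟨C₁ + C₂ + N * M * C₁, by positivity, fun x hx => ?_⟩
  have hmem : z * (x : ℂ) ^ 2 ∈ Metric.closedBall (0 : ℂ) ‖z‖ := by
    rw [mem_closedBall_zero_iff, norm_mul, norm_pow, Complex.norm_real,
      Real.norm_of_nonneg hx.1.le]
    exact mul_le_of_le_one_right (norm_nonneg _) (pow_le_one₀ hx.1.le hx.2)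
  have b1 := hC₁ _ hmem
  have b2 := hC₂ _ hmem
  have hx0 := hx.1
  have hphi : ‖phiFree l z x‖ ≤ C₁ * x ^ (l + 1) := by
    rw [F.phi_eq z x hx0, norm_mul, Complex.norm_real,
      Real.norm_of_nonneg (Real.rpow_nonneg hx0.le _), mul_comm]
    gcongr
  refine ⟨?_, hphi.trans ?_⟩
  · have hp : 0 < x ^ (-l) := Real.rpow_pos_of_pos hx0 _
    have e : x ^ (l + 1) = x ^ (2 * l + 1) * x ^ (-l) := by
      rw [← Real.rpow_add hx0]
      congr 1
      ring
    calc ‖thetaFree l z x‖ ≤ x ^ (-l) * C₂ + N * |Real.log (x / 2)| * (C₁ * x ^ (l + 1)) := by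
          rw [F.theta_eq z x hx0]
          refine (norm_add_le _ _).trans ?_
          rw [norm_mul, norm_mul, norm_mul, Complex.norm_real, Complex.norm_real,
            Real.norm_of_nonneg hp.le, Real.norm_eq_abs]
          gcongr
      _ = x ^ (-l) * (C₂ + N * C₁ * (|Real.log (x / 2)| * x ^ (2 * l + 1))) := by rw [e]; ring
      _ ≤ x ^ (-l) * (C₂ * logFactor l x + N * C₁ * (M * logFactor l x)) := by
          have e1 := le_mul_of_one_le_right h2 (hL x hx)
          have e2 := mul_le_mul_of_nonneg_left (hM x hx) (mul_nonneg (norm_nonneg _ : 0 ≤ N) h1)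
          exact mul_le_mul_of_nonneg_left (add_le_add e1 e2) hp.le
      _ ≤ (C₁ + C₂ + N * M * C₁) * x ^ (-l) * logFactor l x := by
          have := mul_nonneg (mul_nonneg h1 hp.le) (zero_le_one.trans (hL x hx))
          linarith
  · gcongr
    nlinarith [mul_nonneg (mul_nonneg (norm_nonneg (F.c * z ^ F.n)) hM0) h1]

end Frobenius

end

section

/-! ### Estimates for solutions of the free equation -/

/-- `u` is a solution of the free equation on `(0, ∞)` with derivative `v`. -/
structure FreeSol (l : ℝ) (z : ℂ) (u v : ℝ → ℂ) : Prop where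
  deriv : ∀ x, 0 < x → HasDerivAt u (v x) x
  deriv₂ : ∀ x, 0 < x → HasDerivAt v (((l * (l + 1) / x ^ 2 : ℝ) - z) * u x) x

variable {l : ℝ} {z : ℂ} {u v : ℝ → ℂ}

/-- With `s = √z` one has `|z| - z = s (s̄ - s)`. This quantity drives the growth of the energy
below and thus produces `e^{|Im √z| x}`. -/
lemma norm_sub_norm_self (z : ℂ) :
    ‖(‖z‖ : ℂ) - z‖ = 2 * Real.sqrt ‖z‖ * |(csqrt z).im| := by
  set s := csqrt z with hs
  have h1 : z = s * s := by rw [← pow_two, csqrt_sq]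
  have h2 : ‖z‖ = ‖s‖ * ‖s‖ := by rw [h1, norm_mul]
  have h3 : Real.sqrt ‖z‖ = ‖s‖ := by rw [h2, Real.sqrt_mul_self (norm_nonneg _)]
  have h4 : (‖z‖ : ℂ) - z = s * ((starRingEnd ℂ) s - s) := by
    rw [mul_sub, Complex.mul_conj, Complex.normSq_eq_norm_sq, ← h1, h2, pow_two]
  have h5 : (starRingEnd ℂ) s - s = ((-2 * s.im : ℝ) : ℂ) * Complex.I := by
    apply Complex.ext <;> simp
    ring
  rw [h4, norm_mul, h3, h5, norm_mul, Complex.norm_real, Complex.norm_I, Real.norm_eq_abs, abs_mul]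
  norm_num
  ring

/-- The arithmetic–geometric mean inequality `2 k a b ≤ b² + k² a²` bounds the cross term of the
energy derivative by a multiple of the energy. -/
lemma energy_deriv_le {V k σ a b : ℝ} {c : ℝ} (hk : 0 < k) (ha : 0 ≤ a) (hb : 0 ≤ b)
    (hc : c ≤ V + 2 * k * σ) (hV : 0 ≤ V) (hσ : 0 ≤ σ) :
    2 * (c * (a * b)) ≤ (2 * σ + V / k) * (b ^ 2 + k ^ 2 * a ^ 2) := by
  have h1 : 2 * (k * a * b) ≤ b ^ 2 + k ^ 2 * a ^ 2 := by nlinarith [sq_nonneg (k * a - b)]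
  have h2 : c * (a * b) ≤ (V + 2 * k * σ) * (a * b) := by gcongr
  have h3 : (V + 2 * k * σ) * (a * b) = (2 * σ + V / k) * (k * a * b) := by
    field_simp
    ring
  have h4 : 0 ≤ 2 * σ + V / k := by positivity
  nlinarith [mul_le_mul_of_nonneg_left h1 h4]

/-- The energy estimate in the oscillatory region. -/
lemma FreeSol.energy (h : FreeSol l z u v) {x₀ x : ℝ} (hx₀ : 0 < x₀) (hx : x₀ ≤ x)
    (hk : 1 ≤ Real.sqrt ‖z‖ * x₀) :
    ‖v x‖ ^ 2 + ‖z‖ * ‖u x‖ ^ 2 ≤ Real.exp |l * (l + 1)|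
      * (‖v x₀‖ ^ 2 + ‖z‖ * ‖u x₀‖ ^ 2) * Real.exp (2 * |(csqrt z).im| * (x - x₀)) := by
  set k := Real.sqrt ‖z‖ with hkdef
  set σ := |(csqrt z).im| with hσ
  set V := |l * (l + 1)| with hV
  have hk0 : 0 < k := pos_of_mul_pos_left (one_pos.trans_le hk) hx₀.le
  have hzk : ‖z‖ = k ^ 2 := (Real.sq_sqrt (norm_nonneg z)).symm
  -- Using `|z|` instead of `z` makes the energy nonnegative; its derivative then contains only the
  -- coefficient `l(l+1)/t² + (|z| - z)`.
  set E : ℝ → ℝ := fun x => ‖v x‖ ^ 2 + ‖z‖ * ‖u x‖ ^ 2 with hE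
  have hEd : ∀ t, 0 < t → HasDerivAt E (2 * inner ℝ (v t) (((l * (l + 1) / t ^ 2 : ℝ) - z) * u t)
      + ‖z‖ * (2 * inner ℝ (u t) (v t))) t := fun t ht =>
    (h.deriv₂ t ht).norm_sq.add ((h.deriv t ht).norm_sq.const_mul _)
  have hEle : ∀ t, 0 < t → 2 * inner ℝ (v t) (((l * (l + 1) / t ^ 2 : ℝ) - z) * u t)
      + ‖z‖ * (2 * inner ℝ (u t) (v t)) ≤ (2 * σ + V / t ^ 2 / k) * E t := by
    intro t ht
    have e1 : 2 * inner ℝ (v t) (((l * (l + 1) / t ^ 2 : ℝ) - z) * u t)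
        + ‖z‖ * (2 * inner ℝ (u t) (v t))
        = 2 * inner ℝ (v t) ((((l * (l + 1) / t ^ 2 : ℝ) : ℂ) + ((‖z‖ : ℂ) - z)) * u t) := by
      simp only [Complex.inner, Complex.mul_re, Complex.mul_im, Complex.sub_re, Complex.sub_im,
        Complex.add_re, Complex.add_im, Complex.ofReal_re, Complex.ofReal_im, Complex.conj_re,
        Complex.conj_im]
      ring
    rw [e1]
    have e2 := real_inner_le_norm (v t)
      ((((l * (l + 1) / t ^ 2 : ℝ) : ℂ) + ((‖z‖ : ℂ) - z)) * u t)
    rw [norm_mul] at e2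
    have e3 : ‖(((l * (l + 1) / t ^ 2 : ℝ) : ℂ) + ((‖z‖ : ℂ) - z))‖ ≤ V / t ^ 2 + 2 * k * σ := by
      refine (norm_add_le _ _).trans (le_of_eq ?_)
      rw [norm_sub_norm_self, Complex.norm_real, Real.norm_eq_abs, abs_div, abs_of_pos (pow_pos ht 2)]
    have e4 := energy_deriv_le hk0 (norm_nonneg (u t)) (norm_nonneg (v t)) e3 (by positivity)
      (abs_nonneg _)
    rw [← hzk] at e4
    refine le_trans ?_ e4
    nlinarith [e2]
  -- Grönwall by an integrating factor: `2 σ t - V / (k t)` is a primitive of `2 σ + V / (k t²)`.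
  set Ψ : ℝ → ℝ := fun t => E t * Real.exp (-(2 * σ * t - V / k * t⁻¹)) with hΨ
  have hΨd : ∀ t, 0 < t → HasDerivAt Ψ
      ((2 * inner ℝ (v t) (((l * (l + 1) / t ^ 2 : ℝ) - z) * u t)
      + ‖z‖ * (2 * inner ℝ (u t) (v t))) * Real.exp (-(2 * σ * t - V / k * t⁻¹))
      + E t * (Real.exp (-(2 * σ * t - V / k * t⁻¹)) * (-(2 * σ + V / t ^ 2 / k)))) t := by
    intro t ht
    refine (hEd t ht).mul (HasDerivAt.exp ?_)
    have h1 : HasDerivAt (fun t : ℝ => 2 * σ * t - V / k * t⁻¹)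
        (2 * σ * 1 - V / k * (-(t ^ 2)⁻¹)) t :=
      ((hasDerivAt_id t).const_mul _).sub ((hasDerivAt_inv ht.ne').const_mul _)
    refine h1.neg.congr_deriv ?_
    field_simp
    ring
  have hanti : AntitoneOn Ψ (Ioi 0) := by
    refine antitoneOn_of_deriv_nonpos (convex_Ioi 0)
      (fun t ht => (hΨd t ht).continuousAt.continuousWithinAt)
      (fun t ht => (hΨd t (interior_subset ht)).differentiableAt.differentiableWithinAt)
      fun t ht => ?_
    have ht0 : 0 < t := interior_subset ht
    rw [(hΨd t ht0).deriv]
    have := mul_le_mul_of_nonneg_right (hEle t ht0) (Real.exp_pos (-(2 * σ * t - V / k * t⁻¹))).le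
    nlinarith
  have hfin := hanti (show x₀ ∈ Ioi (0 : ℝ) from hx₀) (show x ∈ Ioi (0 : ℝ) from hx₀.trans_le hx) hx
  have hE0 : 0 ≤ E x₀ := by positivity
  have hx0 : 0 < x := hx₀.trans_le hx
  calc E x = Ψ x * Real.exp (2 * σ * x - V / k * x⁻¹) := by
        simp only [hΨ]
        rw [mul_assoc, ← Real.exp_add]
        simp
    _ ≤ Ψ x₀ * Real.exp (2 * σ * x - V / k * x⁻¹) := by gcongr
    _ = E x₀ * Real.exp (2 * σ * (x - x₀) + (V / k * x₀⁻¹ - V / k * x⁻¹)) := by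
        simp only [hΨ]
        rw [mul_assoc, ← Real.exp_add]
        ring_nf
    _ ≤ E x₀ * Real.exp (2 * σ * (x - x₀) + V) := by
        gcongr
        -- The singular potential costs only the factor `e^V`, because `k x₀ ≥ 1`.
        have h1 : V / k * x₀⁻¹ ≤ V := by
          rw [← div_eq_mul_inv, div_div]
          exact div_le_self (abs_nonneg _) hk
        have h2 : 0 ≤ V / k * x⁻¹ := by positivity
        linarith
    _ = _ := by rw [Real.exp_add]; ring

lemma FreeSol.bound_large (h : FreeSol l z u v) {x₀ x a : ℝ} (hx₀ : 0 < x₀) (hx : x₀ ≤ x)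
    (hk : 1 ≤ Real.sqrt ‖z‖ * x₀) (hv : ‖v x₀‖ ≤ a) (hu : Real.sqrt ‖z‖ * ‖u x₀‖ ≤ a) :
    ‖v x‖ ≤ 2 * Real.exp |l * (l + 1)| * a * Real.exp (|(csqrt z).im| * (x - x₀)) ∧
    Real.sqrt ‖z‖ * ‖u x‖
      ≤ 2 * Real.exp |l * (l + 1)| * a * Real.exp (|(csqrt z).im| * (x - x₀)) := by
  have ha : 0 ≤ a := (norm_nonneg _).trans hv
  have hE := h.energy hx₀ hx hk
  have hzk : ‖z‖ = Real.sqrt ‖z‖ ^ 2 := (Real.sq_sqrt (norm_nonneg z)).symm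
  set k := Real.sqrt ‖z‖ with hkdef
  have hkn : 0 ≤ k := Real.sqrt_nonneg _
  rw [hzk, ← mul_pow, ← mul_pow] at hE
  set e := Real.exp |l * (l + 1)| with he
  have he1 : 1 ≤ e := Real.one_le_exp (abs_nonneg _)
  set g := Real.exp (|(csqrt z).im| * (x - x₀)) with hg
  have hg2 : Real.exp (2 * |(csqrt z).im| * (x - x₀)) = g ^ 2 := by
    rw [hg, ← Real.exp_nat_mul]
    push_cast
    ring_nf
  rw [hg2] at hE
  have h1 : ‖v x₀‖ ^ 2 ≤ a ^ 2 := by gcongr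
  have h2 : (k * ‖u x₀‖) ^ 2 ≤ a ^ 2 := by gcongr
  have h3 : e * (‖v x₀‖ ^ 2 + (k * ‖u x₀‖) ^ 2) * g ^ 2 ≤ (2 * e * a * g) ^ 2 := by
    calc e * (‖v x₀‖ ^ 2 + (k * ‖u x₀‖) ^ 2) * g ^ 2 ≤ e * (a ^ 2 + a ^ 2) * g ^ 2 := by gcongr
      _ = 2 * e * (a * g) ^ 2 := by ring
      _ ≤ 4 * e ^ 2 * (a * g) ^ 2 := by
          have : 2 * e ≤ 4 * e ^ 2 := by nlinarith
          gcongr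
      _ = _ := by ring
  have hr : 0 ≤ 2 * e * a * g := by positivity
  constructor
  · refine le_of_sq_le_sq ?_ hr
    nlinarith [sq_nonneg (k * ‖u x‖)]
  · refine le_of_sq_le_sq ?_ hr
    nlinarith [sq_nonneg ‖v x‖]

lemma one_le_logFactor {x : ℝ} (hx : x ∈ Ioc (0 : ℝ) 1) : 1 ≤ logFactor l x := by
  rw [logFactor]
  split_ifs
  · have := Real.log_nonpos hx.1.le hx.2
    linarith
  · exact le_rfl

/-- The weight `t^{-(2l+2)}` is the coefficient in the equation for `x^{-l-1} u`. At `l = -1/2` its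
primitive is a logarithm, which is how `logFactor` enters the Green function bound. -/
lemma exists_rpow_primitive (hl : -1 / 2 ≤ l) :
    ∃ C, 1 ≤ C ∧ ∀ y ∈ Ioc (0 : ℝ) 1, ∃ J : ℝ → ℝ,
      (∀ t, 0 < t → HasDerivAt J (t ^ (-(2 * l + 2))) t) ∧ J y = 0 ∧
      ∀ t ∈ Ioc (0 : ℝ) 1, J t ≤ C * y ^ (-(2 * l + 1)) * logFactor l y := by
  rcases eq_or_lt_of_le hl with h | h
  · refine ⟨1, le_rfl, fun y hy => ⟨fun t => Real.log t - Real.log y, fun t ht => ?_, sub_self _,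
      fun t ht => ?_⟩⟩
    · rw [← h]
      norm_num
      rw [Real.rpow_neg_one]
      exact Real.hasDerivAt_log ht.ne'
    · rw [← h, logFactor, if_pos rfl]
      norm_num
      have := Real.log_nonpos ht.1.le ht.2
      linarith
  · have hd : 0 < 2 * l + 1 := by linarith
    refine ⟨1 + 1 / (2 * l + 1), by linarith [one_div_pos.2 hd], fun y hy =>
      ⟨fun t => (y ^ (-(2 * l + 1)) - t ^ (-(2 * l + 1))) / (2 * l + 1), fun t ht => ?_, by simp,
      fun t ht => ?_⟩⟩
    · have := ((Real.hasDerivAt_rpow_const (x := t) (p := -(2 * l + 1)) (Or.inl ht.ne')).const_sub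
        (y ^ (-(2 * l + 1)))).div_const (2 * l + 1)
      refine this.congr_deriv ?_
      rw [show -(2 * l + 1) - 1 = -(2 * l + 2) by ring]
      field_simp
    · rw [logFactor, if_neg h.ne', mul_one]
      have h1 : 0 < y ^ (-(2 * l + 1)) := Real.rpow_pos_of_pos hy.1 _
      have h2 : 0 < t ^ (-(2 * l + 1)) := Real.rpow_pos_of_pos ht.1 _
      calc (y ^ (-(2 * l + 1)) - t ^ (-(2 * l + 1))) / (2 * l + 1)
          ≤ y ^ (-(2 * l + 1)) / (2 * l + 1) := by gcongr; linarith
        _ = 1 / (2 * l + 1) * y ^ (-(2 * l + 1)) := by ring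
        _ ≤ _ := by gcongr; linarith

end

/-! ### The singular region: a rescaled first order system. -/

section

variable {l : ℝ} {z : ℂ} {u v : ℝ → ℂ}

/-- The first order system for `x ^ (-l-1) u` and `x ^ (l+1) (u' - (l+1) u / x)`. -/
lemma FreeSol.hasDerivAt_rescaled (h : FreeSol l z u v) {t : ℝ} (ht : 0 < t) :
    HasDerivAt (fun t : ℝ => ((t ^ (-(l + 1)) : ℝ) : ℂ) * u t)
      (((t ^ (-(2 * l + 2)) : ℝ) : ℂ) *
        (((t ^ (l + 1) : ℝ) : ℂ) * (v t - ((l + 1) / t : ℝ) * u t))) t ∧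
    HasDerivAt (fun t : ℝ => ((t ^ (l + 1) : ℝ) : ℂ) * (v t - ((l + 1) / t : ℝ) * u t))
      (-z * ((t ^ (2 * l + 2) : ℝ) : ℂ) * (((t ^ (-(l + 1)) : ℝ) : ℂ) * u t)) t := by
  have hp : ∀ s : ℝ, HasDerivAt (fun t : ℝ => ((t ^ s : ℝ) : ℂ)) ((s * (t ^ s / t) : ℝ) : ℂ) t := by
    intro s
    rw [← Real.rpow_sub_one ht.ne']
    exact (Real.hasDerivAt_rpow_const (Or.inl ht.ne')).ofReal_comp
  have htc : (t : ℂ) ≠ 0 := by exact_mod_cast ht.ne'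
  have hX : 0 < t ^ (l + 1) := Real.rpow_pos_of_pos ht _
  have hXc : ((t ^ (l + 1) : ℝ) : ℂ) ≠ 0 := by exact_mod_cast hX.ne'
  have e1 : t ^ (2 * l + 2) = t ^ (l + 1) * t ^ (l + 1) := by
    rw [← Real.rpow_add ht]
    ring_nf
  have e2 : t ^ (-(2 * l + 2)) = (t ^ (l + 1) * t ^ (l + 1))⁻¹ := by
    rw [Real.rpow_neg ht.le, e1]
  have e3 : t ^ (-(l + 1)) = (t ^ (l + 1))⁻¹ := Real.rpow_neg ht.le _
  have hd := h.deriv t ht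
  constructor
  · refine ((hp _).mul hd).congr_deriv ?_
    rw [e2, e3]
    push_cast
    field_simp
    ring
  · have hinv : HasDerivAt (fun t : ℝ => (((l + 1) / t : ℝ) : ℂ))
        (((l + 1) * (-(t ^ 2)⁻¹) : ℝ) : ℂ) t := by
      have := ((hasDerivAt_inv ht.ne').const_mul (l + 1)).ofReal_comp
      simpa [div_eq_mul_inv] using this
    refine ((hp _).mul ((h.deriv₂ t ht).sub (hinv.mul hd))).congr_deriv ?_
    rw [e1, e3]
    simp only [Pi.sub_apply, Pi.mul_apply]
    push_cast
    field_simp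
    ring

/-- The estimate near the singularity for the solution with `u(y) = 0`, `u'(y) = 1`. -/
lemma exists_bound_small (hl : -1 / 2 ≤ l) :
    ∃ C, 0 ≤ C ∧ ∀ (z : ℂ) (u v : ℝ → ℂ), FreeSol l z u v → ∀ x y : ℝ, 0 < y → y ≤ x → x ≤ 1 →
      ‖z‖ * x ^ 2 ≤ 1 → u y = 0 → v y = 1 →
      ‖u x‖ ≤ C * (x ^ (l + 1) * y ^ (-l) * logFactor l y) ∧
      ‖v x‖ ≤ C * (x ^ l * y ^ (-l) * logFactor l y) := by
  obtain ⟨C₀, hC₀, hJ⟩ := exists_rpow_primitive hl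
  refine ⟨2 * C₀ + 1 + 2 * C₀ + |l + 1| * (2 * C₀), by positivity,
    fun z u v h x y hy hyx hx1 hzx huy hvy => ?_⟩
  have hx : 0 < x := hy.trans_le hyx
  have hymem : y ∈ Ioc (0 : ℝ) 1 := ⟨hy, hyx.trans hx1⟩
  obtain ⟨J, hJd, hJy, hJle⟩ := hJ y hymem
  set L := logFactor l y with hL
  have hL1 : 1 ≤ L := one_le_logFactor hymem
  set U : ℝ → ℂ := fun t => ((t ^ (-(l + 1)) : ℝ) : ℂ) * u t with hU
  set W : ℝ → ℂ := fun t => ((t ^ (l + 1) : ℝ) : ℂ) * (v t - ((l + 1) / t : ℝ) * u t) with hW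
  have hpos : ∀ t ∈ Icc y x, 0 < t := fun t ht => hy.trans_le ht.1
  have hUd : ∀ t, 0 < t → HasDerivAt U (((t ^ (-(2 * l + 2)) : ℝ) : ℂ) * W t) t :=
    fun t ht => (h.hasDerivAt_rescaled ht).1
  have hWd : ∀ t, 0 < t → HasDerivAt W (-z * ((t ^ (2 * l + 2) : ℝ) : ℂ) * U t) t :=
    fun t ht => (h.hasDerivAt_rescaled ht).2
  have hUc : ContinuousOn U (Icc y x) := fun t ht =>
    (hUd t (hpos t ht)).continuousAt.continuousWithinAt
  have hWc : ContinuousOn W (Icc y x) := fun t ht =>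
    (hWd t (hpos t ht)).continuousAt.continuousWithinAt
  -- Let `M` be the maximum of `|U|`. Integrating the equation for `W` and then that for `U` bounds
  -- `M` by the data plus a fraction of `M`, which is absorbed.
  obtain ⟨τ, hτ, hmax⟩ := isCompact_Icc.exists_isMaxOn (nonempty_Icc.2 hyx) hUc.norm
  set M := ‖U τ‖ with hM
  have hM0 : 0 ≤ M := norm_nonneg _
  have hUM : ∀ t ∈ Icc y x, ‖U t‖ ≤ M := fun t ht => hmax ht
  have h23 : 2 ≤ 2 * l + 3 := by linarith
  have hWy : ‖W y‖ = y ^ (l + 1) := by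
    simp only [hW, huy, hvy, mul_zero, sub_zero, mul_one]
    rw [Complex.norm_real, Real.norm_of_nonneg (Real.rpow_nonneg hy.le _)]
  have hWle : ∀ t ∈ Icc y x, ‖W t‖ ≤ y ^ (l + 1) + ‖z‖ * M * (t ^ (2 * l + 3) / (2 * l + 3)) := by
    refine image_norm_le_of_norm_deriv_right_le_deriv_boundary' hWc
      (f' := fun t => -z * ((t ^ (2 * l + 2) : ℝ) : ℂ) * U t)
      (B' := fun t => ‖z‖ * M * t ^ (2 * l + 2))
      (fun t ht => (hWd t (hpos t ⟨ht.1, ht.2.le⟩)).hasDerivWithinAt) ?_ ?_ ?_ ?_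
    · rw [hWy]
      have : 0 ≤ ‖z‖ * M * (y ^ (2 * l + 3) / (2 * l + 3)) := by positivity
      linarith
    · refine continuousOn_const.add (continuousOn_const.mul (ContinuousOn.div_const ?_ _))
      exact fun t ht => (Real.continuousAt_rpow_const _ _
        (Or.inl (hpos t ht).ne')).continuousWithinAt
    · intro t ht
      have h1 := ((Real.hasDerivAt_rpow_const (x := t) (p := 2 * l + 3)
        (Or.inl (hpos t ⟨ht.1, ht.2.le⟩).ne')).div_const (2 * l + 3)).const_mul (‖z‖ * M)
      refine ((h1.const_add (y ^ (l + 1))).congr_deriv ?_).hasDerivWithinAt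
      rw [show 2 * l + 3 - 1 = 2 * l + 2 by ring]
      field_simp
    · intro t ht
      have ht' : t ∈ Icc y x := ⟨ht.1, ht.2.le⟩
      have h1 := Real.rpow_nonneg (hpos t ht').le (2 * l + 2)
      rw [norm_mul, norm_mul, norm_neg, Complex.norm_real, Real.norm_of_nonneg h1]
      calc ‖z‖ * t ^ (2 * l + 2) * ‖U t‖ ≤ ‖z‖ * t ^ (2 * l + 2) * M := by
            gcongr
            exact hUM t ht'
        _ = _ := by ring
  have hUle : ∀ t ∈ Icc y x, ‖U t‖ ≤ y ^ (l + 1) * J t + ‖z‖ * M * (t ^ 2 / (2 * (2 * l + 3))) := by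
    refine image_norm_le_of_norm_deriv_right_le_deriv_boundary' hUc
      (f' := fun t => ((t ^ (-(2 * l + 2)) : ℝ) : ℂ) * W t)
      (B' := fun t => y ^ (l + 1) * t ^ (-(2 * l + 2)) + ‖z‖ * M * (t / (2 * l + 3)))
      (fun t ht => (hUd t (hpos t ⟨ht.1, ht.2.le⟩)).hasDerivWithinAt) ?_ ?_ ?_ ?_
    · simp only [hU, huy, mul_zero, norm_zero, hJy, zero_add]
      positivity
    · refine ContinuousOn.add (continuousOn_const.mul fun t ht =>
        (hJd t (hpos t ht)).continuousAt.continuousWithinAt) ?_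
      fun_prop
    · intro t ht
      have h1 := (((hasDerivAt_pow 2 t).div_const (2 * (2 * l + 3))).const_mul (‖z‖ * M))
      refine ((((hJd t (hpos t ⟨ht.1, ht.2.le⟩)).const_mul (y ^ (l + 1))).add
        h1).congr_deriv ?_).hasDerivWithinAt
      push_cast
      field_simp
    · intro t ht
      have ht' : t ∈ Icc y x := ⟨ht.1, ht.2.le⟩
      have ht0 := hpos t ht'
      have h1 := Real.rpow_nonneg ht0.le (-(2 * l + 2))
      have e : t ^ (-(2 * l + 2)) * t ^ (2 * l + 3) = t := by
        rw [← Real.rpow_add ht0]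
        norm_num
      rw [norm_mul, Complex.norm_real, Real.norm_of_nonneg h1]
      calc t ^ (-(2 * l + 2)) * ‖W t‖
          ≤ t ^ (-(2 * l + 2)) * (y ^ (l + 1) + ‖z‖ * M * (t ^ (2 * l + 3) / (2 * l + 3))) := by
            gcongr
            exact hWle t ht'
        _ = y ^ (l + 1) * t ^ (-(2 * l + 2))
            + ‖z‖ * M * ((t ^ (-(2 * l + 2)) * t ^ (2 * l + 3)) / (2 * l + 3)) := by ring
        _ = _ := by rw [e]
  have hyl : y ^ (l + 1) * y ^ (-(2 * l + 1)) = y ^ (-l) := by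
    rw [← Real.rpow_add hy]
    ring_nf
  have hyp : 0 < y ^ (-l) := Real.rpow_pos_of_pos hy _
  have hMle : M ≤ 2 * C₀ * y ^ (-l) * L := by
    have hτ0 := hpos τ hτ
    have h1 := hUle τ hτ
    have h2 : y ^ (l + 1) * J τ ≤ C₀ * y ^ (-l) * L := by
      calc y ^ (l + 1) * J τ ≤ y ^ (l + 1) * (C₀ * y ^ (-(2 * l + 1)) * L) := by
            gcongr
            exact hJle τ ⟨hτ0, hτ.2.trans hx1⟩
        _ = C₀ * (y ^ (l + 1) * y ^ (-(2 * l + 1))) * L := by ring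
        _ = _ := by rw [hyl]
    -- `|z| τ² ≤ 1` and `2l + 3 ≥ 2` give the fraction `1/4`; absorbing it leaves the factor `4/3 ≤
    -- 2`.
    have h3 : ‖z‖ * M * (τ ^ 2 / (2 * (2 * l + 3))) ≤ M / 4 := by
      have h4 : ‖z‖ * τ ^ 2 ≤ 1 := by
        refine le_trans ?_ hzx
        have := hτ.2
        gcongr
      calc ‖z‖ * M * (τ ^ 2 / (2 * (2 * l + 3))) = M * (‖z‖ * τ ^ 2 / (2 * (2 * l + 3))) := by ring
        _ ≤ M * (1 / (2 * 2)) := by gcongr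
        _ = M / 4 := by ring
    have h5 : 0 ≤ C₀ * y ^ (-l) * L := by positivity
    linarith
  have hxmem : x ∈ Icc y x := ⟨hyx, le_rfl⟩
  have hX : 0 < x ^ (l + 1) := Real.rpow_pos_of_pos hx _
  have hX' : 0 < x ^ l := Real.rpow_pos_of_pos hx _
  have hXX : x ^ (l + 1) = x ^ l * x := Real.rpow_add_one hx.ne' l
  have hux : ‖u x‖ ≤ 2 * C₀ * (x ^ (l + 1) * y ^ (-l) * L) := by
    have e : u x = ((x ^ (l + 1) : ℝ) : ℂ) * U x := by
      have hne : ((x ^ (l + 1) : ℝ) : ℂ) ≠ 0 := by exact_mod_cast hX.ne'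
      simp only [hU]
      rw [Real.rpow_neg hx.le]
      push_cast
      field_simp
    rw [e, norm_mul, Complex.norm_real, Real.norm_of_nonneg hX.le]
    calc x ^ (l + 1) * ‖U x‖ ≤ x ^ (l + 1) * (2 * C₀ * y ^ (-l) * L) := by
          gcongr
          exact (hUM x hxmem).trans hMle
      _ = _ := by ring
  have hb : 0 ≤ x ^ l * y ^ (-l) * L := by positivity
  refine ⟨hux.trans ?_, ?_⟩
  · have h1 : 0 ≤ x ^ (l + 1) * y ^ (-l) * L := by positivity
    gcongr
    have : 0 ≤ |l + 1| * (2 * C₀) := by positivity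
    linarith
  -- The derivative is recovered from `W` and `(l+1) u / x`; their contributions are `1 + 2 C₀` and
  -- `|l+1| 2 C₀` in the constant.
  · have e : v x = (((x ^ (l + 1))⁻¹ : ℝ) : ℂ) * W x + (((l + 1) / x : ℝ) : ℂ) * u x := by
      have hne : ((x ^ (l + 1) : ℝ) : ℂ) ≠ 0 := by exact_mod_cast hX.ne'
      simp only [hW]
      push_cast
      field_simp
      ring
    have hWx : (x ^ (l + 1))⁻¹ * ‖W x‖ ≤ (1 + 2 * C₀) * (x ^ l * y ^ (-l) * L) := by
      have h1 : ‖W x‖ ≤ y ^ (l + 1) + M * x ^ (2 * l + 1) := by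
        refine (hWle x hxmem).trans ?_
        refine add_le_add le_rfl ?_
        have e3 : x ^ (2 * l + 3) = x ^ (2 * l + 1) * x ^ 2 := by
          rw [← Real.rpow_natCast x 2, ← Real.rpow_add hx]
          norm_num
          ring_nf
        have hp := Real.rpow_nonneg hx.le (2 * l + 1)
        calc ‖z‖ * M * (x ^ (2 * l + 3) / (2 * l + 3))
            = M * x ^ (2 * l + 1) * (‖z‖ * x ^ 2) / (2 * l + 3) := by rw [e3]; ring
          _ ≤ M * x ^ (2 * l + 1) * 1 / 1 := by gcongr; linarith
          _ = _ := by ring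
      have h2 : y ^ (l + 1) ≤ x ^ (2 * l + 1) * y ^ (-l) := by
        have : y ^ (l + 1) = y ^ (2 * l + 1) * y ^ (-l) := by
          rw [← Real.rpow_add hy]
          ring_nf
        rw [this]
        gcongr
        linarith
      have h3 : (x ^ (l + 1))⁻¹ * x ^ (2 * l + 1) = x ^ l := by
        rw [← Real.rpow_neg hx.le, ← Real.rpow_add hx]
        ring_nf
      have h4 : 0 ≤ x ^ (2 * l + 1) := Real.rpow_nonneg hx.le _
      calc (x ^ (l + 1))⁻¹ * ‖W x‖
          ≤ (x ^ (l + 1))⁻¹ * (x ^ (2 * l + 1) * y ^ (-l) + M * x ^ (2 * l + 1)) := by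
            gcongr
            linarith
        _ = x ^ l * (y ^ (-l) + M) := by
            rw [← h3]
            ring
        _ ≤ x ^ l * (y ^ (-l) * L + 2 * C₀ * y ^ (-l) * L) := by
            gcongr
            exact le_mul_of_one_le_right hyp.le hL1
        _ = _ := by ring
    have hu' : ‖(((l + 1) / x : ℝ) : ℂ) * u x‖ ≤ |l + 1| * (2 * C₀) * (x ^ l * y ^ (-l) * L) := by
      rw [norm_mul, Complex.norm_real, Real.norm_eq_abs, abs_div, abs_of_pos hx]
      calc |l + 1| / x * ‖u x‖ ≤ |l + 1| / x * (2 * C₀ * (x ^ (l + 1) * y ^ (-l) * L)) := by gcongr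
        _ = _ := by
          rw [hXX]
          field_simp
    rw [e]
    refine (norm_add_le _ _).trans ?_
    rw [norm_mul, Complex.norm_real, Real.norm_of_nonneg (inv_nonneg.2 hX.le)]
    have h5 : 0 ≤ 2 * C₀ * (x ^ l * y ^ (-l) * L) := by positivity
    linarith

end

section

/-! ### Bounds for the regular free solution and for the Green function -/

/-- `x / (1 + |z|^{1/2} x)`. -/
def wt (z : ℂ) (x : ℝ) : ℝ := x / (1 + Real.sqrt ‖z‖ * x)

/-- `∂ₓ G_l(z, x, y)`. -/
def dgreen (l : ℝ) (z : ℂ) (x y : ℝ) : ℂ :=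
  dphi l z x * thetaFree l z y - phiFree l z y * dtheta l z x

variable {l : ℝ} {z : ℂ} {u v : ℝ → ℂ}

lemma wt_pos (z : ℂ) {x : ℝ} (hx : 0 < x) : 0 < wt z x := by
  rw [wt]
  positivity

lemma Frobenius.freeSol_phi (F : Frobenius l) (z : ℂ) : FreeSol l z (phiFree l z) (dphi l z) :=
  ⟨fun _ hx => F.hasDerivAt_phi z hx, fun _ hx => F.hasDerivAt_dphi z hx⟩

/-- Together with `green_self` and `Frobenius.dgreen_self` this characterizes the kernel by Cauchy
data `(0, 1)` at `y`. Bounding it as one solution keeps the cancellation between its two products.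
-/
lemma Frobenius.freeSol_green (F : Frobenius l) (z : ℂ) (y : ℝ) :
    FreeSol l z (fun x => green l z x y) (fun x => dgreen l z x y) := by
  refine ⟨fun x hx => ?_, fun x hx => ?_⟩
  · exact ((F.hasDerivAt_phi z hx).mul_const _).sub ((F.hasDerivAt_theta z hx).const_mul _)
  · refine (((F.hasDerivAt_dphi z hx).mul_const _).sub
      ((F.hasDerivAt_dtheta z hx).const_mul _)).congr_deriv ?_
    rw [green]
    ring

lemma green_self (l : ℝ) (z : ℂ) (y : ℝ) : green l z y y = 0 := by
  rw [green]
  ring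

lemma Frobenius.dgreen_self (F : Frobenius l) (z : ℂ) {y : ℝ} (hy : 0 < y) :
    dgreen l z y y = 1 := F.wronskian z hy

lemma rpow_le_of_comparable {a b : ℝ} (ha : 0 < a) (hb : 0 < b) (hab : a ≤ 2 * b) (hba : b ≤ 2 * a)
    (s : ℝ) : a ^ s ≤ 2 ^ |s| * b ^ s := by
  rcases le_total 0 s with hs | hs
  · rw [abs_of_nonneg hs, ← Real.mul_rpow (by norm_num) hb.le]
    gcongr
  · rw [abs_of_nonpos hs]
    have h1 : (2 * a) ^ s ≤ b ^ s := Real.rpow_le_rpow_of_nonpos hb hba hs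
    rw [Real.mul_rpow (by norm_num) ha.le] at h1
    have h2 : (2 : ℝ) ^ (-s) * 2 ^ s = 1 := by rw [← Real.rpow_add (by norm_num)]; simp
    have h3 : (0 : ℝ) < 2 ^ (-s) := by positivity
    calc a ^ s = 2 ^ (-s) * (2 ^ s * a ^ s) := by rw [← mul_assoc, h2, one_mul]
      _ ≤ _ := by gcongr

/-- Before the turning point `x / 2 ≤ wt z x ≤ x`. -/
lemma rpow_le_wt_small {x : ℝ} (hx : 0 < x) (hkx : Real.sqrt ‖z‖ * x ≤ 1) (s : ℝ) :
    x ^ s ≤ 2 ^ |s| * wt z x ^ s := by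
  have hk := mul_nonneg (Real.sqrt_nonneg ‖z‖) hx.le
  refine rpow_le_of_comparable hx (wt_pos z hx) ?_ ?_ s
  · rw [wt, ← mul_div_assoc, le_div_iff₀ (by positivity)]
    nlinarith
  · rw [wt, div_le_iff₀ (by positivity)]
    nlinarith

/-- Past the turning point the weight saturates: `x₀ / 2 ≤ wt z x ≤ x₀`, since `wt z x` is `x₀`
times `|z|^{1/2} x / (1 + |z|^{1/2} x)`. -/
lemma rpow_le_wt_large {x x₀ : ℝ} (hx₀ : 0 < x₀) (hx : x₀ ≤ x) (hk : Real.sqrt ‖z‖ * x₀ = 1)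
    (s : ℝ) : x₀ ^ s ≤ 2 ^ |s| * wt z x ^ s := by
  have hx' := hx₀.trans_le hx
  have hkx : 1 ≤ Real.sqrt ‖z‖ * x := by rw [← hk]; gcongr
  have e : x₀ * (Real.sqrt ‖z‖ * x) = x := by linear_combination x * hk
  have hk' : 0 < 1 + Real.sqrt ‖z‖ * x := by linarith
  refine rpow_le_of_comparable hx₀ (wt_pos z hx') ?_ ?_ s
  · rw [wt, ← mul_div_assoc, le_div_iff₀ hk']
    nlinarith
  · rw [wt, div_le_iff₀ hk']
    nlinarith

/-- At the turning point the bounds for `v` and `|z|^{1/2} u` have the same size `B x₀^l`, so the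
small-argument estimates serve as initial data for the energy estimate. -/
lemma FreeSol.bound_transport (h : FreeSol l z u v) {x₀ x B : ℝ} (hx₀ : 0 < x₀) (hx : x₀ ≤ x)
    (hk : Real.sqrt ‖z‖ * x₀ = 1) (hB : 0 ≤ B) (hu : ‖u x₀‖ ≤ B * x₀ ^ (l + 1))
    (hv : ‖v x₀‖ ≤ B * x₀ ^ l) :
    ‖u x‖ ≤ 2 * Real.exp |l * (l + 1)| * B * Real.exp (|(csqrt z).im| * (x - x₀))
      * (2 ^ |l + 1| * wt z x ^ (l + 1)) ∧
    ‖v x‖ ≤ 2 * Real.exp |l * (l + 1)| * B * Real.exp (|(csqrt z).im| * (x - x₀))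
      * (2 ^ |l| * wt z x ^ l) := by
  have e1 : x₀ ^ (l + 1) = x₀ ^ l * x₀ := Real.rpow_add_one hx₀.ne' l
  obtain ⟨h1, h2⟩ := h.bound_large hx₀ hx hk.ge hv (a := B * x₀ ^ l) (by
    calc Real.sqrt ‖z‖ * ‖u x₀‖ ≤ Real.sqrt ‖z‖ * (B * x₀ ^ (l + 1)) := by gcongr
      _ = B * x₀ ^ l * (Real.sqrt ‖z‖ * x₀) := by rw [e1]; ring
      _ = B * x₀ ^ l := by rw [hk, mul_one]
      _ ≤ _ := le_rfl)
  constructor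
  · calc ‖u x‖ = x₀ * (Real.sqrt ‖z‖ * ‖u x‖) := by linear_combination (-‖u x‖) * hk
      _ ≤ x₀ * (2 * Real.exp |l * (l + 1)| * (B * x₀ ^ l)
          * Real.exp (|(csqrt z).im| * (x - x₀))) := by gcongr
      _ = 2 * Real.exp |l * (l + 1)| * B * Real.exp (|(csqrt z).im| * (x - x₀))
          * x₀ ^ (l + 1) := by rw [e1]; ring
      _ ≤ _ := by
        gcongr
        exact rpow_le_wt_large hx₀ hx hk _
  · calc ‖v x‖ ≤ _ := h1
      _ = 2 * Real.exp |l * (l + 1)| * B * Real.exp (|(csqrt z).im| * (x - x₀)) * x₀ ^ l := by ring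
      _ ≤ _ := by
        gcongr
        exact rpow_le_wt_large hx₀ hx hk _

lemma norm_mul_sq_le_one {x : ℝ} (hx : 0 ≤ x) (h : Real.sqrt ‖z‖ * x ≤ 1) : ‖z‖ * x ^ 2 ≤ 1 := by
  have h1 : ‖z‖ = Real.sqrt ‖z‖ ^ 2 := (Real.sq_sqrt (norm_nonneg z)).symm
  rw [h1, ← mul_pow]
  exact pow_le_one₀ (by positivity) h

/-- For `1 < |z|^{1/2} x` the turning point `|z|^{-1/2}` lies in `(0, x)`. -/
lemma exists_turning_point {x : ℝ} (hx : 0 < x) (h : 1 < Real.sqrt ‖z‖ * x) :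
    ∃ x₀, 0 < x₀ ∧ x₀ < x ∧ Real.sqrt ‖z‖ * x₀ = 1 := by
  have hk : 0 < Real.sqrt ‖z‖ := pos_of_mul_pos_left (one_pos.trans h) hx.le
  refine ⟨(Real.sqrt ‖z‖)⁻¹, inv_pos.2 hk, ?_, mul_inv_cancel₀ hk.ne'⟩
  rw [inv_lt_iff_one_lt_mul₀ hk]
  linarith

lemma Frobenius.exists_phi_weight_bound (F : Frobenius l) :
    ∃ C, 0 ≤ C ∧ ∀ (z : ℂ) (x : ℝ), 0 < x →
      ‖phiFree l z x‖ ≤ C * (wt z x ^ (l + 1) * Real.exp (|(csqrt z).im| * x)) := by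
  obtain ⟨B, hB, hphi⟩ := F.exists_phi_bound
  set e := 2 * Real.exp |l * (l + 1)| with he
  have he1 : 1 ≤ e := by
    have := Real.one_le_exp (abs_nonneg (l * (l + 1)))
    linarith
  refine ⟨e * B * 2 ^ |l + 1|, by positivity, fun z x hx => ?_⟩
  have hw := Real.rpow_nonneg (wt_pos z hx).le (l + 1)
  have hσ := abs_nonneg (csqrt z).im
  rcases le_or_gt (Real.sqrt ‖z‖ * x) 1 with hk | hk
  · have h1 := (hphi z x hx (norm_mul_sq_le_one hx.le hk)).1
    have h2 : 1 ≤ Real.exp (|(csqrt z).im| * x) := Real.one_le_exp (by positivity)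
    calc ‖phiFree l z x‖ ≤ 1 * B * x ^ (l + 1) * 1 := by linarith
      _ ≤ e * B * (2 ^ |l + 1| * wt z x ^ (l + 1)) * Real.exp (|(csqrt z).im| * x) := by
          have := rpow_le_wt_small hx hk (l + 1)
          gcongr
      _ = _ := by ring
  · obtain ⟨x₀, hx₀, hx₀x, hkx₀⟩ := exists_turning_point hx hk
    obtain ⟨h1, h2⟩ := hphi z x₀ hx₀ (norm_mul_sq_le_one hx₀.le hkx₀.le)
    have h3 := ((F.freeSol_phi z).bound_transport hx₀ hx₀x.le hkx₀ hB h1 h2).1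
    calc ‖phiFree l z x‖ ≤ _ := h3
      _ ≤ e * B * Real.exp (|(csqrt z).im| * x) * (2 ^ |l + 1| * wt z x ^ (l + 1)) := by
          gcongr
          linarith
      _ = _ := by ring

/-- There are three positions of the turning point `x₀`: for `x` not beyond it `exists_bound_small`
suffices; for `x₀ ≤ y` the energy estimate starts from the data at `y`; for `y < x₀ < x` the first
bound is used up to `x₀` and transported from there. -/
lemma Frobenius.exists_green_bound (F : Frobenius l) (hl : -1 / 2 ≤ l) :
    ∃ C, 0 ≤ C ∧ ∀ (z : ℂ) (x y : ℝ), 0 < y → y ≤ x → x ≤ 1 →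
      ‖green l z x y‖ ≤ C * (wt z x ^ (l + 1) * wt z y ^ (-l)
        * Real.exp (|(csqrt z).im| * (x - y)) * logFactor l y) ∧
      ‖dgreen l z x y‖ ≤ C * (wt z x ^ l * wt z y ^ (-l)
        * Real.exp (|(csqrt z).im| * (x - y)) * logFactor l y) := by
  obtain ⟨C₁, hC₁, hsmall⟩ := exists_bound_small hl
  set e := 2 * Real.exp |l * (l + 1)| with he
  have he0 : 0 ≤ e := by positivity
  set K₀ : ℝ := 2 ^ |l| with hK₀
  set K₁ : ℝ := 2 ^ |l + 1| with hK₁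
  have hK₀0 : 0 < K₀ := by positivity
  have hK₁0 : 0 < K₁ := by positivity
  have habs : (2 : ℝ) ^ |-l| = K₀ := by rw [abs_neg]
  refine ⟨(C₁ + e + e * C₁) * (K₀ + K₁) * K₀, by positivity, fun z x y hy hyx hx1 => ?_⟩
  have hx := hy.trans_le hyx
  set σ := |(csqrt z).im| with hσdef
  have hσ : 0 ≤ σ := abs_nonneg _
  set g := Real.exp (σ * (x - y)) with hg
  have hg1 : 1 ≤ g := Real.one_le_exp (mul_nonneg hσ (by linarith))
  set L := logFactor l y with hL
  have hL1 : 1 ≤ L := one_le_logFactor ⟨hy, hyx.trans hx1⟩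
  set p₁ := wt z x ^ (l + 1) with hp₁
  set p₀ := wt z x ^ l with hp₀
  set r := wt z y ^ (-l) with hr
  have hp₁0 : 0 < p₁ := Real.rpow_pos_of_pos (wt_pos z hx) _
  have hp₀0 : 0 < p₀ := Real.rpow_pos_of_pos (wt_pos z hx) _
  have hr0 : 0 < r := Real.rpow_pos_of_pos (wt_pos z hy) _
  have hyl : 0 < y ^ (-l) := Real.rpow_pos_of_pos hy _
  have hsol := F.freeSol_green z y
  suffices H : ∃ c, 0 ≤ c ∧ c ≤ C₁ + e + e * C₁ ∧
      ‖green l z x y‖ ≤ c * ((K₁ * p₁) * (K₀ * r) * g * L) ∧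
      ‖dgreen l z x y‖ ≤ c * ((K₀ * p₀) * (K₀ * r) * g * L) by
    obtain ⟨c, hc0, hc, h1, h2⟩ := H
    refine ⟨h1.trans ?_, h2.trans ?_⟩
    · calc c * ((K₁ * p₁) * (K₀ * r) * g * L) = c * K₁ * K₀ * (p₁ * r * g * L) := by ring
        _ ≤ _ := by
          gcongr
          linarith
    · calc c * ((K₀ * p₀) * (K₀ * r) * g * L) = c * K₀ * K₀ * (p₀ * r * g * L) := by ring
        _ ≤ _ := by
          gcongr
          linarith
  have heC : 0 ≤ e * C₁ := by positivity
  rcases le_or_gt (Real.sqrt ‖z‖ * x) 1 with hk | hk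
  · have hky : Real.sqrt ‖z‖ * y ≤ 1 := le_trans (by gcongr) hk
    obtain ⟨h1, h2⟩ := hsmall z _ _ hsol x y hy hyx hx1 (norm_mul_sq_le_one hx.le hk)
      (green_self l z y) (F.dgreen_self z hy)
    have b1 := rpow_le_wt_small hx hk (l + 1)
    have b0 := rpow_le_wt_small hx hk l
    have br := rpow_le_wt_small hy hky (-l)
    rw [habs] at br
    have hx1' := Real.rpow_nonneg hx.le (l + 1)
    have hx0' := Real.rpow_nonneg hx.le l
    refine ⟨C₁, hC₁, by linarith, h1.trans ?_, h2.trans ?_⟩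
    · calc C₁ * (x ^ (l + 1) * y ^ (-l) * L) = C₁ * (x ^ (l + 1) * y ^ (-l) * 1 * L) := by ring
        _ ≤ _ := by gcongr
    · calc C₁ * (x ^ l * y ^ (-l) * L) = C₁ * (x ^ l * y ^ (-l) * 1 * L) := by ring
        _ ≤ _ := by gcongr
  · obtain ⟨x₀, hx₀, hx₀x, hkx₀⟩ := exists_turning_point hx hk
    rcases le_or_gt x₀ y with hxy | hxy
    · have hky : 1 ≤ Real.sqrt ‖z‖ * y := by rw [← hkx₀]; gcongr
      obtain ⟨h1, h2⟩ := hsol.bound_large (a := 1) hy hyx hky (by simp [F.dgreen_self z hy])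
        (by simp [green_self])
      have b1 := rpow_le_wt_large hx₀ hx₀x.le hkx₀ (l + 1)
      have b0 := rpow_le_wt_large hx₀ hx₀x.le hkx₀ l
      have br := rpow_le_wt_large hx₀ hxy hkx₀ (-l)
      rw [habs] at br
      have q1 := Real.rpow_pos_of_pos hx₀ (l + 1)
      have q0 := Real.rpow_pos_of_pos hx₀ l
      have qr := Real.rpow_pos_of_pos hx₀ (-l)
      -- Both weights are comparable to `x₀` here, so the energy bounds `x₀` and `1` are rewritten
      -- as products of powers of `x₀`.
      have e1 : x₀ ^ (l + 1) * x₀ ^ (-l) = x₀ := by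
        rw [← Real.rpow_add hx₀]
        norm_num
      have e0 : x₀ ^ l * x₀ ^ (-l) = 1 := by
        rw [← Real.rpow_add hx₀]
        norm_num
      refine ⟨e, he0, by linarith, ?_, ?_⟩
      · calc ‖green l z x y‖ = x₀ * (Real.sqrt ‖z‖ * ‖green l z x y‖) := by
              linear_combination (-‖green l z x y‖) * hkx₀
          _ ≤ x₀ * (e * 1 * g) := by gcongr
          _ = e * ((x₀ ^ (l + 1) * x₀ ^ (-l)) * g * 1) := by rw [e1]; ring
          _ ≤ _ := by gcongr
      · calc ‖dgreen l z x y‖ ≤ e * 1 * g := h1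
          _ = e * ((x₀ ^ l * x₀ ^ (-l)) * g * 1) := by rw [e0]; ring
          _ ≤ _ := by gcongr
    · have hky : Real.sqrt ‖z‖ * y ≤ 1 := by rw [← hkx₀]; gcongr
      obtain ⟨h1, h2⟩ := hsmall z _ _ hsol x₀ y hy hxy.le (hx₀x.le.trans hx1)
        (norm_mul_sq_le_one hx₀.le hkx₀.le) (green_self l z y) (F.dgreen_self z hy)
      have hB : 0 ≤ C₁ * (y ^ (-l) * L) := by positivity
      obtain ⟨h3, h4⟩ := hsol.bound_transport hx₀ hx₀x.le hkx₀ hB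
        (h1.trans_eq (by ring)) (h2.trans_eq (by ring))
      have br := rpow_le_wt_small hy hky (-l)
      rw [habs] at br
      have hgg : Real.exp (σ * (x - x₀)) ≤ g := by
        rw [hg]
        gcongr
      refine ⟨e * C₁, heC, by linarith, h3.trans ?_, h4.trans ?_⟩
      · calc e * (C₁ * (y ^ (-l) * L)) * Real.exp (σ * (x - x₀)) * (K₁ * p₁)
            ≤ e * (C₁ * (K₀ * r * L)) * g * (K₁ * p₁) := by gcongr
          _ = _ := by ring
      · calc e * (C₁ * (y ^ (-l) * L)) * Real.exp (σ * (x - x₀)) * (K₀ * p₀)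
            ≤ e * (C₁ * (K₀ * r * L)) * g * (K₀ * p₀) := by gcongr
          _ = _ := by ring

end

section

/-! ### The Volterra operator -/

/-- A parametric integral of entire functions with a locally uniform integrable bound is entire. -/
lemma differentiable_integral_of_dominated {α : Type*} [MeasurableSpace α] {μ : Measure α}
    {F : ℂ → α → ℂ} (hmeas : ∀ z, AEStronglyMeasurable (F z) μ)
    (hdiff : ∀ᵐ y ∂μ, Differentiable ℂ fun z => F z y)
    (hbound : ∀ R : ℝ, ∃ g : α → ℝ, Integrable g μ ∧ ∀ᵐ y ∂μ, ∀ z, ‖z‖ ≤ R → ‖F z y‖ ≤ g y) :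
    Differentiable ℂ fun z => ∫ y, F z y ∂μ := by
  intro z₀
  -- The radius leaves room for Cauchy's estimate on unit circles centred in the unit ball around
  -- `z₀`, so `g` also dominates the derivative.
  obtain ⟨g, hg, hFg⟩ := hbound (‖z₀‖ + 2)
  have hint : Integrable (F z₀) μ := hg.mono' (hmeas z₀) (by
    filter_upwards [hFg] with y hy
    exact hy z₀ (by linarith))
  -- The derivative in `z` is measurable in `y` as a limit of difference quotients with step
  -- `1/(n+1)`.
  have hF' : AEStronglyMeasurable (fun y => deriv (fun z => F z y) z₀) μ := by
    refine aestronglyMeasurable_of_tendsto_ae atTop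
      (f := fun (n : ℕ) y => ((n : ℂ) + 1) * (F (z₀ + ((n : ℂ) + 1)⁻¹) y - F z₀ y))
      (fun n => ((hmeas _).sub (hmeas _)).const_mul _) ?_
    filter_upwards [hdiff] with y hy
    have h1 := (hy z₀).hasDerivAt.tendsto_slope_zero
    have h2 : Tendsto (fun n : ℕ => ((n : ℂ) + 1)⁻¹) atTop (𝓝[≠] 0) := by
      rw [tendsto_nhdsWithin_iff]
      refine ⟨?_, Eventually.of_forall fun n => ?_⟩
      · simpa [one_div] using tendsto_one_div_add_atTop_nhds_zero_nat (𝕜 := ℂ)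
      · exact inv_ne_zero (by exact_mod_cast n.succ_ne_zero)
    refine (h1.comp h2).congr fun n => ?_
    simp
  refine (hasDerivAt_integral_of_dominated_loc_of_deriv_le (μ := μ) (F := F) (bound := g)
    (F' := fun z y => deriv (fun z => F z y) z) (Metric.ball_mem_nhds z₀ one_pos)
    (Eventually.of_forall hmeas) hint hF' ?_ hg ?_).2.differentiableAt
  · filter_upwards [hFg, hdiff] with y hy hd z hz
    have := Complex.norm_deriv_le_of_forall_mem_sphere_norm_le (f := fun z => F z y) (c := z)
      (R := 1) (C := g y) one_pos hd.diffContOnCl fun w hw => hy w (by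
        have h1 : ‖w - z‖ = 1 := by simpa [dist_eq_norm] using hw
        have h2 : ‖z - z₀‖ < 1 := by simpa [dist_eq_norm] using hz
        calc ‖w‖ = ‖(w - z) + (z - z₀) + z₀‖ := by ring_nf
          _ ≤ ‖w - z‖ + ‖z - z₀‖ + ‖z₀‖ := norm_add₃_le
          _ ≤ _ := by linarith)
    simpa using this
  · filter_upwards [hdiff] with y hy z _
    exact (hy z).hasDerivAt

/-! ### The potential, the weights and the split kernel. -/

variable {l : ℝ} {q : ℝ → ℝ}

/-- The hypotheses on the potential. -/
structure IsPotential (l : ℝ) (q : ℝ → ℝ) : Prop where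
  meas : AEMeasurable q (volume.restrict (Ioo (0 : ℝ) 1))
  integrable : IntegrableOn (fun x : ℝ => x * qTilde l q x) (Ioo (0 : ℝ) 1)

lemma qTilde_eq (l : ℝ) (q : ℝ → ℝ) (x : ℝ) : qTilde l q x = logFactor l x * |q x| := by
  rw [qTilde, logFactor]
  split_ifs <;> ring

lemma abs_le_qTilde {x : ℝ} (hx : x ∈ Ioc (0 : ℝ) 1) : |q x| ≤ qTilde l q x := by
  rw [qTilde_eq]
  exact le_mul_of_one_le_left (abs_nonneg _) (one_le_logFactor hx)

lemma mul_qTilde_nonneg {x : ℝ} (hx : x ∈ Ioc (0 : ℝ) 1) : 0 ≤ x * qTilde l q x :=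
  mul_nonneg hx.1.le ((abs_nonneg _).trans (abs_le_qTilde hx))

lemma IsPotential.integrableOn (hq : IsPotential l q) :
    IntegrableOn (fun x : ℝ => x * qTilde l q x) (Ioc (0 : ℝ) 1) :=
  (integrableOn_Ioc_iff_integrableOn_Ioo).2 hq.integrable

lemma IsPotential.intervalIntegrable (hq : IsPotential l q) {x : ℝ} (hx : x ∈ Icc (0 : ℝ) 1) :
    IntervalIntegrable (fun x : ℝ => x * qTilde l q x) volume 0 x :=
  (intervalIntegrable_iff_integrableOn_Ioc_of_le hx.1).2
    (hq.integrableOn.mono_set (Ioc_subset_Ioc_right hx.2))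

lemma IsPotential.aestronglyMeasurable (hq : IsPotential l q) :
    AEStronglyMeasurable (fun x => (q x : ℂ)) (volume.restrict (Ioc (0 : ℝ) 1)) := by
  have h := hq.meas
  rw [Measure.restrict_congr_set Ioo_ae_eq_Ioc] at h
  exact (Complex.measurable_ofReal.comp_aemeasurable h).aestronglyMeasurable

/-- `I(x) = ∫₀ˣ y q̃(y) dy`. -/
def potInt (l : ℝ) (q : ℝ → ℝ) (x : ℝ) : ℝ := ∫ y in (0 : ℝ)..x, y * qTilde l q y

lemma IsPotential.potInt_nonneg {x : ℝ} (hx : x ∈ Icc (0 : ℝ) 1) :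
    0 ≤ potInt l q x :=
  intervalIntegral.integral_nonneg_of_ae_restrict hx.1 (by
    rw [← Measure.restrict_congr_set Ioc_ae_eq_Icc]
    filter_upwards [ae_restrict_mem measurableSet_Ioc] with y hy
    exact mul_qTilde_nonneg ⟨hy.1, hy.2.trans hx.2⟩)

lemma IsPotential.potInt_le (hq : IsPotential l q) {x : ℝ} (hx : x ∈ Icc (0 : ℝ) 1) :
    potInt l q x ≤ potInt l q 1 := by
  have h1 : IntervalIntegrable (fun x : ℝ => x * qTilde l q x) volume 0 1 :=
    hq.intervalIntegrable ⟨zero_le_one, le_rfl⟩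
  refine intervalIntegral.integral_mono_interval le_rfl hx.1 hx.2 ?_ h1
  filter_upwards [ae_restrict_mem measurableSet_Ioc] with y hy
  exact mul_qTilde_nonneg hy

/-- `∫₀ˣ I'(y) I(y)ⁿ dy = I(x)ⁿ⁺¹ / (n + 1)`. -/
lemma IsPotential.integral_mul_potInt_pow (hq : IsPotential l q) {x : ℝ} (hx : x ∈ Icc (0 : ℝ) 1)
    (n : ℕ) :
    IntervalIntegrable (fun y => y * qTilde l q y * potInt l q y ^ n) volume 0 x ∧
    ∫ y in (0 : ℝ)..x, y * qTilde l q y * potInt l q y ^ n = potInt l q x ^ (n + 1) / (n + 1) := by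
  have hint := hq.intervalIntegrable hx
  have hac : AbsolutelyContinuousOnInterval (potInt l q) 0 x :=
    hint.absolutelyContinuousOnInterval_intervalIntegral (by simp)
  -- `I` is known to be differentiable only almost everywhere. Its powers are absolutely continuous,
  -- so the fundamental theorem of calculus still applies.
  have hpow : ∀ n : ℕ, AbsolutelyContinuousOnInterval (fun y => potInt l q y ^ (n + 1)) 0 x := by
    intro n
    induction n with
    | zero => simpa using hac
    | succ n ih =>
      have := ih.fun_mul hac
      simpa only [← pow_succ] using this
  have hderiv : ∀ᵐ y, y ∈ uIoc 0 x →
      deriv (fun y => potInt l q y ^ (n + 1)) y = (n + 1) * (y * qTilde l q y * potInt l q y ^ n) := by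
    filter_upwards [hint.ae_hasDerivAt_integral] with y hy hmem
    have h1 := (hy (uIoc_subset_uIcc hmem) 0 (by simp)).pow (n + 1)
    have h2 : deriv (fun y => potInt l q y ^ (n + 1)) y = _ := h1.deriv
    rw [h2]
    simp only [Nat.add_sub_cancel, potInt]
    push_cast
    ring
  have h1 := (hpow n).integral_deriv_eq_sub
  rw [intervalIntegral.integral_congr_ae hderiv, intervalIntegral.integral_const_mul] at h1
  have h0 : potInt l q 0 = 0 := intervalIntegral.integral_same
  have hn : (n : ℝ) + 1 ≠ 0 := by positivity
  refine ⟨hint.mul_continuousOn (hac.continuousOn.pow n), ?_⟩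
  rw [h0] at h1
  rw [eq_div_iff hn]
  simpa [mul_comm] using h1

/-- The weight `(x / (1 + |z|^{1/2} x)) ^ (l + 1) e^{|Im z^{1/2}| x}`. -/
def pw (l : ℝ) (z : ℂ) (x : ℝ) : ℝ := wt z x ^ (l + 1) * Real.exp (|(csqrt z).im| * x)

lemma pw_nonneg (l : ℝ) (z : ℂ) {x : ℝ} (hx : 0 < x) : 0 ≤ pw l z x :=
  mul_nonneg (Real.rpow_nonneg (wt_pos z hx).le _) (Real.exp_pos _).le

lemma wt_le (z : ℂ) {x : ℝ} (hx : 0 < x) : wt z x ≤ x :=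
  div_le_self hx.le (by
    have : 0 ≤ Real.sqrt ‖z‖ * x := by positivity
    linarith)

lemma pw_le (hl : -1 / 2 ≤ l) (z : ℂ) {x : ℝ} (hx : x ∈ Ioc (0 : ℝ) 1) :
    pw l z x ≤ Real.exp (Real.sqrt ‖z‖) * x ^ (l + 1) := by
  have h1 : |(csqrt z).im| ≤ Real.sqrt ‖z‖ := by
    refine (Complex.abs_im_le_norm _).trans (le_of_eq ?_)
    have h2 : ‖z‖ = ‖csqrt z‖ * ‖csqrt z‖ := by rw [← norm_mul, ← pow_two, csqrt_sq]
    rw [h2, Real.sqrt_mul_self (norm_nonneg _)]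
  rw [pw, mul_comm]
  have h3 := wt_le z hx.1
  have h4 := (wt_pos z hx.1).le
  have h5 : |(csqrt z).im| * x ≤ Real.sqrt ‖z‖ := by
    have := mul_le_mul h1 hx.2 hx.1.le (Real.sqrt_nonneg _)
    simpa using this
  have h6 : 0 ≤ l + 1 := by linarith
  gcongr

/-- The weighted kernel bound. -/
lemma kernel_bound {C : ℝ} {z g f : ℂ} {x y s b : ℝ} (hy : 0 < y) (hC : 0 ≤ C)
    (hg : ‖g‖ ≤ C * (wt z x ^ s * wt z y ^ (-l) * Real.exp (|(csqrt z).im| * (x - y))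
      * logFactor l y)) (hf : ‖f‖ ≤ pw l z y * b) (hwx : 0 < wt z x) (hL : 0 ≤ logFactor l y) :
    ‖g * (q y : ℂ) * f‖ ≤ C * (wt z x ^ s * Real.exp (|(csqrt z).im| * x))
      * (y * qTilde l q y / (1 + Real.sqrt ‖z‖ * y) * b) := by
  have hw := wt_pos z hy
  -- The exponents `-l` and `l + 1` add up to `1`; this produces the denominator in `errorIntegral`.
  have e1 : wt z y ^ (-l) * wt z y ^ (l + 1) = y / (1 + Real.sqrt ‖z‖ * y) := by
    rw [← Real.rpow_add hw, neg_add_cancel_left, Real.rpow_one, wt]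
  have e2 : Real.exp (|(csqrt z).im| * (x - y)) * Real.exp (|(csqrt z).im| * y)
      = Real.exp (|(csqrt z).im| * x) := by
    rw [← Real.exp_add]
    ring_nf
  have hwl := Real.rpow_pos_of_pos hw (-l)
  have hws := Real.rpow_pos_of_pos hwx s
  rw [norm_mul, norm_mul, Complex.norm_real, Real.norm_eq_abs]
  calc ‖g‖ * |q y| * ‖f‖ ≤ C * (wt z x ^ s * wt z y ^ (-l)
          * Real.exp (|(csqrt z).im| * (x - y)) * logFactor l y) * |q y| * (pw l z y * b) := by
        gcongr
    _ = C * (wt z x ^ s * (Real.exp (|(csqrt z).im| * (x - y)) * Real.exp (|(csqrt z).im| * y)))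
          * ((wt z y ^ (-l) * wt z y ^ (l + 1)) * (logFactor l y * |q y|) * b) := by
        rw [pw]
        ring
    _ = _ := by
        rw [e1, e2, ← qTilde_eq]
        ring

section Split

variable {f : ℝ → ℂ} {K : ℝ} {z : ℂ}

/-- Integrability of `θ_l q f` and `φ_l q f` if `f = O(x ^ (l + 1))`. -/
lemma Frobenius.intervalIntegrable_split (F : Frobenius l) (hl : -1 / 2 ≤ l) (hq : IsPotential l q)
    (hfc : ContinuousOn f (Ioc 0 1)) (hf : ∀ y ∈ Ioc (0 : ℝ) 1, ‖f y‖ ≤ K * y ^ (l + 1)) :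
    IntervalIntegrable (fun y => thetaFree l z y * (q y : ℂ) * f y) volume 0 1 ∧
    IntervalIntegrable (fun y => phiFree l z y * (q y : ℂ) * f y) volume 0 1 := by
  obtain ⟨M, hM, hb⟩ := F.exists_theta_bound hl z
  have hK : 0 ≤ K := by
    have := (norm_nonneg _).trans (hf 1 ⟨one_pos, le_rfl⟩)
    simpa using this
  have hθc : ContinuousOn (thetaFree l z) (Ioc 0 1) := fun y hy =>
    (F.hasDerivAt_theta z hy.1).continuousAt.continuousWithinAt
  have hφc : ContinuousOn (phiFree l z) (Ioc 0 1) := fun y hy =>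
    (F.hasDerivAt_phi z hy.1).continuousAt.continuousWithinAt
  have hfm := hfc.aestronglyMeasurable (μ := volume) measurableSet_Ioc
  have hqm := hq.aestronglyMeasurable
  rw [intervalIntegrable_iff_integrableOn_Ioc_of_le zero_le_one,
    intervalIntegrable_iff_integrableOn_Ioc_of_le zero_le_one]
  have hmaj := hq.integrableOn.const_mul (M * K)
  constructor
  · refine hmaj.mono' (((hθc.aestronglyMeasurable measurableSet_Ioc).mul hqm).mul hfm) ?_
    filter_upwards [ae_restrict_mem measurableSet_Ioc] with y hy
    have e : y ^ (-l) * y ^ (l + 1) = y := by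
      rw [← Real.rpow_add hy.1]
      norm_num
    have hy1 := Real.rpow_nonneg hy.1.le (-l)
    have hL := one_le_logFactor (l := l) hy
    rw [norm_mul, norm_mul, Complex.norm_real, Real.norm_eq_abs]
    calc ‖thetaFree l z y‖ * |q y| * ‖f y‖
        ≤ (M * y ^ (-l) * logFactor l y) * |q y| * (K * y ^ (l + 1)) := by
          gcongr
          · exact (hb y hy).1
          · exact hf y hy
      _ = M * K * ((y ^ (-l) * y ^ (l + 1)) * (logFactor l y * |q y|)) := by ring
      _ = _ := by rw [e, ← qTilde_eq]
  · refine hmaj.mono' (((hφc.aestronglyMeasurable measurableSet_Ioc).mul hqm).mul hfm) ?_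
    filter_upwards [ae_restrict_mem measurableSet_Ioc] with y hy
    -- Since `2l + 2 ≥ 1` and `y ≤ 1`, the `φ_l` term needs no logarithm.
    have e : y ^ (l + 1) * y ^ (l + 1) ≤ y := by
      rw [← Real.rpow_add hy.1]
      calc y ^ (l + 1 + (l + 1)) ≤ y ^ (1 : ℝ) :=
            Real.rpow_le_rpow_of_exponent_ge hy.1 hy.2 (by linarith)
        _ = y := Real.rpow_one y
    have hy1 := Real.rpow_nonneg hy.1.le (l + 1)
    have hqt : 0 ≤ qTilde l q y := (abs_nonneg _).trans (abs_le_qTilde hy)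
    rw [norm_mul, norm_mul, Complex.norm_real, Real.norm_eq_abs]
    calc ‖phiFree l z y‖ * |q y| * ‖f y‖
        ≤ (M * y ^ (l + 1)) * qTilde l q y * (K * y ^ (l + 1)) := by
          gcongr
          · exact (hb y hy).2
          · exact abs_le_qTilde hy
          · exact hf y hy
      _ = M * K * ((y ^ (l + 1) * y ^ (l + 1)) * qTilde l q y) := by ring
      _ ≤ _ := by gcongr

/-- The dependence on `x` leaves the integral. Free coefficients `a`, `b` let this serve both the
Green function and its derivative in `x`. -/
lemma Frobenius.integral_split (F : Frobenius l) (hl : -1 / 2 ≤ l) (hq : IsPotential l q)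
    (hfc : ContinuousOn f (Ioc 0 1)) (hf : ∀ y ∈ Ioc (0 : ℝ) 1, ‖f y‖ ≤ K * y ^ (l + 1))
    (a b : ℂ) {x : ℝ} (hx : x ∈ Ioc (0 : ℝ) 1) :
    IntervalIntegrable (fun y => (a * thetaFree l z y - phiFree l z y * b) * (q y : ℂ) * f y)
      volume 0 x ∧
    ∫ y in (0 : ℝ)..x, (a * thetaFree l z y - phiFree l z y * b) * (q y : ℂ) * f y
      = a * (∫ y in (0 : ℝ)..x, thetaFree l z y * (q y : ℂ) * f y)
        - b * ∫ y in (0 : ℝ)..x, phiFree l z y * (q y : ℂ) * f y := by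
  obtain ⟨h1, h2⟩ := F.intervalIntegrable_split (z := z) hl hq hfc hf
  have hsub : uIcc (0 : ℝ) x ⊆ uIcc 0 1 := by
    rw [uIcc_of_le hx.1.le, uIcc_of_le zero_le_one]
    exact Icc_subset_Icc_right hx.2
  have h1' := (h1.mono_set hsub).const_mul a
  have h2' := (h2.mono_set hsub).const_mul b
  have e : (fun y => (a * thetaFree l z y - phiFree l z y * b) * (q y : ℂ) * f y)
      = fun y => a * (thetaFree l z y * (q y : ℂ) * f y)
        - b * (phiFree l z y * (q y : ℂ) * f y) := by
    funext y
    ring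
  rw [e]
  refine ⟨h1'.sub h2', ?_⟩
  rw [intervalIntegral.integral_sub h1' h2', intervalIntegral.integral_const_mul,
    intervalIntegral.integral_const_mul]

end Split

end

section

/-! ### Successive approximation -/

variable {l : ℝ} {q : ℝ → ℝ}

/-- The functions on which the Volterra operator acts. -/
structure Admissible (l : ℝ) (c : ℝ → ℝ) (f : ℂ → ℝ → ℂ) : Prop where
  cont : ∀ z, ContinuousOn (f z) (Ioc 0 1)
  entire : ∀ x ∈ Ioc (0 : ℝ) 1, Differentiable ℂ fun z => f z x
  bound : ∀ z, ∀ x ∈ Ioc (0 : ℝ) 1, ‖f z x‖ ≤ pw l z x * c x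

/-- The Volterra operator. -/
def volterra (l : ℝ) (q : ℝ → ℝ) (f : ℂ → ℝ → ℂ) (z : ℂ) (x : ℝ) : ℂ :=
  ∫ y in (0 : ℝ)..x, green l z x y * (q y : ℂ) * f z y

/-- The bound of `G_l` by the constant `C`. -/
def GreenBound (l C : ℝ) : Prop :=
  ∀ (z : ℂ) (x y : ℝ), 0 < y → y ≤ x → x ≤ 1 →
    ‖green l z x y‖ ≤ C * (wt z x ^ (l + 1) * wt z y ^ (-l)
      * Real.exp (|(csqrt z).im| * (x - y)) * logFactor l y)

lemma pw_le_exp (hl : -1 / 2 ≤ l) {z : ℂ} {R x : ℝ} (hz : ‖z‖ ≤ R) (hx : x ∈ Ioc (0 : ℝ) 1) :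
    pw l z x ≤ Real.exp (Real.sqrt R) := by
  have h1 : x ^ (l + 1) ≤ 1 := Real.rpow_le_one hx.1.le hx.2 (by linarith)
  have h2 : Real.exp (Real.sqrt ‖z‖) ≤ Real.exp (Real.sqrt R) := by gcongr
  have h3 := Real.rpow_nonneg hx.1.le (l + 1)
  calc pw l z x ≤ Real.exp (Real.sqrt ‖z‖) * x ^ (l + 1) := pw_le hl z hx
    _ ≤ Real.exp (Real.sqrt R) * 1 := by gcongr
    _ = _ := mul_one _

lemma Admissible.growth {c : ℝ → ℝ} {f : ℂ → ℝ → ℂ} (hf : Admissible l c f) (hl : -1 / 2 ≤ l)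
    {c₁ : ℝ} (hc₁ : 0 ≤ c₁) (hc : ∀ x ∈ Ioc (0 : ℝ) 1, c x ≤ c₁) (z : ℂ) :
    ∀ x ∈ Ioc (0 : ℝ) 1, ‖f z x‖ ≤ Real.exp (Real.sqrt ‖z‖) * c₁ * x ^ (l + 1) := by
  intro x hx
  have h1 := pw_nonneg l z hx.1
  calc ‖f z x‖ ≤ pw l z x * c₁ := (hf.bound z x hx).trans (by gcongr; exact hc x hx)
    _ ≤ Real.exp (Real.sqrt ‖z‖) * x ^ (l + 1) * c₁ := by
      gcongr
      exact pw_le hl z hx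
    _ = _ := by ring

/-- The pointwise bound of the integrand of the Volterra operator. -/
lemma GreenBound.integrand_le {C : ℝ} (hC : 0 ≤ C) (hG : GreenBound l C) {z f : ℂ} {x y b : ℝ}
    (hy : 0 < y) (hyx : y ≤ x) (hx : x ≤ 1) (hb : 0 ≤ b) (hf : ‖f‖ ≤ pw l z y * b) :
    ‖green l z x y * (q y : ℂ) * f‖ ≤ C * pw l z x * (y * qTilde l q y * b) := by
  have hymem : y ∈ Ioc (0 : ℝ) 1 := ⟨hy, hyx.trans hx⟩
  have hx0 := hy.trans_le hyx
  have hp := pw_nonneg l z hx0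
  refine (kernel_bound hy hC (hG z x y hy hyx hx) hf (wt_pos z hx0)
    (zero_le_one.trans (one_le_logFactor hymem))).trans ?_
  change C * pw l z x * _ ≤ _
  have : y * qTilde l q y / (1 + Real.sqrt ‖z‖ * y) ≤ y * qTilde l q y :=
    div_le_self (mul_qTilde_nonneg hymem) (by
      have : 0 ≤ Real.sqrt ‖z‖ * y := by positivity
      linarith)
  gcongr

lemma exists_potInt_pow_bound (hq : IsPotential l q) {a : ℝ} (ha : 0 ≤ a) (n : ℕ) :
    ∀ x ∈ Ioc (0 : ℝ) 1, a * potInt l q x ^ n ≤ a * potInt l q 1 ^ n := by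
  intro x hx
  have hx' : x ∈ Icc (0 : ℝ) 1 := ⟨hx.1.le, hx.2⟩
  have h1 := hq.potInt_le hx'
  have h2 := IsPotential.potInt_nonneg (l := l) (q := q) hx'
  gcongr

lemma Admissible.intervalIntegrable {f : ℂ → ℝ → ℂ} {c : ℝ → ℝ} (F : Frobenius l)
    (hl : -1 / 2 ≤ l) (hq : IsPotential l q) (hf : Admissible l c f) {c₁ : ℝ} (hc₁ : 0 ≤ c₁)
    (hc : ∀ x ∈ Ioc (0 : ℝ) 1, c x ≤ c₁) (z : ℂ) {x : ℝ} (hx : x ∈ Ioc (0 : ℝ) 1) :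
    IntervalIntegrable (fun y => green l z x y * (q y : ℂ) * f z y) volume 0 x :=
  (F.integral_split hl hq (hf.cont z) (hf.growth hl hc₁ hc z) _ _ hx).1

/-- The kernel bound reproduces the weight `pw` at `x` and leaves `∫ I' Iⁿ = I^{n+1} / (n+1)`. Each
application thus gains `C I / (n+1)`, the source of the factorials. -/
lemma Frobenius.admissible_volterra (F : Frobenius l) (hl : -1 / 2 ≤ l) (hq : IsPotential l q)
    {C : ℝ} (hC : 0 ≤ C) (hG : GreenBound l C) {f : ℂ → ℝ → ℂ} {a : ℝ} (ha : 0 ≤ a) {n : ℕ}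
    (hf : Admissible l (fun x => a * potInt l q x ^ n) f) :
    Admissible l (fun x => C * a / (n + 1) * potInt l q x ^ (n + 1)) (volterra l q f) := by
  have h01 : (1 : ℝ) ∈ Icc (0 : ℝ) 1 := ⟨zero_le_one, le_rfl⟩
  have hc₁ : 0 ≤ a * potInt l q 1 ^ n :=
    mul_nonneg ha (pow_nonneg (IsPotential.potInt_nonneg h01) _)
  have hc := exists_potInt_pow_bound hq ha n
  refine ⟨fun z => ?_, fun x hx => ?_, fun z x hx => ?_⟩
  · obtain ⟨h1, h2⟩ := F.intervalIntegrable_split (z := z) hl hq (hf.cont z)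
      (hf.growth hl hc₁ hc z)
    have hu : uIcc (0 : ℝ) 1 = Icc 0 1 := uIcc_of_le zero_le_one
    have c1 := (intervalIntegral.continuousOn_primitive_interval
      (by rw [hu]; exact (intervalIntegrable_iff_integrableOn_Icc_of_le zero_le_one).1 h1))
    have c2 := (intervalIntegral.continuousOn_primitive_interval
      (by rw [hu]; exact (intervalIntegrable_iff_integrableOn_Icc_of_le zero_le_one).1 h2))
    rw [hu] at c1 c2
    have hφc : ContinuousOn (phiFree l z) (Ioc 0 1) := fun y hy =>
      (F.hasDerivAt_phi z hy.1).continuousAt.continuousWithinAt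
    have hθc : ContinuousOn (thetaFree l z) (Ioc 0 1) := fun y hy =>
      (F.hasDerivAt_theta z hy.1).continuousAt.continuousWithinAt
    refine ((hφc.mul (c1.mono Ioc_subset_Icc_self)).sub
      (hθc.mul (c2.mono Ioc_subset_Icc_self))).congr fun x hx => ?_
    exact (F.integral_split hl hq (hf.cont z) (hf.growth hl hc₁ hc z) _ _ hx).2
  · have hint : ∀ z, IntegrableOn (fun y => green l z x y * (q y : ℂ) * f z y) (Ioc 0 x) :=
      fun z => (intervalIntegrable_iff_integrableOn_Ioc_of_le hx.1.le).1
        (hf.intervalIntegrable F hl hq hc₁ hc z hx)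
    have e : (fun z => volterra l q f z x)
        = fun z => ∫ y in Ioc 0 x, green l z x y * (q y : ℂ) * f z y := by
      funext z
      exact intervalIntegral.integral_of_le hx.1.le
    rw [e]
    refine differentiable_integral_of_dominated (fun z => (hint z).aestronglyMeasurable) ?_ ?_
    · filter_upwards [ae_restrict_mem measurableSet_Ioc] with y hy
      have d1 := F.differentiable_phi hx.1
      have d2 := F.differentiable_theta hx.1
      have d3 := F.differentiable_phi hy.1
      have d4 := F.differentiable_theta hy.1
      have d5 := hf.entire y ⟨hy.1, hy.2.trans hx.2⟩
      unfold green
      fun_prop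
    · intro R
      refine ⟨fun y => C * Real.exp (Real.sqrt R) * (y * qTilde l q y * (a * potInt l q 1 ^ n)),
        ((hq.integrableOn.mono_set (Ioc_subset_Ioc_right hx.2)).mul_const _).const_mul _, ?_⟩
      filter_upwards [ae_restrict_mem measurableSet_Ioc] with y hy z hz
      have hymem : y ∈ Ioc (0 : ℝ) 1 := ⟨hy.1, hy.2.trans hx.2⟩
      have hb := hf.bound z y hymem
      have hp := pw_nonneg l z hy.1
      refine (hG.integrand_le hC hy.1 hy.2 hx.2 hc₁ 
        (hb.trans (mul_le_mul_of_nonneg_left (hc y hymem) hp))).trans ?_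
      have h1 := pw_le_exp hl hz hx
      have h2 := mul_nonneg (mul_qTilde_nonneg (l := l) (q := q) hymem) hc₁
      gcongr
  · have hx' : x ∈ Icc (0 : ℝ) 1 := ⟨hx.1.le, hx.2⟩
    obtain ⟨h1, h2⟩ := hq.integral_mul_potInt_pow hx' n
    calc ‖volterra l q f z x‖
        ≤ ∫ y in (0 : ℝ)..x, C * pw l z x * a * (y * qTilde l q y * potInt l q y ^ n) := by
          refine intervalIntegral.norm_integral_le_of_norm_le hx.1.le
            (Eventually.of_forall fun y hy => ?_) (h1.const_mul _)
          have hymem : y ∈ Ioc (0 : ℝ) 1 := ⟨hy.1, hy.2.trans hx.2⟩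
          have hI := IsPotential.potInt_nonneg (l := l) (q := q) ⟨hymem.1.le, hymem.2⟩
          refine (hG.integrand_le hC hy.1 hy.2 hx.2 (by positivity)
            (hf.bound z y hymem)).trans (le_of_eq ?_)
          ring
      _ = _ := by
          rw [intervalIntegral.integral_const_mul, h2]
          ring

/-- The successive approximations. -/
def iter (l : ℝ) (q : ℝ → ℝ) (n : ℕ) : ℂ → ℝ → ℂ := (volterra l q)^[n] (phiFree l)

lemma iter_succ (l : ℝ) (q : ℝ → ℝ) (n : ℕ) : iter l q (n + 1) = volterra l q (iter l q n) :=
  Function.iterate_succ_apply' _ _ _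

/-- The regular solution. -/
def regularSolution (l : ℝ) (q : ℝ → ℝ) (z : ℂ) (x : ℝ) : ℂ := ∑' n, iter l q n z x

lemma Frobenius.admissible_iter (F : Frobenius l) (hl : -1 / 2 ≤ l) (hq : IsPotential l q)
    {C C₀ : ℝ} (hC : 0 ≤ C) (hG : GreenBound l C) (hC₀ : 0 ≤ C₀)
    (hφ : ∀ (z : ℂ) (x : ℝ), 0 < x → ‖phiFree l z x‖ ≤ C₀ * pw l z x) (n : ℕ) :
    Admissible l (fun x => C₀ * C ^ n / n.factorial * potInt l q x ^ n) (iter l q n) := by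
  induction n with
  | zero =>
    refine ⟨fun z y hy => (F.hasDerivAt_phi z hy.1).continuousAt.continuousWithinAt,
      fun x hx => F.differentiable_phi hx.1, fun z x hx => (hφ z x hx.1).trans (le_of_eq ?_)⟩
    simp [mul_comm]
  | succ n ih =>
    rw [iter_succ]
    have h := F.admissible_volterra hl hq hC hG (by positivity) ih
    have e : C * (C₀ * C ^ n / n.factorial) / (n + 1) = C₀ * C ^ (n + 1) / (n + 1).factorial := by
      rw [Nat.factorial_succ]
      push_cast
      have : (n.factorial : ℝ) ≠ 0 := by exact_mod_cast n.factorial_ne_zero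
      have : (n : ℝ) + 1 ≠ 0 := by positivity
      field_simp
      ring
    rwa [e] at h

/-- Existence of the regular solution with the Volterra integral equation. -/
lemma Frobenius.admissible_regularSolution (F : Frobenius l) (hl : -1 / 2 ≤ l)
    (hq : IsPotential l q) {C C₀ : ℝ} (hC : 0 ≤ C) (hG : GreenBound l C) (hC₀ : 0 ≤ C₀)
    (hφ : ∀ (z : ℂ) (x : ℝ), 0 < x → ‖phiFree l z x‖ ≤ C₀ * pw l z x) :
    Admissible l (fun _ => C₀ * Real.exp (C * potInt l q 1)) (regularSolution l q) ∧
    ∀ (z : ℂ), ∀ x ∈ Ioc (0 : ℝ) 1, regularSolution l q z x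
      = phiFree l z x + volterra l q (regularSolution l q) z x := by
  have hI1 : 0 ≤ potInt l q 1 := IsPotential.potInt_nonneg ⟨zero_le_one, le_rfl⟩
  set Q := C * potInt l q 1 with hQ
  have hQ0 : 0 ≤ Q := mul_nonneg hC hI1
  set a : ℕ → ℝ := fun n => C₀ * (Q ^ n / n.factorial) with ha
  have ha0 : ∀ n, 0 ≤ a n := fun n => by positivity
  have hasum : HasSum a (C₀ * Real.exp Q) := by
    -- The majorants sum to an exponential; as `I(x) ≤ I(1)`, one numerical series serves all `x`,
    -- and all `z` in a disc.
    have h := NormedSpace.expSeries_div_hasSum_exp (𝔸 := ℝ) Q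
    rw [← Real.exp_eq_exp_ℝ] at h
    exact h.mul_left C₀
  have hadm := F.admissible_iter hl hq hC hG hC₀ hφ
  have hbound : ∀ n z, ∀ x ∈ Ioc (0 : ℝ) 1, ‖iter l q n z x‖ ≤ pw l z x * a n := by
    intro n z x hx
    have h1 := pw_nonneg l z hx.1
    refine ((hadm n).bound z x hx).trans ?_
    gcongr
    refine (exists_potInt_pow_bound hq (by positivity) n x hx).trans (le_of_eq ?_)
    simp only [ha, hQ, mul_pow]
    ring
  have hunif : ∀ R : ℝ, ∀ n z, ‖z‖ ≤ R → ∀ x ∈ Ioc (0 : ℝ) 1,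
      ‖iter l q n z x‖ ≤ Real.exp (Real.sqrt R) * a n := by
    intro R n z hz x hx
    refine (hbound n z x hx).trans ?_
    have h1 := ha0 n
    gcongr
    exact pw_le_exp hl hz hx
  have hsummable : ∀ z, ∀ x ∈ Ioc (0 : ℝ) 1, Summable fun n => iter l q n z x := fun z x hx =>
    Summable.of_norm_bounded (hasum.summable.mul_left (pw l z x)) fun n => hbound n z x hx
  refine ⟨⟨fun z => ?_, fun x hx => ?_, fun z x hx => ?_⟩, fun z x hx => ?_⟩
  · exact continuousOn_tsum (fun n => (hadm n).cont z)
      (hasum.summable.mul_left (Real.exp (Real.sqrt ‖z‖))) fun n x hx => hunif _ n z le_rfl x hx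
  · intro z
    have h := Complex.differentiableOn_tsum_of_summable_norm (F := fun n z => iter l q n z x)
      (hasum.summable.mul_left (Real.exp (Real.sqrt (‖z‖ + 1))))
      (fun n => ((hadm n).entire x hx).differentiableOn) (Metric.isOpen_ball (x := (0 : ℂ)))
      fun n w hw => hunif (‖z‖ + 1) n w (by simpa using (Metric.mem_ball.1 hw).le) x hx
    exact (h z (by simp)).differentiableAt (Metric.isOpen_ball.mem_nhds (by simp))
  · exact tsum_of_norm_bounded (hasum.mul_left (pw l z x)) fun n => hbound n z x hx
  · have h0 : regularSolution l q z x = phiFree l z x + ∑' n, iter l q (n + 1) z x :=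
      (hsummable z x hx).tsum_eq_zero_add
    rw [h0]
    congr 1
    have hx' : x ∈ Icc (0 : ℝ) 1 := ⟨hx.1.le, hx.2⟩
    have hint : ∀ n, IntervalIntegrable (fun y => green l z x y * (q y : ℂ) * iter l q n z y)
        volume 0 x := fun n => by
      refine (hadm n).intervalIntegrable F hl hq (c₁ := C₀ * C ^ n / n.factorial
        * potInt l q 1 ^ n) (by positivity) ?_ z hx
      exact exists_potInt_pow_bound hq (by positivity) n
    -- Dominated convergence exchanges sum and integral; with the index shift this is the fixed
    -- point equation.
    have hs : HasSum (fun n => ∫ y in (0 : ℝ)..x, green l z x y * (q y : ℂ) * iter l q n z y)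
        (∫ y in (0 : ℝ)..x, green l z x y * (q y : ℂ) * regularSolution l q z y) := by
      refine intervalIntegral.hasSum_integral_of_dominated_convergence
        (fun n y => C * pw l z x * (y * qTilde l q y * a n)) (fun n => ?_) (fun n => ?_) ?_ ?_ ?_
      · rw [uIoc_of_le hx.1.le]
        exact (hint n).1.aestronglyMeasurable
      · refine Eventually.of_forall fun y hy => ?_
        rw [uIoc_of_le hx.1.le] at hy
        exact hG.integrand_le hC hy.1 hy.2 hx.2 (ha0 n) (hbound n z y ⟨hy.1, hy.2.trans hx.2⟩)
      · exact Eventually.of_forall fun y _ =>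
          (hasum.summable.mul_left (y * qTilde l q y)).mul_left _
      · simp_rw [tsum_mul_left]
        exact ((hq.intervalIntegrable hx').mul_const _).const_mul _
      · refine Eventually.of_forall fun y hy => ?_
        rw [uIoc_of_le hx.1.le] at hy
        exact (hsummable z y ⟨hy.1, hy.2.trans hx.2⟩).hasSum.mul_left _
    rw [volterra, ← hs.tsum_eq]
    refine tsum_congr fun n => ?_
    rw [iter_succ]
    rfl

end

section

/-! ### Absolutely continuous complex-valued functions -/

lemma absolutelyContinuousOnInterval_congr {f g : ℝ → ℂ} {a b : ℝ}
    (hf : AbsolutelyContinuousOnInterval f a b) (h : EqOn g f (uIcc a b)) :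
    AbsolutelyContinuousOnInterval g a b := by
  rw [absolutelyContinuousOnInterval_iff] at hf ⊢
  intro ε hε
  obtain ⟨δ, hδ, hE⟩ := hf ε hε
  refine ⟨δ, hδ, fun E hmem hlen => ?_⟩
  refine lt_of_eq_of_lt (Finset.sum_congr rfl fun i hi => ?_) (hE E hmem hlen)
  have hi' := hmem.1 i hi
  rw [h hi'.1, h hi'.2]

lemma absolutelyContinuousOnInterval_of_hasDerivAt {u v : ℝ → ℂ} {a b : ℝ}
    (hu : ∀ x ∈ uIcc a b, HasDerivAt u (v x) x) (hv : ContinuousOn v (uIcc a b)) :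
    AbsolutelyContinuousOnInterval u a b := by
  obtain ⟨C, hC⟩ := isCompact_uIcc.exists_bound_of_continuousOn hv
  have hC' : ∀ x ∈ uIcc a b, ‖v x‖₊ ≤ C.toNNReal := fun x hx => by
    rw [← NNReal.coe_le_coe, coe_nnnorm]
    exact (hC x hx).trans (Real.le_coe_toNNReal C)
  exact ((convex_uIcc a b).lipschitzOnWith_of_nnnorm_hasDerivWithin_le
    (fun x hx => (hu x hx).hasDerivWithinAt) hC').absolutelyContinuousOnInterval

lemma absolutelyContinuousOnInterval_const (w : ℂ) (a b : ℝ) :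
    AbsolutelyContinuousOnInterval (fun _ : ℝ => w) a b :=
  absolutelyContinuousOnInterval_of_hasDerivAt (fun x _ => hasDerivAt_const x w) continuousOn_const

/-- Reduction to the real and imaginary parts. -/
lemma absolutelyContinuousOnInterval_integral {f : ℝ → ℂ} {a b : ℝ}
    (hf : IntervalIntegrable f volume a b) :
    AbsolutelyContinuousOnInterval (fun x => ∫ t in a..x, f t) a b := by
  have hre : IntervalIntegrable (fun t => (f t).re) volume a b := ⟨hf.1.re, hf.2.re⟩
  have him : IntervalIntegrable (fun t => (f t).im) volume a b := ⟨hf.1.im, hf.2.im⟩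
  have h1 := hre.absolutelyContinuousOnInterval_intervalIntegral (c := a) (by simp)
  have h2 := him.absolutelyContinuousOnInterval_intervalIntegral (c := a) (by simp)
  have h := (h1.fun_smul (absolutelyContinuousOnInterval_const 1 a b)).fun_add
    (h2.fun_smul (absolutelyContinuousOnInterval_const Complex.I a b))
  refine absolutelyContinuousOnInterval_congr h fun x hx => ?_
  have hsub : IntervalIntegrable f volume a x :=
    hf.mono_set (uIcc_subset_uIcc left_mem_uIcc hx)
  have e1 : (∫ t in a..x, f t).re = ∫ t in a..x, (f t).re :=
    (Complex.reCLM.intervalIntegral_comp_comm hsub).symm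
  have e2 : (∫ t in a..x, f t).im = ∫ t in a..x, (f t).im :=
    (Complex.imCLM.intervalIntegral_comp_comm hsub).symm
  rw [← e1, ← e2]
  simp

/-- An absolutely continuous function whose a.e. derivative is continuous is differentiable. -/
lemma hasDerivWithinAt_of_absolutelyContinuous {f g : ℝ → ℂ} {a b : ℝ} (hab : a ≤ b)
    (hf : AbsolutelyContinuousOnInterval f a b) (hg : ContinuousOn g (Icc a b))
    (hae : ∀ᵐ x, x ∈ uIcc a b → HasDerivAt f (g x) x) {x : ℝ} (hx : x ∈ Icc a b) :
    HasDerivWithinAt f (g x) (Icc a b) x := by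
  have hu : uIcc a b = Icc a b := uIcc_of_le hab
  have hgi : IntervalIntegrable g volume a b := (hu ▸ hg).intervalIntegrable
  -- The difference `f - ∫ g` is absolutely continuous with derivative zero almost everywhere, hence
  -- constant.
  have hD : AbsolutelyContinuousOnInterval (fun x => f x - ∫ t in a..x, g t) a b :=
    hf.fun_sub (absolutelyContinuousOnInterval_integral hgi)
  obtain ⟨c, hc⟩ := hD.const_of_ae_hasDerivAt_zero (by
    filter_upwards [hae, hgi.ae_hasDerivAt_integral] with y h1 h2 hy
    have := (h1 hy).sub (h2 hy a left_mem_uIcc)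
    rwa [sub_self] at this)
  have hfx : ∀ y ∈ Icc a b, f y = c + ∫ t in a..y, g t := fun y hy => by
    have : f y - ∫ t in a..y, g t = c := hc y (hu ▸ hy)
    rw [← this, sub_add_cancel]
  have : Fact (x ∈ Icc a b) := ⟨hx⟩
  have hsub : IntervalIntegrable g volume a x :=
    hgi.mono_set (uIcc_subset_uIcc left_mem_uIcc (hu ▸ hx))
  have hder := intervalIntegral.integral_hasDerivWithinAt_right (s := Icc a b) (t := Icc a b) hsub
    (hg.stronglyMeasurableAtFilter_nhdsWithin measurableSet_Icc x) (hg x hx)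
  exact (hder.const_add c).congr hfx (hfx x hx)

variable {l : ℝ} {q : ℝ → ℝ}

/-! ### From the integral equation to the differential equation. -/

section Solution

variable {z : ℂ} {f : ℝ → ℂ} {K : ℝ}

lemma ddx_eq {f : ℝ → ℂ} {d : ℂ} {x : ℝ} (hx : x ∈ Ioc (0 : ℝ) 1)
    (h : HasDerivWithinAt f d (Ioc 0 1) x) : ddx f x = d :=
  h.derivWithin (uniqueDiffOn_Ioc 0 1 x hx)

/-- A continuous solution of the integral equation solves the differential equation. -/
lemma Frobenius.isSolution (F : Frobenius l) (hl : -1 / 2 ≤ l) (hq : IsPotential l q)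
    (hfc : ContinuousOn f (Ioc 0 1)) (hf : ∀ y ∈ Ioc (0 : ℝ) 1, ‖f y‖ ≤ K * y ^ (l + 1))
    (heq : ∀ x ∈ Ioc (0 : ℝ) 1,
      f x = phiFree l z x + ∫ y in (0 : ℝ)..x, green l z x y * (q y : ℂ) * f y) :
    IsSolution l q z f ∧ ∀ x ∈ Ioc (0 : ℝ) 1,
      ddx f x = dphi l z x + ∫ y in (0 : ℝ)..x, dgreen l z x y * (q y : ℂ) * f y := by
  obtain ⟨hi1, hi2⟩ := F.intervalIntegrable_split (z := z) hl hq hfc hf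
  set A : ℝ → ℂ := fun x => ∫ y in (0 : ℝ)..x, thetaFree l z y * (q y : ℂ) * f y with hA
  set B : ℝ → ℂ := fun x => ∫ y in (0 : ℝ)..x, phiFree l z y * (q y : ℂ) * f y with hB
  -- Variation of constants: `g` is the formal derivative of `f₀`, without `φ_l A' - θ_l B'`, which
  -- cancels since `A' = θ_l q f` and `B' = φ_l q f`.
  set f₀ : ℝ → ℂ := fun x => phiFree l z x * (1 + A x) - thetaFree l z x * B x with hf₀
  set g : ℝ → ℂ := fun x => dphi l z x * (1 + A x) - dtheta l z x * B x with hg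
  have hff₀ : ∀ x ∈ Ioc (0 : ℝ) 1, f x = f₀ x := by
    intro x hx
    rw [heq x hx]
    have := (F.integral_split (z := z) hl hq hfc hf (phiFree l z x) (thetaFree l z x) hx).2
    simp only [green]
    rw [this]
    simp only [hf₀, hA, hB]
    ring
  have hg_eq : ∀ x ∈ Ioc (0 : ℝ) 1,
      g x = dphi l z x + ∫ y in (0 : ℝ)..x, dgreen l z x y * (q y : ℂ) * f y := by
    intro x hx
    have := (F.integral_split (z := z) hl hq hfc hf (dphi l z x) (dtheta l z x) hx).2
    simp only [dgreen]
    rw [this]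
    simp only [hg, hA, hB]
    ring
  have hAac := absolutelyContinuousOnInterval_integral hi1
  have hBac := absolutelyContinuousOnInterval_integral hi2
  have hu : uIcc (0 : ℝ) 1 = Icc 0 1 := uIcc_of_le zero_le_one
  have hdA : ∀ᵐ x, x ∈ Icc (0 : ℝ) 1 → HasDerivAt A (thetaFree l z x * (q x : ℂ) * f x) x := by
    filter_upwards [hi1.ae_hasDerivAt_integral] with x h hx
    exact h (hu ▸ hx) 0 left_mem_uIcc
  have hdB : ∀ᵐ x, x ∈ Icc (0 : ℝ) 1 → HasDerivAt B (phiFree l z x * (q x : ℂ) * f x) x := by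
    filter_upwards [hi2.ae_hasDerivAt_integral] with x h hx
    exact h (hu ▸ hx) 0 left_mem_uIcc
  have hsubset : ∀ a : ℝ, 0 < a → a < 1 → uIcc a 1 ⊆ uIcc 0 1 := fun a h0 h1 => by
    rw [hu, uIcc_of_le h1.le]
    exact Icc_subset_Icc_left h0.le
  have hcombo : ∀ (s t s' t' : ℝ → ℂ), (∀ x, 0 < x → HasDerivAt s (s' x) x) →
      (∀ x, 0 < x → HasDerivAt t (t' x) x) → ContinuousOn s' (Ioi 0) → ContinuousOn t' (Ioi 0) →
      ∀ a : ℝ, 0 < a → a < 1 →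
        AbsolutelyContinuousOnInterval (fun x => s x * (1 + A x) - t x * B x) a 1 := by
    intro s t s' t' hs ht hs' ht' a h0 h1
    have hsub : uIcc a 1 ⊆ Ioi 0 := fun x hx => by
      rw [uIcc_of_le h1.le] at hx
      exact h0.trans_le hx.1
    have c1 := absolutelyContinuousOnInterval_of_hasDerivAt (fun x hx => hs x (hsub hx))
      (hs'.mono hsub)
    have c2 := absolutelyContinuousOnInterval_of_hasDerivAt (fun x hx => ht x (hsub hx))
      (ht'.mono hsub)
    exact (c1.fun_smul ((absolutelyContinuousOnInterval_const 1 a 1).fun_add (hAac.mono (hsubset a h0 h1)))).fun_sub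
      (c2.fun_smul (hBac.mono (hsubset a h0 h1)))
  have cφ : ContinuousOn (phiFree l z) (Ioi 0) := fun x hx =>
    (F.hasDerivAt_phi z hx).continuousAt.continuousWithinAt
  have cθ : ContinuousOn (thetaFree l z) (Ioi 0) := fun x hx =>
    (F.hasDerivAt_theta z hx).continuousAt.continuousWithinAt
  have cφ' : ContinuousOn (dphi l z) (Ioi 0) := fun x hx =>
    (F.hasDerivAt_dphi z hx).continuousAt.continuousWithinAt
  have cθ' : ContinuousOn (dtheta l z) (Ioi 0) := fun x hx =>
    (F.hasDerivAt_dtheta z hx).continuousAt.continuousWithinAt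
  have cV : ContinuousOn (fun x : ℝ => ((l * (l + 1) / x ^ 2 : ℝ) : ℂ) - z) (Ioi 0) := by
    refine ContinuousOn.sub (Complex.continuous_ofReal.comp_continuousOn
      (continuousOn_const.div (by fun_prop) fun x hx => ?_)) continuousOn_const
    exact pow_ne_zero _ (ne_of_gt hx)
  have hf₀ac := hcombo (phiFree l z) (thetaFree l z) _ _ (fun x hx => F.hasDerivAt_phi z hx)
    (fun x hx => F.hasDerivAt_theta z hx) cφ' cθ'
  have hgac := hcombo (dphi l z) (dtheta l z) _ _ (fun x hx => F.hasDerivAt_dphi z hx)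
    (fun x hx => F.hasDerivAt_dtheta z hx) (cV.mul cφ) (cV.mul cθ)
  have hderiv : ∀ x ∈ Ioc (0 : ℝ) 1, HasDerivWithinAt f (g x) (Ioc 0 1) x := by
    intro x hx
    have ha0 : 0 < x / 2 := by linarith [hx.1]
    have ha1 : x / 2 < 1 := by linarith [hx.1, hx.2]
    have hxm : x ∈ Icc (x / 2) 1 := ⟨by linarith [hx.1], hx.2⟩
    have hu2 : uIcc (x / 2) 1 = Icc (x / 2) 1 := uIcc_of_le ha1.le
    -- `A` and `B` are differentiable only almost everywhere, but `g` is continuous, so `f₀` is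
    -- differentiable at every point. Working on `[x/2, 1]` avoids the singularity.
    have h1 : HasDerivWithinAt f₀ (g x) (Icc (x / 2) 1) x := by
      refine hasDerivWithinAt_of_absolutelyContinuous ha1.le (hf₀ac _ ha0 ha1)
        (hu2 ▸ (hgac _ ha0 ha1).continuousOn) ?_ hxm
      filter_upwards [hdA, hdB] with y h1 h2 hy
      rw [hu2] at hy
      have hy0 : 0 < y := ha0.trans_le hy.1
      have hym : y ∈ Icc (0 : ℝ) 1 := ⟨hy0.le, hy.2⟩
      refine (((F.hasDerivAt_phi z hy0).mul ((h1 hym).const_add 1)).sub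
        ((F.hasDerivAt_theta z hy0).mul (h2 hym))).congr_deriv ?_
      simp only [hg]
      ring
    have h2 : HasDerivWithinAt f₀ (g x) (Ioc 0 1) x := by
      refine h1.mono_of_mem_nhdsWithin ?_
      filter_upwards [self_mem_nhdsWithin,
        mem_nhdsWithin_of_mem_nhds (lt_mem_nhds (show x / 2 < x by linarith [hx.1]))] with y hy hy'
      exact ⟨le_of_lt hy', hy.2⟩
    exact h2.congr hff₀ (hff₀ x hx)
  have hddx : ∀ x ∈ Ioc (0 : ℝ) 1, ddx f x = g x := fun x hx => ddx_eq hx (hderiv x hx)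
  refine ⟨⟨fun x hx => (hderiv x hx).differentiableWithinAt, fun a h0 h1 => ?_, ?_⟩,
    fun x hx => (hddx x hx).trans (hg_eq x hx)⟩
  · refine absolutelyContinuousOnInterval_congr (hgac a h0 h1) fun x hx => ?_
    rw [uIcc_of_le h1.le] at hx
    exact hddx x ⟨h0.trans_le hx.1, hx.2⟩
  · filter_upwards [ae_restrict_mem measurableSet_Ioo, ae_restrict_of_ae hdA,
      ae_restrict_of_ae hdB] with x hx h1 h2
    have hx0 := hx.1
    have hxm : x ∈ Ioc (0 : ℝ) 1 := Ioo_subset_Ioc_self hx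
    have d1 := h1 (Ioo_subset_Icc_self hx)
    have d2 := h2 (Ioo_subset_Icc_self hx)
    have hgd : HasDerivAt g (((l * (l + 1) / x ^ 2 : ℝ) - z) * f x + (q x : ℂ) * f x) x := by
      refine (((F.hasDerivAt_dphi z hx0).mul (d1.const_add 1)).sub
        ((F.hasDerivAt_dtheta z hx0).mul d2)).congr_deriv ?_
      -- The terms `φ_l' A' - θ_l' B'` equal the Wronskian times `q f`; its value `1` yields the
      -- potential term.
      have hw := F.wronskian z hx0
      have e := hff₀ x hxm
      simp only [hf₀] at e
      linear_combination (-((l * (l + 1) / x ^ 2 : ℝ) - z) : ℂ) * e + (q x : ℂ) * f x * hw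
    have h3 : HasDerivWithinAt (ddx f) (((l * (l + 1) / x ^ 2 : ℝ) - z) * f x + (q x : ℂ) * f x)
        (Ioc 0 1) x :=
      hgd.hasDerivWithinAt.congr hddx (hddx x hxm)
    rw [ddx_eq hxm h3]
    push_cast
    ring

end Solution

/-- The estimate of the Volterra integrals in terms of `errorIntegral`. -/
lemma norm_integral_kernel_le (hq : IsPotential l q) {C b s : ℝ} {z : ℂ} {k f : ℝ → ℂ} {x : ℝ}
    (hx : x ∈ Ioc (0 : ℝ) 1) (hC : 0 ≤ C)
    (hk : ∀ y, 0 < y → y ≤ x → ‖k y‖ ≤ C * (wt z x ^ s * wt z y ^ (-l)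
      * Real.exp (|(csqrt z).im| * (x - y)) * logFactor l y))
    (hf : ∀ y ∈ Ioc (0 : ℝ) 1, ‖f y‖ ≤ pw l z y * b) :
    ‖∫ y in (0 : ℝ)..x, k y * (q y : ℂ) * f y‖ ≤ C * b * (x / (1 + Real.sqrt ‖z‖ * x)) ^ s
      * Real.exp (|(csqrt z).im| * x) * errorIntegral l q z x := by
  have hint : IntervalIntegrable (fun y => y * qTilde l q y / (1 + Real.sqrt ‖z‖ * y))
      volume 0 x := by
    simp_rw [div_eq_mul_inv]
    refine (hq.intervalIntegrable ⟨hx.1.le, hx.2⟩).mul_continuousOn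
      (ContinuousOn.inv₀ (by fun_prop) fun y hy => ?_)
    rw [uIcc_of_le hx.1.le] at hy
    have : 0 ≤ Real.sqrt ‖z‖ * y := mul_nonneg (Real.sqrt_nonneg _) hy.1
    linarith
  calc ‖∫ y in (0 : ℝ)..x, k y * (q y : ℂ) * f y‖
      ≤ ∫ y in (0 : ℝ)..x, C * (wt z x ^ s * Real.exp (|(csqrt z).im| * x)) * b
          * (y * qTilde l q y / (1 + Real.sqrt ‖z‖ * y)) := by
        refine intervalIntegral.norm_integral_le_of_norm_le hx.1.le
          (Eventually.of_forall fun y hy => ?_) (hint.const_mul _)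
        have hymem : y ∈ Ioc (0 : ℝ) 1 := ⟨hy.1, hy.2.trans hx.2⟩
        refine (kernel_bound hy.1 hC (hk y hy.1 hy.2) (hf y hymem) (wt_pos z hx.1)
          (zero_le_one.trans (one_le_logFactor hymem))).trans (le_of_eq ?_)
        ring
    _ = _ := by
        rw [intervalIntegral.integral_const_mul, wt, errorIntegral]
        ring

end

end SphericalSchrodinger

end

/-! ### Assembly of the regular solution and its estimates. -/

theorem mainTheorem4 (l : ℝ) (hl : -1 / 2 ≤ l) (q : ℝ → ℝ)
    (hqm : AEMeasurable q (MeasureTheory.volume.restrict (Set.Ioo (0 : ℝ) 1)))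
    (hq : MeasureTheory.IntegrableOn (fun x : ℝ => x * SphericalSchrodinger.qTilde l q x)
      (Set.Ioo (0 : ℝ) 1)) :
    ∃ φ : ℂ → ℝ → ℂ,
      -- `φ(z, ·)` solves `H f = z f`
      (∀ z : ℂ, SphericalSchrodinger.IsSolution l q z (φ z)) ∧
      -- `φ(·, x)` is entire
      (∀ x ∈ Set.Ioc (0 : ℝ) 1, Differentiable ℂ (fun z : ℂ => φ z x)) ∧
      -- the integral equation
      (∀ z : ℂ, ∀ x ∈ Set.Ioc (0 : ℝ) 1,
        IntervalIntegrable (fun y : ℝ => SphericalSchrodinger.green l z x y * (q y : ℂ) * φ z y)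
          MeasureTheory.volume 0 x ∧
        φ z x = SphericalSchrodinger.phiFree l z x +
          ∫ y in (0 : ℝ)..x, SphericalSchrodinger.green l z x y * (q y : ℂ) * φ z y) ∧
      -- the formula for the derivative
      (∀ z : ℂ, ∀ x ∈ Set.Ioc (0 : ℝ) 1,
        IntervalIntegrable (fun y : ℝ =>
            SphericalSchrodinger.ddx (fun t : ℝ => SphericalSchrodinger.green l z t y) x
              * (q y : ℂ) * φ z y)
          MeasureTheory.volume 0 x ∧
        SphericalSchrodinger.ddx (φ z) x =
          SphericalSchrodinger.ddx (SphericalSchrodinger.phiFree l z) x +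
            ∫ y in (0 : ℝ)..x,
              SphericalSchrodinger.ddx (fun t : ℝ => SphericalSchrodinger.green l z t y) x
                * (q y : ℂ) * φ z y) ∧
      -- the two estimates, with a constant independent of `z` and `x`
      ∃ C : ℝ, ∀ z : ℂ, ∀ x ∈ Set.Ioc (0 : ℝ) 1,
        ‖φ z x - SphericalSchrodinger.phiFree l z x‖ ≤
          C * (x / (1 + Real.sqrt ‖z‖ * x)) ^ (l + 1)
            * Real.exp (|(SphericalSchrodinger.csqrt z).im| * x)
            * SphericalSchrodinger.errorIntegral l q z x ∧
        ‖SphericalSchrodinger.ddx (φ z) x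
            - SphericalSchrodinger.ddx (SphericalSchrodinger.phiFree l z) x‖ ≤
          C * (x / (1 + Real.sqrt ‖z‖ * x)) ^ l
            * Real.exp (|(SphericalSchrodinger.csqrt z).im| * x)
            * SphericalSchrodinger.errorIntegral l q z x := by
  obtain ⟨F⟩ := SphericalSchrodinger.nonempty_frobenius hl
  have hpot : SphericalSchrodinger.IsPotential l q := ⟨hqm, hq⟩
  obtain ⟨C₀, hC₀, hφ⟩ := F.exists_phi_weight_bound
  obtain ⟨C, hC, hG⟩ := F.exists_green_bound hl
  obtain ⟨hadm, heq⟩ := F.admissible_regularSolution hl hpot hC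
    (fun z x y h1 h2 h3 => (hG z x y h1 h2 h3).1) hC₀ hφ
  -- `b` bounds the solution relative to the weight `pw`, uniformly in `z` and `x`. The final
  -- constant is `C * b`: one kernel bound applied to this bound.
  set b := C₀ * Real.exp (C * SphericalSchrodinger.potInt l q 1) with hb
  have hb0 : 0 ≤ b := mul_nonneg hC₀ (Real.exp_pos _).le
  have hgrowth := hadm.growth hl hb0 (fun _ _ => le_rfl)
  have hsol := fun z => F.isSolution (z := z) hl hpot (hadm.cont z) (hgrowth z) (heq z)
  have hdφ : ∀ z : ℂ, ∀ x ∈ Set.Ioc (0 : ℝ) 1,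
      SphericalSchrodinger.ddx (SphericalSchrodinger.phiFree l z) x
        = SphericalSchrodinger.dphi l z x := fun z x hx =>
    SphericalSchrodinger.ddx_eq hx (F.hasDerivAt_phi z hx.1).hasDerivWithinAt
  have hdG : ∀ z : ℂ, ∀ x ∈ Set.Ioc (0 : ℝ) 1, ∀ y : ℝ,
      SphericalSchrodinger.ddx (fun t : ℝ => SphericalSchrodinger.green l z t y) x
        = SphericalSchrodinger.dgreen l z x y := fun z x hx y =>
    SphericalSchrodinger.ddx_eq hx ((F.freeSol_green z y).deriv x hx.1).hasDerivWithinAt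
  refine ⟨SphericalSchrodinger.regularSolution l q, fun z => (hsol z).1, hadm.entire,
    fun z x hx => ⟨hadm.intervalIntegrable F hl hpot hb0 (fun _ _ => le_rfl) z hx, heq z x hx⟩,
    fun z x hx => ?_, C * b, fun z x hx => ⟨?_, ?_⟩⟩
  · simp only [hdG z x hx, hdφ z x hx]
    exact ⟨(F.integral_split hl hpot (hadm.cont z) (hgrowth z) _ _ hx).1, (hsol z).2 x hx⟩
  · rw [heq z x hx, add_sub_cancel_left]
    exact SphericalSchrodinger.norm_integral_kernel_le hpot hx hC
      (fun y h1 h2 => (hG z x y h1 h2 hx.2).1) (hadm.bound z)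
  · rw [(hsol z).2 x hx, hdφ z x hx, add_sub_cancel_left]
    exact SphericalSchrodinger.norm_integral_kernel_le hpot hx hC
      (fun y h1 h2 => (hG z x y h1 h2 hx.2).2) (hadm.bound z)
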